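/- Let $d\ge 1$ and let $\Omega\subset\mathbb{R}^d$ be a nonempty open bounded connected polyhedral set: $\Omega$ is the interior of $\overline\Omega$, and $\partial\Omega=\overline\Omega\setminus\Omega$ is contained in a finite union of hyperplanes (equivalently, $\Omega$ is bounded, connected, and the interior of a finite union of convex polytopes). **Discretisations.** A discretisation of $\Omega$ is a triple $\mathcal D=(\mathcal M,\mathcal E,\mathcal P)$ such that: 1. $\mathcal M$ is a finite family of nonempty connected open pairwise disjoint subsets $K$ of $\Omega$ with $\overline\Omega=\bigcup_{K\in\mathcal M}\overline K$. Write $\partial K=\overline K\setminus K$, $|K|$ for the Lebesgue measure and $h_K$ for the diameter of $K$. 2. $\mathcal E$ is a finite family of pairwise disjoint subsets $\sigma$ of $\overline\Omega$. Each $\sigma$ is a nonempty relatively open subset of a hyperplane, with $(d-1)$-dimensional Lebesgue measure $|\sigma|>0$, and $\overline\sigma\setminus\sigma$ has $(d-1)$-dimensional measure $0$. For each $K\in\mathcal M$ there is a subset $\mathcal E_K\subset\mathcal E$ with $\partial K=\bigcup_{\sigma\in\mathcal E_K}\overline\sigma$. Put $\mathcal M_\sigma=\{K\in\mathcal M:\sigma\in\mathcal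 E_K\}$. For each $\sigma\in\mathcal E$, either $\mathcal M_\sigma$ has exactly one element and $\sigma\subset\partial\Omega$ (then $\sigma\in\mathcal E_{\rm ext}$), or $\mathcal M_\sigma$ has exactly two elements (then $\sigma\in\mathcal E_{\rm int}$). Let $x_\sigma$ be the barycentre of $\sigma$ and, for $\sigma\in\mathcal E_K$, let $n_{K,\sigma}$ be the unit normal to $\sigma$ outward to $K$. 3. $\mathcal P=(x_K)_{K\in\mathcal M}$ with $x_K\in K$, each $K$ is star-shaped with respect to $x_K$, and for $\sigma\in\mathcal E_K$ the distance $d_{K,\sigma}$ from $x_K$ to the hyperplane containing $\sigma$ is positive. Let $D_{K,\sigma}=\{(1-t)x_K+ty: t\in(0,1),\,y\in\sigma\}$. The size and the regularity of $\mathcal D$ are $$h_{\mathcal D}=\max_{K\in\mathcal M}h_K,\qquad \theta_{\mathcal D}=\max\Big(\max_{\sigma\in\mathcal E_{\rm int},\,K,L\in\mathcal M_\sigma}\frac{d_{K,\sigma}}{d_{L,\sigma}},\ \max_{K\in\mathcal M,\,\sigma\in\mathcal E_K}\frac{h_K}{d_{K,\sigma}}\Big).$$ **Discrete functions.** $X_{\mathcal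 D}$ is the space of families $v=((v_K)_{K\in\mathcal M},(v_\sigma)_{\sigma\in\mathcal E})$ of real numbers, and $X_{\mathcal D,0}$ is the set of those with $v_\sigma=0$ for all $\sigma\in\mathcal E_{\rm ext}$. For $v\in X_{\mathcal D}$ put $$|v|_X^2=\sum_{K\in\mathcal M}\sum_{\sigma\in\mathcal E_K}\frac{|\sigma|}{d_{K,\sigma}}(v_\sigma-v_K)^2,\qquad \Pi_{\mathcal M}v=v_K\ \text{on } K,$$ $$\nabla_Kv=\frac1{|K|}\sum_{\sigma\in\mathcal E_K}|\sigma|(v_\sigma-v_K)\,n_{K,\sigma},\qquad R_{K,\sigma}v=\frac{\sqrt d}{d_{K,\sigma}}\big(v_\sigma-v_K-\nabla_Kv\cdot(x_\sigma-x_K)\big),$$ $$\nabla_{\mathcal D}v=\nabla_Kv+R_{K,\sigma}v\;n_{K,\sigma}\quad\text{on } D_{K,\sigma}\qquad(K\in\mathcal M,\ \sigma\in\mathcal E_K).$$ **Lemma (weak discrete $H^1$ compactness).** Let $\mathcal F$ be a family of discretisations of $\Omega$ that contains discretisations of arbitrarily small size $h_{\mathcal D}$, and suppose that there is $\theta>0$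 with $\theta_{\mathcal D}\le\theta$ for all $\mathcal D\in\mathcal F$. Let $(u_{\mathcal D})_{\mathcal D\in\mathcal F}$ be such that - $u_{\mathcal D}\in X_{\mathcal D,0}$ for all $\mathcal D\in\mathcal F$; - there is $C>0$ with $|u_{\mathcal D}|_X\le C$ for all $\mathcal D\in\mathcal F$; - there is $u\in L^2(\Omega)$ with $\lim_{h_{\mathcal D}\to0}\|\Pi_{\mathcal M}u_{\mathcal D}-u\|_{L^2(\Omega)}=0$. Then $u\in H^1_0(\Omega)$, and $\nabla_{\mathcal D}u_{\mathcal D}$ converges weakly in $L^2(\Omega)^d$ to $\nabla u$ as $h_{\mathcal D}\to0$. -/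

import Mathlib

open MeasureTheory Filter Topology
open scoped ENNReal ContDiff

noncomputable section

namespace HybridFV

/-- The Euclidean space `ℝ^d`. -/
abbrev Space (d : ℕ) : Type := EuclideanSpace ℝ (Fin d)

variable {d : ℕ}

/-- The hyperplane with normal vector `ν` and equation `ν · x = c`. -/
def hyperplane (ν : Space d) (c : ℝ) : Set (Space d) := {x | inner ℝ ν x = c}

/-- The `(d-1)`-dimensional Lebesgue measure carried by the hyperplane `ν · x = c` (for a unit
vector `ν`): the image of the Lebesgue measure of the Euclidean space `ν^⊥` under `v ↦ c ν + v`.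
(The Hausdorff measure `μH[d-1]` of Mathlib is normalised differently when `d ≥ 3`.) -/
def hyperplaneMeasure (ν : Space d) (c : ℝ) : Measure (Space d) :=
  Measure.map (fun v : (Submodule.span ℝ {ν})ᗮ => c • ν + (v : Space d)) volume

/-- An open bounded connected polyhedral set: its boundary is contained in a finite union of
hyperplanes and it is the interior of its closure (so that it has no slits). Equivalently, it is
bounded and connected, and is the interior of a finite union of convex polytopes. -/
structure IsPolyhedralDomain (Ω : Set (Space d)) : Prop where
  isOpen : IsOpen Ω
  isBounded : Bornology.IsBounded Ω
  isConnected : IsConnected Ω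
  interior_closure : interior (closure Ω) = Ω
  boundary_subset : ∃ H : Finset (Space d × ℝ), (∀ h ∈ H, h.1 ≠ 0) ∧
    closure Ω \ Ω ⊆ ⋃ h ∈ H, hyperplane h.1 h.2

/-- A discretisation `(M, E, P)` of `Ω`. Control volumes are indexed by `Fin numCells`, edges by
`Fin numEdges`. -/
structure Discretisation (Ω : Set (Space d)) where
  /-- the number of control volumes -/
  numCells : ℕ
  /-- the number of edges -/
  numEdges : ℕ
  /-- the control volumes -/
  cell : Fin numCells → Set (Space d)
  cell_isOpen : ∀ K, IsOpen (cell K)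
  cell_isConnected : ∀ K, IsConnected (cell K)
  cell_subset : ∀ K, cell K ⊆ Ω
  cell_disjoint : ∀ K L, K ≠ L → Disjoint (cell K) (cell L)
  closure_eq : closure Ω = ⋃ K, closure (cell K)
  /-- the edges -/
  edge : Fin numEdges → Set (Space d)
  /-- a unit normal vector of the hyperplane that contains the edge (either of the two) -/
  edgeNormal : Fin numEdges → Space d
  /-- the hyperplane that contains the edge `σ` is `{x | edgeNormal σ · x = edgeOffset σ}` -/
  edgeOffset : Fin numEdges → ℝ
  norm_edgeNormal : ∀ σ, ‖edgeNormal σ‖ = 1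
  edge_nonempty : ∀ σ, (edge σ).Nonempty
  edge_subset : ∀ σ, edge σ ⊆ closure Ω
  edge_disjoint : ∀ σ τ, σ ≠ τ → Disjoint (edge σ) (edge τ)
  /-- every edge is a relatively open subset of its hyperplane -/
  edge_isOpen : ∀ σ, ∃ U : Set (Space d), IsOpen U ∧
    edge σ = U ∩ hyperplane (edgeNormal σ) (edgeOffset σ)
  edge_measure_pos :
    ∀ σ, 0 < hyperplaneMeasure (edgeNormal σ) (edgeOffset σ) (edge σ)
  /-- the relative boundary of an edge has zero `(d-1)`-dimensional measure -/
  edge_boundary_null :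
    ∀ σ, hyperplaneMeasure (edgeNormal σ) (edgeOffset σ) (closure (edge σ) \ edge σ) = 0
  /-- the set `E_K` of the edges of the control volume `K` -/
  cellEdges : Fin numCells → Finset (Fin numEdges)
  cell_boundary : ∀ K, closure (cell K) \ cell K = ⋃ σ ∈ cellEdges K, closure (edge σ)
  /-- an edge belongs to one control volume and lies in `∂Ω`, or it belongs to two -/
  edge_cells : ∀ σ,
    ((Finset.univ.filter fun K => σ ∈ cellEdges K).card = 1 ∧ edge σ ⊆ closure Ω \ Ω) ∨
      (Finset.univ.filter fun K => σ ∈ cellEdges K).card = 2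
  /-- the points `x_K` -/
  center : Fin numCells → Space d
  center_mem : ∀ K, center K ∈ cell K
  cell_starConvex : ∀ K, StarConvex ℝ (center K) (cell K)
  center_dist_pos : ∀ K, ∀ σ ∈ cellEdges K,
    0 < Metric.infDist (center K) (hyperplane (edgeNormal σ) (edgeOffset σ))

namespace Discretisation

variable {Ω : Set (Space d)} (D : Discretisation Ω)

/-- The set `M_σ` of the control volumes that have `σ` as an edge. -/
def edgeCells (σ : Fin D.numEdges) : Finset (Fin D.numCells) :=
  Finset.univ.filter fun K => σ ∈ D.cellEdges K

/-- `σ ∈ E_ext`. -/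
def IsExterior (σ : Fin D.numEdges) : Prop := (D.edgeCells σ).card = 1

/-- `σ ∈ E_int`. -/
def IsInterior (σ : Fin D.numEdges) : Prop := (D.edgeCells σ).card = 2

/-- The measure `|K|`. -/
def cellMeasure (K : Fin D.numCells) : ℝ := volume.real (D.cell K)

/-- The hyperplane that contains `σ`. -/
def edgeHyperplane (σ : Fin D.numEdges) : Set (Space d) :=
  hyperplane (D.edgeNormal σ) (D.edgeOffset σ)

/-- The `(d-1)`-dimensional Lebesgue measure on the hyperplane that contains `σ`. -/
def surfaceMeasure (σ : Fin D.numEdges) : Measure (Space d) :=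
  hyperplaneMeasure (D.edgeNormal σ) (D.edgeOffset σ)

/-- The `(d-1)`-dimensional measure `|σ|`. -/
def edgeMeasure (σ : Fin D.numEdges) : ℝ := (D.surfaceMeasure σ).real (D.edge σ)

/-- The barycentre `x_σ`. -/
def barycentre (σ : Fin D.numEdges) : Space d :=
  (D.edgeMeasure σ)⁻¹ • ∫ x in D.edge σ, x ∂(D.surfaceMeasure σ)

/-- The distance `d_{K,σ}` between `x_K` and the hyperplane that contains `σ`. -/
def centerDist (K : Fin D.numCells) (σ : Fin D.numEdges) : ℝ :=
  Metric.infDist (D.center K) (D.edgeHyperplane σ)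

/-- The unit normal `n_{K,σ}` to `σ` outward to `K`. As `K` is star-shaped with respect to `x_K`,
it is the unit normal that points away from `x_K` (see `normal_outward`). -/
def normal (K : Fin D.numCells) (σ : Fin D.numEdges) : Space d :=
  Real.sign (D.edgeOffset σ - inner ℝ (D.edgeNormal σ) (D.center K)) • D.edgeNormal σ

/-- The open cone `D_{K,σ}` with vertex `x_K` and basis `σ`. -/
def cone (K : Fin D.numCells) (σ : Fin D.numEdges) : Set (Space d) :=
  {x | ∃ t ∈ Set.Ioo (0 : ℝ) 1, ∃ y ∈ D.edge σ, x = (1 - t) • D.center K + t • y}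

/-- The size `h_D`. -/
def size : ℝ := ⨆ K, Metric.diam (D.cell K)

/-- The regularity `θ_D`: the maximum of the finite set of all quotients `d_{K,σ} / d_{L,σ}`
(`σ` an interior edge of `K` and `L`) and `h_K / d_{K,σ}` (`σ` an edge of `K`). -/
def regularity : ℝ :=
  sSup ({r | ∃ σ, D.IsInterior σ ∧ ∃ K ∈ D.edgeCells σ, ∃ L ∈ D.edgeCells σ,
      r = D.centerDist K σ / D.centerDist L σ} ∪
    {r | ∃ K, ∃ σ ∈ D.cellEdges K, r = Metric.diam (D.cell K) / D.centerDist K σ})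

/-- The space `X_D`: one real value for every control volume and one for every edge. -/
abbrev X : Type := (Fin D.numCells → ℝ) × (Fin D.numEdges → ℝ)

/-- The space `X_{D,0}`. -/
def X0 : Set D.X := {v | ∀ σ, D.IsExterior σ → v.2 σ = 0}

/-- The semi-norm `|v|_X`. -/
def seminormX (v : D.X) : ℝ :=
  Real.sqrt (∑ K, ∑ σ ∈ D.cellEdges K, D.edgeMeasure σ / D.centerDist K σ * (v.2 σ - v.1 K) ^ 2)

/-- The piecewise constant function `Π_M v`, equal to `v_K` on `K`. -/
def reconstruction (v : D.X) (x : Space d) : ℝ :=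
  ∑ K, (D.cell K).indicator (fun _ => v.1 K) x

/-- `∇_K v`. -/
def cellGradient (v : D.X) (K : Fin D.numCells) : Space d :=
  (D.cellMeasure K)⁻¹ •
    ∑ σ ∈ D.cellEdges K, (D.edgeMeasure σ * (v.2 σ - v.1 K)) • D.normal K σ

/-- `R_{K,σ} v`. -/
def residual (v : D.X) (K : Fin D.numCells) (σ : Fin D.numEdges) : ℝ :=
  Real.sqrt d / D.centerDist K σ *
    (v.2 σ - v.1 K - inner ℝ (D.cellGradient v K) (D.barycentre σ - D.center K))

/-- The stabilised gradient `∇_{K,σ} v`. -/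
def edgeGradient (v : D.X) (K : Fin D.numCells) (σ : Fin D.numEdges) : Space d :=
  D.cellGradient v K + D.residual v K σ • D.normal K σ

/-- The discrete gradient `∇_D v`, equal to `∇_{K,σ} v` on the cone `D_{K,σ}` (these cones are
pairwise disjoint and cover `Ω` up to a null set). -/
def discreteGradient (v : D.X) (x : Space d) : Space d :=
  ∑ K, ∑ σ ∈ D.cellEdges K, (D.cone K σ).indicator (fun _ => D.edgeGradient v K σ) x

theorem centerDist_eq (K : Fin D.numCells) (σ : Fin D.numEdges) :
    D.centerDist K σ = |D.edgeOffset σ - inner ℝ (D.edgeNormal σ) (D.center K)| := by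
  have hν := D.norm_edgeNormal σ
  set ν := D.edgeNormal σ with hνdef
  set c := D.edgeOffset σ with hc
  set a := D.center K with ha
  have hmem : a + (c - inner ℝ ν a) • ν ∈ D.edgeHyperplane σ := by
    change inner ℝ ν (a + (c - inner ℝ ν a) • ν) = c
    rw [inner_add_right, inner_smul_right, real_inner_self_eq_norm_sq, hν]
    ring
  apply le_antisymm
  · refine (Metric.infDist_le_dist_of_mem hmem).trans ?_
    rw [dist_self_add_right, norm_smul, hν, mul_one, Real.norm_eq_abs]
  · refine (Metric.le_infDist ⟨_, hmem⟩).2 ?_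
    intro y hy
    have hy' : inner ℝ ν y = c := hy
    rw [← hy', ← inner_sub_right]
    refine (abs_real_inner_le_norm _ _).trans ?_
    rw [hν, one_mul, ← dist_eq_norm, dist_comm]

theorem norm_normal {K : Fin D.numCells} {σ : Fin D.numEdges} (h : σ ∈ D.cellEdges K) :
    ‖D.normal K σ‖ = 1 := by
  have h0 : 0 < D.centerDist K σ := D.center_dist_pos K σ h
  rw [centerDist_eq] at h0
  rw [normal, norm_smul, D.norm_edgeNormal σ, mul_one]
  rcases lt_or_gt_of_ne (abs_pos.1 h0) with h1 | h1
  · rw [Real.sign_of_neg h1]; simp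
  · rw [Real.sign_of_pos h1]; simp

/-- The vector `n_{K,σ}` points from `x_K` to `σ`. -/
theorem inner_normal (K : Fin D.numCells) {σ : Fin D.numEdges} {x : Space d}
    (hx : x ∈ D.edgeHyperplane σ) :
    inner ℝ (D.normal K σ) (x - D.center K) = D.centerDist K σ := by
  have hx' : inner ℝ (D.edgeNormal σ) x = D.edgeOffset σ := hx
  rw [normal, real_inner_smul_left, inner_sub_right, hx', centerDist_eq]
  set r := D.edgeOffset σ - inner ℝ (D.edgeNormal σ) (D.center K)
  rcases lt_trichotomy r 0 with h | h | h
  · rw [Real.sign_of_neg h, abs_of_neg h]; ring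
  · rw [h]; simp
  · rw [Real.sign_of_pos h, abs_of_pos h]; ring

theorem mem_edgeHyperplane_iff {K : Fin D.numCells} {σ : Fin D.numEdges}
    (h : σ ∈ D.cellEdges K) (x : Space d) :
    x ∈ D.edgeHyperplane σ ↔
      inner ℝ (D.normal K σ) (x - D.center K) = D.centerDist K σ := by
  refine ⟨D.inner_normal K, fun hx => ?_⟩
  have h0 : 0 < D.centerDist K σ := D.center_dist_pos K σ h
  rw [centerDist_eq] at h0
  rw [normal, real_inner_smul_left, inner_sub_right, centerDist_eq] at hx
  change inner ℝ (D.edgeNormal σ) x = D.edgeOffset σ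
  rcases lt_or_gt_of_ne (abs_pos.1 h0) with h1 | h1
  · rw [Real.sign_of_neg h1, abs_of_neg h1] at hx; linarith
  · rw [Real.sign_of_pos h1, abs_of_pos h1] at hx; linarith

theorem edge_subset_boundary {K : Fin D.numCells} {σ : Fin D.numEdges}
    (h : σ ∈ D.cellEdges K) : D.edge σ ⊆ closure (D.cell K) \ D.cell K := by
  rw [D.cell_boundary K]
  exact fun x hx => Set.mem_biUnion h (subset_closure hx)

/-- The radial projection, from `x_K`, onto the hyperplane that contains `σ`. -/
def radial (K : Fin D.numCells) (σ : Fin D.numEdges) (y : Space d) : Space d :=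
  D.center K + (D.centerDist K σ / inner ℝ (D.normal K σ) (y - D.center K)) • (y - D.center K)

theorem radial_mem {K : Fin D.numCells} {σ : Fin D.numEdges} (h : σ ∈ D.cellEdges K)
    {y : Space d} (hy : inner ℝ (D.normal K σ) (y - D.center K) ≠ 0) :
    D.radial K σ y ∈ D.edgeHyperplane σ := by
  rw [D.mem_edgeHyperplane_iff h, radial, add_sub_cancel_left, inner_smul_right]
  field_simp

theorem radial_self {K : Fin D.numCells} {σ : Fin D.numEdges} (h : σ ∈ D.cellEdges K)
    {y : Space d} (hy : y ∈ D.edgeHyperplane σ) : D.radial K σ y = y := by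
  have h0 : 0 < D.centerDist K σ := D.center_dist_pos K σ h
  rw [radial, D.inner_normal K hy, div_self h0.ne', one_smul, add_sub_cancel]

theorem radial_continuousAt {K : Fin D.numCells} {σ : Fin D.numEdges}
    {y : Space d} (hy : inner ℝ (D.normal K σ) (y - D.center K) ≠ 0) :
    ContinuousAt (D.radial K σ) y := by
  unfold radial
  fun_prop (disch := exact hy)

/-- A point of the closure of `K` is not radially beyond an edge of `K`. -/
theorem not_beyond {K : Fin D.numCells} {σ : Fin D.numEdges} (h : σ ∈ D.cellEdges K)
    {w : Space d} (hw : w ∈ closure (D.cell K))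
    (h1 : D.centerDist K σ < inner ℝ (D.normal K σ) (w - D.center K)) :
    D.radial K σ w ∉ D.edge σ := by
  intro hmem
  have h0 : 0 < D.centerDist K σ := D.center_dist_pos K σ h
  obtain ⟨U, hU, hσ⟩ := D.edge_isOpen σ
  have hwU : D.radial K σ w ∈ U := by rw [hσ] at hmem; exact hmem.1
  have e1 : ∀ᶠ k in 𝓝 w, D.radial K σ k ∈ U :=
    (D.radial_continuousAt (h0.trans h1).ne').eventually (hU.mem_nhds hwU)
  have e2 : ∀ᶠ k in 𝓝 w, D.centerDist K σ < inner ℝ (D.normal K σ) (k - D.center K) := by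
    have : Continuous fun k : Space d => inner ℝ (D.normal K σ) (k - D.center K) := by fun_prop
    exact this.continuousAt.eventually (lt_mem_nhds h1)
  obtain ⟨k, hkK, hkU, hk⟩ :=
    ((mem_closure_iff_frequently.1 hw).and_eventually (e1.and e2)).exists
  have hkσ : D.radial K σ k ∈ D.edge σ := by
    rw [hσ]; exact ⟨hkU, D.radial_mem h (h0.trans hk).ne'⟩
  refine (D.edge_subset_boundary h hkσ).2 ?_
  have hpos := h0.trans hk
  have := (D.cell_starConvex K).add_smul_sub_mem hkK
    (t := D.centerDist K σ / inner ℝ (D.normal K σ) (k - D.center K))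
    (by positivity) ((div_le_one hpos).2 hk.le)
  exact this

/-- The vector `n_{K,σ}` is outward to `K`: near `σ`, the set `K` lies exactly on the side of `σ`
from which `n_{K,σ}` points away. -/
theorem normal_outward {K : Fin D.numCells} {σ : Fin D.numEdges} (h : σ ∈ D.cellEdges K)
    {x : Space d} (hx : x ∈ D.edge σ) :
    ∀ᶠ t in 𝓝[>] (0 : ℝ),
      x - t • D.normal K σ ∈ D.cell K ∧ x + t • D.normal K σ ∉ closure (D.cell K) := by
  have h0 : 0 < D.centerDist K σ := D.center_dist_pos K σ h
  obtain ⟨U, hU, hσ⟩ := D.edge_isOpen σ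
  have hxH : x ∈ D.edgeHyperplane σ := by rw [hσ] at hx; exact hx.2
  have hxU : x ∈ U := by rw [hσ] at hx; exact hx.1
  have hxn := D.inner_normal K hxH
  have hnn : inner ℝ (D.normal K σ) (D.normal K σ) = (1 : ℝ) := by
    rw [real_inner_self_eq_norm_sq, D.norm_normal h]; norm_num
  have hev : ∀ᶠ y in 𝓝 x, D.radial K σ y ∈ U := by
    refine (D.radial_continuousAt (by rw [hxn]; exact h0.ne')).eventually ?_
    rw [D.radial_self h hxH]
    exact hU.mem_nhds hxU
  have c1 : Tendsto (fun t : ℝ => x - t • D.normal K σ) (𝓝[>] 0) (𝓝 x) := by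
    have : Continuous fun t : ℝ => x - t • D.normal K σ := by fun_prop
    have := this.tendsto 0
    rw [zero_smul, sub_zero] at this
    exact this.mono_left nhdsWithin_le_nhds
  have c2 : Tendsto (fun t : ℝ => x + t • D.normal K σ) (𝓝[>] 0) (𝓝 x) := by
    have : Continuous fun t : ℝ => x + t • D.normal K σ := by fun_prop
    have := this.tendsto 0
    rw [zero_smul, add_zero] at this
    exact this.mono_left nhdsWithin_le_nhds
  have hsmall : ∀ᶠ t in 𝓝[>] (0 : ℝ), t < D.centerDist K σ :=
    nhdsWithin_le_nhds (gt_mem_nhds h0)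
  filter_upwards [c1.eventually hev, c2.eventually hev, hsmall, self_mem_nhdsWithin]
    with t ht1 ht2 ht3 ht0
  have ht0' : 0 < t := ht0
  constructor
  · by_contra hz
    set z := x - t • D.normal K σ with hzdef
    have hzn : inner ℝ (D.normal K σ) (z - D.center K) = D.centerDist K σ - t := by
      rw [hzdef, sub_right_comm, inner_sub_right, hxn, inner_smul_right, hnn, mul_one]
    obtain ⟨p, hpseg, hpfr⟩ :
        ∃ p ∈ segment ℝ (D.center K) z, p ∈ closure (D.cell K) \ D.cell K := by
      by_contra hno
      push Not at hno
      have hcover : segment ℝ (D.center K) z ⊆ D.cell K ∪ (closure (D.cell K))ᶜ := by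
        intro q hq
        by_cases hqK : q ∈ D.cell K
        · exact Or.inl hqK
        · exact Or.inr fun hqc => hno q hq ⟨hqc, hqK⟩
      obtain ⟨q, -, hq1, hq2⟩ := (convex_segment (D.center K) z).isPreconnected
        (D.cell K) (closure (D.cell K))ᶜ (D.cell_isOpen K) isClosed_closure.isOpen_compl hcover
        ⟨D.center K, left_mem_segment ℝ _ _, D.center_mem K⟩
        ⟨z, right_mem_segment ℝ _ _,
          (hcover (right_mem_segment ℝ _ _)).resolve_left hz⟩
      exact hq2 (subset_closure hq1)
    rw [D.cell_boundary K] at hpfr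
    obtain ⟨τ, hτ, hpτ⟩ := Set.mem_iUnion₂.1 hpfr
    rw [segment_eq_image'] at hpseg
    obtain ⟨s, ⟨hs0, hs1⟩, rfl⟩ := hpseg
    have hp0 : 0 < D.centerDist K τ := D.center_dist_pos K τ hτ
    obtain ⟨V, hV, hτV⟩ := D.edge_isOpen τ
    have hclH : closure (D.edge τ) ⊆ D.edgeHyperplane τ := by
      refine closure_minimal (by rw [hτV]; exact Set.inter_subset_right) ?_
      exact isClosed_eq (by fun_prop) continuous_const
    have hspos : 0 < s := by
      rcases hs0.lt_or_eq with h' | h'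
      · exact h'
      · have := D.inner_normal K (hclH hpτ)
        rw [← h'] at this
        simp at this
        exact absurd this hp0.ne
    have hdt : 0 < D.centerDist K σ - t := by linarith
    set p := D.center K + s • (z - D.center K) with hpdef
    have hpn : inner ℝ (D.normal K σ) (p - D.center K) = s * (D.centerDist K σ - t) := by
      rw [hpdef, add_sub_cancel_left, inner_smul_right, hzn]
    have hpn0 : 0 < inner ℝ (D.normal K σ) (p - D.center K) := by rw [hpn]; positivity
    have hpn1 : inner ℝ (D.normal K σ) (p - D.center K) < D.centerDist K σ := by
      rw [hpn]; nlinarith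
    have hradp : D.radial K σ p = D.radial K σ z := by
      rw [radial, radial, hpn, hzn, hpdef, add_sub_cancel_left, smul_smul]
      congr 2
      field_simp
    have e1 : ∀ᶠ y in 𝓝 p, D.radial K σ y ∈ U := by
      refine (D.radial_continuousAt hpn0.ne').eventually ?_
      rw [hradp]
      exact hU.mem_nhds ht1
    have hc : Continuous fun k : Space d => inner ℝ (D.normal K σ) (k - D.center K) := by
      fun_prop
    obtain ⟨y, hyτ, hyU, hy0, hy1⟩ :=
      ((mem_closure_iff_frequently.1 hpτ).and_eventually (e1.and
        ((hc.continuousAt.eventually (lt_mem_nhds hpn0)).and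
          (hc.continuousAt.eventually (gt_mem_nhds hpn1))))).exists
    have hyσ : D.radial K σ y ∈ D.edge σ := by
      rw [hσ]; exact ⟨hyU, D.radial_mem h hy0.ne'⟩
    have hyH : y ∈ D.edgeHyperplane τ := hclH (subset_closure hyτ)
    set r := D.centerDist K σ / inner ℝ (D.normal K σ) (y - D.center K) with hr
    have hr1 : 1 < r := (one_lt_div hy0).2 hy1
    have hrn : inner ℝ (D.normal K τ) (D.radial K σ y - D.center K)
        = r * D.centerDist K τ := by
      rw [radial, add_sub_cancel_left, inner_smul_right, D.inner_normal K hyH]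
    refine D.not_beyond hτ (D.edge_subset_boundary h hyσ).1 (by rw [hrn]; nlinarith) ?_
    have : D.radial K τ (D.radial K σ y) = y := by
      rw [radial, hrn, radial, add_sub_cancel_left, ← hr, smul_smul]
      have : D.centerDist K τ / (r * D.centerDist K τ) * r = 1 := by
        have : r ≠ 0 := by positivity
        field_simp
      rw [this, one_smul, add_sub_cancel]
    rw [this]
    exact hyτ
  · intro hcl
    have hyn : inner ℝ (D.normal K σ) (x + t • D.normal K σ - D.center K)
        = D.centerDist K σ + t := by
      rw [add_sub_right_comm, inner_add_right, hxn, inner_smul_right, hnn, mul_one]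
    refine D.not_beyond h hcl (by rw [hyn]; linarith) ?_
    rw [hσ]
    exact ⟨ht2, D.radial_mem h (by rw [hyn]; positivity)⟩

end Discretisation

/-- `φ ∈ C_c^∞(Ω)`. -/
def IsTestFunction (Ω : Set (Space d)) (φ : Space d → ℝ) : Prop :=
  ContDiff ℝ ∞ φ ∧ HasCompactSupport φ ∧ tsupport φ ⊆ Ω

/-- `f ∈ L²(Ω)`, for a function with values in `ℝ` or in `ℝ^d`. -/
def MemL2 {F : Type*} [NormedAddCommGroup F] (Ω : Set (Space d)) (f : Space d → F) : Prop :=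
  MemLp f 2 (volume.restrict Ω)

/-- The norm of `L²(Ω)`, with values in `[0,∞]`. -/
def normL2 {F : Type*} [NormedAddCommGroup F] (Ω : Set (Space d)) (f : Space d → F) : ℝ≥0∞ :=
  eLpNorm f 2 (volume.restrict Ω)

/-- `u ∈ H¹(Ω)`, with weak gradient `∇u = G`. -/
def HasWeakGradient (Ω : Set (Space d)) (u : Space d → ℝ) (G : Space d → Space d) : Prop :=
  MemL2 Ω u ∧ MemL2 Ω G ∧ ∀ φ, IsTestFunction Ω φ →
    ∫ x in Ω, u x • gradient φ x = - ∫ x in Ω, φ x • G x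

/-- `u ∈ H¹_0(Ω)`, the closure of `C_c^∞(Ω)` in `H¹(Ω)`. -/
def MemH10 (Ω : Set (Space d)) (u : Space d → ℝ) : Prop :=
  ∃ G, HasWeakGradient Ω u G ∧ ∃ φ : ℕ → Space d → ℝ, (∀ n, IsTestFunction Ω (φ n)) ∧
    Tendsto (fun n => normL2 Ω fun x => φ n x - u x) atTop (𝓝 0) ∧
    Tendsto (fun n => normL2 Ω fun x => gradient (φ n) x - G x) atTop (𝓝 0)

/-- The family `F` of elements of `L²(Ω)^d` converges weakly in `L²(Ω)^d` to `G` along `l`. -/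
def WeaklyTendstoL2 {ι : Type*} (Ω : Set (Space d)) (F : ι → Space d → Space d) (l : Filter ι)
    (G : Space d → Space d) : Prop :=
  (∀ i, MemL2 Ω (F i)) ∧ MemL2 Ω G ∧ ∀ g : Space d → Space d, MemL2 Ω g →
    Tendsto (fun i => ∫ x in Ω, inner ℝ (F i x) (g x)) l (𝓝 (∫ x in Ω, inner ℝ (G x) (g x)))

/-- The filter on the index set of a family of discretisations that expresses `h_D → 0`: a
property holds eventually iff, for some `δ > 0`, it holds for all members with `h_D < δ`. -/
def sizeToZero {ι : Type*} {Ω : Set (Space d)} (D : ι → Discretisation Ω) : Filter ι :=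
  comap (fun i => (D i).size) (𝓝 0)

end HybridFV

end

/-!
Testing `∇_D u_D` against `φ e`, with `φ` smooth and compactly supported in `ℝ^d` but not
necessarily in `Ω`, and integrating by parts on the cones `D_{K,σ}` gives
`∫ φ ⟨∇_D u_D, e⟩ = - ∫ Π_M u_D ⟨∇φ, e⟩ + O(h_D)`: the interior edges cancel by conservativity,
and the exterior ones carry `v_σ = 0`. Since `|·|_X` bounds the `L²` norm of `∇_D`, the discrete
gradients have a weak limit `G`, and the extension of `G` by zero is the weak gradient of the
extension of `u` by zero.

On a polyhedral set this makes `u` a limit of test functions. Truncating the discrete functions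
reduces this to bounded `u`. Such a `u` is cut off at distance `ε` from the boundary and mollified
at a comparable scale. Near a single face a translation of length `2ε` leaves `Ω`, so that the mass
of `u` there is an increment, of size `O(ε)` in `L²`; the points close to two faces form a set of
volume `O(ε²)`, on which `u` is bounded. Hence the gradients of the mollified functions are bounded
in `L²`, and a subspace of a Hilbert space contains the weak limits of its bounded sequences in its
closure.
-/

open scoped NNReal

noncomputable section

namespace HybridFV

/-! ### Slicing by parallel hyperplanes -/

section Slicing

variable {E : Type*} [NormedAddCommGroup E] [InnerProductSpace ℝ E] {ν : E}

theorem smul_add_orthogonal_injective (hν : ‖ν‖ = 1) :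
    Function.Injective (fun p : ℝ × (Submodule.span ℝ {ν})ᗮ => p.1 • ν + (p.2 : E)) := by
  rintro ⟨s, v⟩ ⟨t, w⟩ h
  have hv : ∀ v : (Submodule.span ℝ {ν})ᗮ, inner ℝ ν (v : E) = 0 := fun v =>
    Submodule.mem_orthogonal_singleton_iff_inner_right.1 v.2
  have hst := congrArg (fun x => inner ℝ ν x) h
  simp only [inner_add_right, hv, inner_smul_right, real_inner_self_eq_norm_sq, hν, one_pow,
    mul_one, add_zero] at hst
  subst hst
  simpa using h

variable [FiniteDimensional ℝ E]

theorem finrank_orthogonal_span_singleton (hν : ν ≠ 0) :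
    Module.finrank ℝ (Submodule.span ℝ {ν})ᗮ = Module.finrank ℝ E - 1 := by
  have h := (Submodule.span ℝ {ν}).finrank_add_finrank_orthogonal
  rw [finrank_span_singleton hν] at h
  omega

variable [MeasurableSpace E] [BorelSpace E]

theorem measurePreserving_smul_add_orthogonal (hν : ‖ν‖ = 1) :
    MeasurePreserving (fun p : ℝ × (Submodule.span ℝ {ν})ᗮ => p.1 • ν + (p.2 : E)) := by
  have h_line := (LinearIsometryEquiv.toSpanUnitSingleton (𝕜 := ℝ) ν hν).measurePreserving
  have h_prod := h_line.prod (MeasurePreserving.id (volume : Measure (Submodule.span ℝ {ν})ᗮ))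
  have h_lp := WithLp.volume_preserving_toLp (Submodule.span ℝ {ν}) (Submodule.span ℝ {ν})ᗮ
  have h_sum := (Submodule.span ℝ {ν}).orthogonalDecomposition.symm.measurePreserving
  have h := h_sum.comp (h_lp.comp h_prod)
  rw [← Measure.volume_eq_prod] at h
  convert h using 1
  ext p
  simp

theorem measurableEmbedding_smul_add_orthogonal (hν : ‖ν‖ = 1) :
    MeasurableEmbedding (fun p : ℝ × (Submodule.span ℝ {ν})ᗮ => p.1 • ν + (p.2 : E)) :=
  Continuous.measurableEmbedding (by fun_prop) (smul_add_orthogonal_injective hν)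

end Slicing

section Hyperplane

variable {d : ℕ} {G : Type*} [NormedAddCommGroup G] [NormedSpace ℝ G]

theorem isClosed_hyperplane (ν : Space d) (c : ℝ) : IsClosed (hyperplane ν c) :=
  isClosed_eq (by fun_prop) continuous_const

theorem volume_hyperplane {ν : Space d} (hν : ν ≠ 0) (c : ℝ) : volume (hyperplane ν c) = 0 := by
  let H : AffineSubspace ℝ (Space d) :=
    (AffineSubspace.mk' c ⊥).comap (innerₛₗ ℝ ν).toAffineMap
  have hmem : ∀ x, x ∈ H ↔ x ∈ hyperplane ν c := fun x => by
    simp [H, hyperplane, AffineSubspace.mem_comap, sub_eq_zero]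
  have hne : H ≠ ⊤ := fun htop => by
    have hall : ∀ x, inner ℝ ν x = c := fun x => (hmem x).1 (htop ▸ AffineSubspace.mem_top ℝ _ x)
    exact hν (inner_self_eq_zero.1 ((hall ν).trans ((hall 0).symm.trans (inner_zero_right ν))))
  rw [← Measure.addHaar_affineSubspace volume H hne]
  exact congrArg _ (Set.ext fun x => (hmem x).symm)

theorem measurableEmbedding_smul_add (ν : Space d) (c : ℝ) :
    MeasurableEmbedding (fun v : (Submodule.span ℝ {ν})ᗮ => c • ν + (v : Space d)) :=
  Continuous.measurableEmbedding (by fun_prop) fun v w h => by simpa using h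

theorem integral_hyperplaneMeasure (ν : Space d) (c : ℝ) (F : Space d → G) :
    ∫ y, F y ∂hyperplaneMeasure ν c =
      ∫ v : (Submodule.span ℝ {ν})ᗮ, F (c • ν + (v : Space d)) := by
  rw [hyperplaneMeasure, (measurableEmbedding_smul_add ν c).integral_map]

theorem ae_mem_hyperplane {ν : Space d} (hν : ‖ν‖ = 1) (c : ℝ) :
    ∀ᵐ y ∂hyperplaneMeasure ν c, y ∈ hyperplane ν c := by
  rw [hyperplaneMeasure, (measurableEmbedding_smul_add ν c).ae_map_iff]
  filter_upwards with v
  have : inner ℝ ν (v : Space d) = 0 :=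
    Submodule.mem_orthogonal_singleton_iff_inner_right.1 v.2
  simp [hyperplane, inner_add_right, inner_smul_right, this, hν]

theorem hyperplaneMeasure_lt_top (ν : Space d) (c : ℝ) {A : Set (Space d)}
    (hA : Bornology.IsBounded A) : hyperplaneMeasure ν c A < ⊤ := by
  rw [hyperplaneMeasure, (measurableEmbedding_smul_add ν c).map_apply]
  have hanti : AntilipschitzWith 1 fun v : (Submodule.span ℝ {ν})ᗮ => c • ν + (v : Space d) :=
    AntilipschitzWith.of_le_mul_dist fun v w => by simp [Subtype.dist_eq]
  exact (hanti.isBounded_preimage hA).measure_lt_top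

theorem integral_eq_integral_hyperplaneMeasure {ν : Space d} (hν : ‖ν‖ = 1) {F : Space d → G}
    (hF : Integrable F) : ∫ x, F x = ∫ s : ℝ, ∫ y, F y ∂hyperplaneMeasure ν s := by
  have hm := measurePreserving_smul_add_orthogonal hν
  have he := measurableEmbedding_smul_add_orthogonal hν
  simp only [integral_hyperplaneMeasure]
  rw [← hm.integral_comp he]
  exact integral_prod _ ((hm.integrable_comp_emb he).2 hF)

theorem integral_hyperplaneMeasure_homothety {ν : Space d} (hν : ‖ν‖ = 1) (a : Space d) (c : ℝ)
    {t : ℝ} (ht : t ≠ 0) (F : Space d → G) :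
    |t| ^ (d - 1) • ∫ y, F ((1 - t) • a + t • y) ∂hyperplaneMeasure ν c =
      ∫ y, F y ∂hyperplaneMeasure ν ((1 - t) * inner ℝ ν a + t * c) := by
  have hmem : a - (inner ℝ ν a : ℝ) • ν ∈ (Submodule.span ℝ {ν})ᗮ := by
    rw [Submodule.mem_orthogonal_singleton_iff_inner_right, inner_sub_right, inner_smul_right,
      real_inner_self_eq_norm_sq, hν, one_pow, mul_one, sub_self]
  have hrank : Module.finrank ℝ (Submodule.span ℝ {ν})ᗮ = d - 1 := by
    rw [finrank_orthogonal_span_singleton (norm_ne_zero_iff.1 (hν ▸ one_ne_zero)),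
      finrank_euclideanSpace_fin]
  set s := (1 - t) * inner ℝ ν a + t * c with hs
  have hpoint : ∀ v : (Submodule.span ℝ {ν})ᗮ, (1 - t) • a + t • (c • ν + (v : Space d)) =
      s • ν + ((t • v + (1 - t) • ⟨a - (inner ℝ ν a : ℝ) • ν, hmem⟩ :
        (Submodule.span ℝ {ν})ᗮ) : Space d) := fun v => by
    simp only [hs, Submodule.coe_add, Submodule.coe_smul]
    module
  simp only [integral_hyperplaneMeasure, hpoint]
  rw [Measure.integral_comp_smul volume (fun v : (Submodule.span ℝ {ν})ᗮ => F (s • ν +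
      ((v + (1 - t) • ⟨a - (inner ℝ ν a : ℝ) • ν, hmem⟩ : (Submodule.span ℝ {ν})ᗮ) : Space d))) t,
    integral_add_right_eq_self (fun v : (Submodule.span ℝ {ν})ᗮ => F (s • ν + (v : Space d))),
    hrank, smul_smul, abs_inv, abs_pow, mul_inv_cancel₀ (by positivity), one_smul]

theorem integral_eq_integral_homothety {ν a : Space d} {c : ℝ} (hν : ‖ν‖ = 1)
    (hc : inner ℝ ν a ≠ c) {F : Space d → G} (hF : Integrable F) :
    ∫ x, F x = |c - inner ℝ ν a| • ∫ t : ℝ, |t| ^ (d - 1) •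
      ∫ y, F ((1 - t) • a + t • y) ∂hyperplaneMeasure ν c := by
  set H : ℝ → G := fun s => ∫ y, F y ∂hyperplaneMeasure ν s
  have hH : (∫ t : ℝ, |t| ^ (d - 1) • ∫ y, F ((1 - t) • a + t • y) ∂hyperplaneMeasure ν c) =
      ∫ t : ℝ, H (inner ℝ ν a + (c - inner ℝ ν a) * t) := by
    apply integral_congr_ae
    filter_upwards [Measure.ae_ne volume (0 : ℝ)] with t ht
    rw [integral_hyperplaneMeasure_homothety hν a c ht]
    exact congrArg H (by ring)
  rw [integral_eq_integral_hyperplaneMeasure hν hF, hH,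
    Measure.integral_comp_mul_left (fun t => H (inner ℝ ν a + t)), integral_add_left_eq_self H,
    smul_smul, abs_inv, mul_inv_cancel₀ (abs_ne_zero.2 (sub_ne_zero.2 hc.symm)), one_smul]

end Hyperplane

/-! ### Cones -/

section Cone

variable {d : ℕ}

/-- The open cone with vertex `a` and basis `A`, without its vertex. -/
def openCone (a : Space d) (A : Set (Space d)) : Set (Space d) :=
  {x | ∃ t ∈ Set.Ioo (0 : ℝ) 1, ∃ y ∈ A, x = (1 - t) • a + t • y}

/-- The affine coordinate that vanishes at the vertex `a` and equals `1` on the hyperplane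
`ν · x = c`; the points of a cone on this hyperplane are `(1 - t) a + t y` with `t` their height. -/
def coneHeight (ν : Space d) (c : ℝ) (a x : Space d) : ℝ := inner ℝ ν (x - a) / (c - inner ℝ ν a)

variable {ν a : Space d} {c : ℝ} {A : Set (Space d)}

theorem homothety_sub_center (a y : Space d) (t : ℝ) : (1 - t) • a + t • y - a = t • (y - a) := by
  module

theorem continuous_coneHeight (ν : Space d) (c : ℝ) (a : Space d) :
    Continuous (coneHeight ν c a) := by
  unfold coneHeight
  fun_prop

theorem coneHeight_homothety (hc : inner ℝ ν a ≠ c) {y : Space d} (hy : y ∈ hyperplane ν c)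
    (t : ℝ) : coneHeight ν c a ((1 - t) • a + t • y) = t := by
  have hyc : inner ℝ ν y = c := hy
  rw [coneHeight, homothety_sub_center, inner_smul_right, inner_sub_right, hyc, mul_div_assoc,
    div_self (sub_ne_zero.2 hc.symm), mul_one]

theorem mem_openCone (hc : inner ℝ ν a ≠ c) (hA : A ⊆ hyperplane ν c) {x : Space d} :
    x ∈ openCone a A ↔ coneHeight ν c a x ∈ Set.Ioo (0 : ℝ) 1 ∧
      a + (coneHeight ν c a x)⁻¹ • (x - a) ∈ A := by
  constructor
  · rintro ⟨t, ht, y, hy, rfl⟩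
    rw [coneHeight_homothety hc (hA hy), homothety_sub_center, smul_smul,
      inv_mul_cancel₀ ht.1.ne', one_smul, add_sub_cancel]
    exact ⟨ht, hy⟩
  · rintro ⟨ht, hy⟩
    refine ⟨_, ht, _, hy, ?_⟩
    rw [smul_add, smul_smul, mul_inv_cancel₀ ht.1.ne']
    module

theorem homothety_mem_openCone (hc : inner ℝ ν a ≠ c) (hA : A ⊆ hyperplane ν c) {t : ℝ}
    {y : Space d} (hy : y ∈ hyperplane ν c) :
    (1 - t) • a + t • y ∈ openCone a A ↔ t ∈ Set.Ioo (0 : ℝ) 1 ∧ y ∈ A := by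
  rw [mem_openCone hc hA, coneHeight_homothety hc hy]
  refine and_congr_right fun ht => ?_
  rw [homothety_sub_center, smul_smul, inv_mul_cancel₀ ht.1.ne', one_smul, add_sub_cancel]

theorem measurableSet_openCone (hc : inner ℝ ν a ≠ c) (hA : A ⊆ hyperplane ν c)
    (hAm : MeasurableSet A) : MeasurableSet (openCone a A) := by
  have hheight := (continuous_coneHeight ν c a).measurable
  have hproj : Measurable fun x : Space d => a + (coneHeight ν c a x)⁻¹ • (x - a) := by fun_prop
  have h : openCone a A = coneHeight ν c a ⁻¹' Set.Ioo 0 1 ∩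
      (fun x => a + (coneHeight ν c a x)⁻¹ • (x - a)) ⁻¹' A := Set.ext fun _ => mem_openCone hc hA
  rw [h]
  exact (hheight measurableSet_Ioo).inter (hproj hAm)

theorem isOpen_openCone (hc : inner ℝ ν a ≠ c) {U : Set (Space d)} (hU : IsOpen U) :
    IsOpen (openCone a (U ∩ hyperplane ν c)) := by
  rw [isOpen_iff_mem_nhds]
  intro x hx
  obtain ⟨ht, hy⟩ := (mem_openCone hc Set.inter_subset_right).1 hx
  have hheight := (continuous_coneHeight ν c a).continuousAt (x := x)
  have hproj : ContinuousAt (fun x : Space d => a + (coneHeight ν c a x)⁻¹ • (x - a)) x :=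
    continuousAt_const.add ((hheight.inv₀ ht.1.ne').smul (by fun_prop))
  filter_upwards [hheight (isOpen_Ioo.mem_nhds ht), hproj (hU.mem_nhds hy.1)] with z hz hzU
  refine (mem_openCone hc Set.inter_subset_right).2 ⟨hz, hzU, ?_⟩
  have hz0 : inner ℝ ν (z - a) ≠ 0 := fun h0 => by simp [coneHeight, h0] at hz
  change inner ℝ ν _ = c
  rw [inner_add_right, inner_smul_right, coneHeight, inv_div,
    div_mul_cancel₀ _ hz0]
  ring

theorem isBounded_openCone (hA : Bornology.IsBounded A) : Bornology.IsBounded (openCone a A) := by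
  obtain ⟨R, hR⟩ := hA.subset_ball a
  refine (Metric.isBounded_ball (x := a) (r := R)).subset ?_
  rintro _ ⟨t, ht, y, hy, rfl⟩
  have := hR hy
  rw [Metric.mem_ball, dist_eq_norm] at this ⊢
  rw [homothety_sub_center, norm_smul, Real.norm_of_nonneg ht.1.le]
  nlinarith [norm_nonneg (y - a), ht.1, ht.2]

theorem integral_hyperplaneMeasure_indicator_openCone {G : Type*} [NormedAddCommGroup G]
    [NormedSpace ℝ G] (hν : ‖ν‖ = 1) (hc : inner ℝ ν a ≠ c) (hA : A ⊆ hyperplane ν c)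
    (hAm : MeasurableSet A) (F : Space d → G) (t : ℝ) :
    ∫ y, (openCone a A).indicator F ((1 - t) • a + t • y) ∂hyperplaneMeasure ν c =
      (Set.Ioo (0 : ℝ) 1).indicator
        (fun t => ∫ y in A, F ((1 - t) • a + t • y) ∂hyperplaneMeasure ν c) t := by
  have hcone : ∀ᵐ y ∂hyperplaneMeasure ν c,
      ((1 - t) • a + t • y ∈ openCone a A ↔ t ∈ Set.Ioo (0 : ℝ) 1 ∧ y ∈ A) :=
    (ae_mem_hyperplane hν c).mono fun y hy => homothety_mem_openCone hc hA hy
  by_cases ht : t ∈ Set.Ioo (0 : ℝ) 1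
  · rw [Set.indicator_of_mem ht, ← integral_indicator hAm]
    refine integral_congr_ae (hcone.mono fun y hy => ?_)
    by_cases hyA : y ∈ A
    · simp only [Set.indicator_of_mem hyA, Set.indicator_of_mem (hy.2 ⟨ht, hyA⟩)]
    · simp only [Set.indicator_of_notMem hyA, Set.indicator_of_notMem fun h => hyA (hy.1 h).2]
  · rw [Set.indicator_of_notMem ht]
    refine integral_eq_zero_of_ae (hcone.mono fun y hy => ?_)
    exact Set.indicator_of_notMem (fun h => ht (hy.1 h).1) _

theorem setIntegral_openCone {G : Type*} [NormedAddCommGroup G] [NormedSpace ℝ G] (hν : ‖ν‖ = 1)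
    (hc : inner ℝ ν a ≠ c) (hA : A ⊆ hyperplane ν c) (hAm : MeasurableSet A) {F : Space d → G}
    (hF : IntegrableOn F (openCone a A)) :
    ∫ x in openCone a A, F x = |c - inner ℝ ν a| • ∫ t in (0 : ℝ)..1, t ^ (d - 1) •
      ∫ y in A, F ((1 - t) • a + t • y) ∂hyperplaneMeasure ν c := by
  have hm := measurableSet_openCone hc hA hAm
  rw [← integral_indicator hm, integral_eq_integral_homothety hν hc (hF.integrable_indicator hm),
    intervalIntegral.integral_of_le zero_le_one, integral_Ioc_eq_integral_Ioo,
    ← integral_indicator measurableSet_Ioo]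
  congr 2 with t
  rw [integral_hyperplaneMeasure_indicator_openCone hν hc hA hAm]
  by_cases ht : t ∈ Set.Ioo (0 : ℝ) 1
  · rw [Set.indicator_of_mem ht, Set.indicator_of_mem ht, abs_of_pos ht.1]
  · rw [Set.indicator_of_notMem ht, Set.indicator_of_notMem ht, smul_zero]

theorem volume_real_openCone (hd : 0 < d) (hν : ‖ν‖ = 1) (hc : inner ℝ ν a ≠ c)
    (hA : A ⊆ hyperplane ν c) (hAm : MeasurableSet A) (hAb : Bornology.IsBounded A) :
    volume.real (openCone a A) = |c - inner ℝ ν a| * (hyperplaneMeasure ν c).real A / d := by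
  have h := setIntegral_openCone (F := fun _ => (1 : ℝ)) hν hc hA hAm
    (integrableOn_const (isBounded_openCone hAb).measure_lt_top.ne)
  simp only [setIntegral_const, smul_eq_mul, mul_one, intervalIntegral.integral_mul_const,
    integral_pow, Nat.sub_add_cancel hd, one_pow, Nat.cast_sub hd, Nat.cast_one,
    sub_add_cancel, zero_pow hd.ne', sub_zero] at h
  rw [h]
  ring

theorem setIntegral_sub_openCone (hd : 0 < d) (hν : ‖ν‖ = 1) (hc : inner ℝ ν a ≠ c)
    (hA : A ⊆ hyperplane ν c) (hAm : MeasurableSet A) (hAb : Bornology.IsBounded A) :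
    ∫ x in openCone a A, (x - a) =
      (|c - inner ℝ ν a| / (d + 1)) • ∫ y in A, (y - a) ∂hyperplaneMeasure ν c := by
  have hint : IntegrableOn (fun x : Space d => x - a) (openCone a A) :=
    ((by fun_prop : Continuous fun x : Space d => x - a).continuousOn.integrableOn_compact
      (isBounded_openCone hAb).isCompact_closure).mono_set subset_closure
  have hpow : ∫ t in (0 : ℝ)..1, t ^ (d - 1) * t = 1 / (d + 1) := by
    simp only [← pow_succ, Nat.sub_add_cancel hd]
    simp
  simp only [setIntegral_openCone hν hc hA hAm hint, homothety_sub_center, integral_smul,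
    smul_smul, intervalIntegral.integral_smul_const, hpow, mul_one_div]

end Cone

/-! ### Continuous selections of Lipschitz functions -/

section Selection

variable {ι : Type*} {P : Finset ι} {L : NNReal}

theorem frequently_slope_le_of_selection {f : ℝ → ℝ} (hf : Continuous f) {q : ι → ℝ → ℝ}
    (hq : ∀ i ∈ P, LipschitzWith L (q i)) (hsel : ∀ x, ∃ i ∈ P, f x = q i x) (s : ℝ) :
    ∃ᶠ z in 𝓝[>] s, slope f s z ≤ L := by
  obtain ⟨i, hi, hfreq⟩ : ∃ i ∈ P, ∃ᶠ z in 𝓝[>] s, f z = q i z := by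
    by_contra! hno
    obtain ⟨z, hz⟩ := ((eventually_all_finset P).2 hno).exists
    obtain ⟨i, hi, hiz⟩ := hsel z
    exact hz i hi hiz
  have hs : f s = q i s :=
    (isClosed_eq hf (hq i hi).continuous).mem_of_frequently_of_tendsto hfreq
      (tendsto_id.mono_right nhdsWithin_le_nhds)
  refine (hfreq.and_eventually self_mem_nhdsWithin).mono ?_
  rintro z ⟨hz, hzs⟩
  have hzs' : 0 < z - s := sub_pos.2 hzs
  rw [slope_def_field, div_le_iff₀ hzs', hz, hs]
  have hdist := (hq i hi).dist_le_mul z s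
  rw [Real.dist_eq, Real.dist_eq, abs_of_pos hzs'] at hdist
  exact (le_abs_self _).trans hdist

theorem le_add_of_selection {f : ℝ → ℝ} (hf : Continuous f) {q : ι → ℝ → ℝ}
    (hq : ∀ i ∈ P, LipschitzWith L (q i)) (hsel : ∀ x, ∃ i ∈ P, f x = q i x) :
    f 1 ≤ f 0 + L := by
  have key : ∀ s ∈ Set.Icc (0 : ℝ) 1, f s ≤ f 0 + L * s := by
    refine image_le_of_liminf_slope_right_le_deriv_boundary (B' := fun _ => (L : ℝ))
      hf.continuousOn (by simp) (by fun_prop) (fun s _ => ?_) fun s _ r hr =>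
        (frequently_slope_le_of_selection hf hq hsel s).mono fun z hz => hz.trans_lt hr
    simpa using (((hasDerivAt_id s).const_mul (L : ℝ)).const_add (f 0)).hasDerivWithinAt
  simpa using key 1 (by simp)

theorem lipschitzWith_of_continuous_selection {E : Type*} [NormedAddCommGroup E]
    [NormedSpace ℝ E] {g : E → ℝ} (hg : Continuous g) {p : ι → E → ℝ}
    (hp : ∀ i ∈ P, LipschitzWith L (p i)) (hsel : ∀ x, ∃ i ∈ P, g x = p i x) :
    LipschitzWith L g := by
  refine LipschitzWith.of_le_add_mul L fun y x => ?_
  have h := le_add_of_selection (f := g ∘ AffineMap.lineMap x y) (P := P)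
    (hg.comp AffineMap.lineMap_continuous)
    (fun i hi => (hp i hi).comp (lipschitzWith_lineMap x y)) fun s => hsel _
  simpa [dist_comm] using h

end Selection

/-! ### The gauge of an open star-convex set -/

section Gauge

open scoped Pointwise

variable {E : Type*} [AddCommGroup E] [Module ℝ E] [TopologicalSpace E] [ContinuousSMul ℝ E]
  {s : Set E} {x y : E} {r t : ℝ}

theorem smul_mem_boundary_of_starConvex (hs : StarConvex ℝ 0 s) (h0 : (0 : E) ∈ s)
    (hx : x ∈ closure s) (ht : 0 ≤ t) (htx : t • x ∉ s) (hr : r ∈ Set.Icc t 1) :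
    r • x ∈ closure s \ s := by
  have hr0 : 0 ≤ r := ht.trans hr.1
  refine ⟨map_mem_closure (continuous_const_smul r) hx fun z hz => hs.smul_mem hz hr0 hr.2,
    fun hmem => htx ?_⟩
  rcases hr0.eq_or_lt with rfl | hr0
  · rwa [le_antisymm hr.1 ht, zero_smul]
  · have := hs.smul_mem hmem (div_nonneg ht hr0.le) ((div_le_one hr0).2 hr.1)
    rwa [smul_smul, div_mul_cancel₀ _ hr0.ne'] at this

theorem gauge_lt_iff_mem_smul (ho : IsOpen s) (h0 : (0 : E) ∈ s) (hs : StarConvex ℝ 0 s)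
    (hr : 0 < r) : gauge s x < r ↔ x ∈ r • s := by
  refine ⟨fun h => ?_, gauge_lt_of_mem_smul x r hr ho⟩
  by_contra hx
  exact h.not_ge (le_gauge_of_notMem hs (absorbent_nhds_zero (ho.mem_nhds h0) x) hx)

theorem gauge_lt_one_iff_mem (ho : IsOpen s) (h0 : (0 : E) ∈ s) (hs : StarConvex ℝ 0 s) :
    gauge s x < 1 ↔ x ∈ s := by
  rw [gauge_lt_iff_mem_smul ho h0 hs one_pos, one_smul]

theorem gauge_le_iff_mem_smul_closure (ho : IsOpen s) (h0 : (0 : E) ∈ s) (hs : StarConvex ℝ 0 s)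
    (hcl : ∀ p ∈ closure s, ∀ t ∈ Set.Ico (0 : ℝ) 1, t • p ∈ s) (hr : 0 < r) :
    gauge s x ≤ r ↔ x ∈ r • closure s := by
  rw [Set.mem_smul_set_iff_inv_smul_mem₀ hr.ne']
  constructor
  · intro h
    have hlim : Tendsto (fun q : ℝ => q⁻¹ • x) (𝓝[>] r) (𝓝 (r⁻¹ • x)) :=
      (((continuousAt_inv₀ hr.ne').smul continuousAt_const).tendsto).mono_left nhdsWithin_le_nhds
    refine mem_closure_of_tendsto hlim (eventually_mem_nhdsWithin.mono fun q hq => ?_)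
    have hq0 : 0 < q := hr.trans hq
    exact (Set.mem_smul_set_iff_inv_smul_mem₀ hq0.ne' _ _).1
      ((gauge_lt_iff_mem_smul ho h0 hs hq0).1 (h.trans_lt hq))
  · refine fun h => le_of_forall_gt_imp_ge_of_dense fun q hq => ?_
    have hq0 : 0 < q := hr.trans hq
    refine ((gauge_lt_iff_mem_smul ho h0 hs hq0).2 ?_).le
    have := hcl _ h (q⁻¹ * r) ⟨by positivity, by rwa [inv_mul_lt_iff₀ hq0, mul_one]⟩
    rwa [smul_smul, mul_assoc, mul_inv_cancel₀ hr.ne', mul_one,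
      ← Set.mem_smul_set_iff_inv_smul_mem₀ hq0.ne'] at this

theorem gauge_eq_one_iff_mem_boundary (ho : IsOpen s) (h0 : (0 : E) ∈ s) (hs : StarConvex ℝ 0 s)
    (hcl : ∀ p ∈ closure s, ∀ t ∈ Set.Ico (0 : ℝ) 1, t • p ∈ s) :
    gauge s x = 1 ↔ x ∈ closure s \ s := by
  rw [Set.mem_sdiff, ← gauge_lt_one_iff_mem ho h0 hs, not_lt, ← one_smul ℝ (closure s),
    ← gauge_le_iff_mem_smul_closure ho h0 hs hcl one_pos]
  exact le_antisymm_iff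

theorem continuous_gauge_of_starConvex [T1Space E] (ho : IsOpen s) (h0 : (0 : E) ∈ s)
    (hs : StarConvex ℝ 0 s) (hb : Bornology.IsVonNBounded ℝ s)
    (hcl : ∀ p ∈ closure s, ∀ t ∈ Set.Ico (0 : ℝ) 1, t • p ∈ s) : Continuous (gauge s) := by
  refine OrderTopology.continuous_iff.2 fun r => ⟨?_, ?_⟩
  · rcases lt_trichotomy r 0 with hr | rfl | hr
    · convert isOpen_univ
      exact Set.eq_univ_of_forall fun x => hr.trans_le (gauge_nonneg x)
    · convert (isOpen_compl_singleton (x := (0 : E))) using 1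
      exact Set.ext fun x => gauge_pos (absorbent_nhds_zero (ho.mem_nhds h0)) hb
    · convert ((isClosed_closure (s := s)).smul_of_ne_zero hr.ne').isOpen_compl using 1
      exact Set.ext fun x =>
        not_le.symm.trans (not_congr (gauge_le_iff_mem_smul_closure ho h0 hs hcl hr))
  · rcases le_or_gt r 0 with hr | hr
    · convert isOpen_empty
      exact Set.eq_empty_of_forall_notMem fun x hx => not_lt.2 (hr.trans (gauge_nonneg x)) hx
    · convert ho.smul₀ hr.ne' using 1
      exact Set.ext fun x => gauge_lt_iff_mem_smul ho h0 hs hr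

end Gauge

/-! ### Geometry of the control volumes -/

namespace Discretisation

variable {d : ℕ} {Ω : Set (Space d)} (D : Discretisation Ω)

theorem edgeNormal_ne_zero (σ : Fin D.numEdges) : D.edgeNormal σ ≠ 0 :=
  norm_ne_zero_iff.1 (by rw [D.norm_edgeNormal σ]; exact one_ne_zero)

theorem edge_subset_edgeHyperplane (σ : Fin D.numEdges) : D.edge σ ⊆ D.edgeHyperplane σ := by
  obtain ⟨U, -, h⟩ := D.edge_isOpen σ
  rw [h]
  exact Set.inter_subset_right

theorem closure_edge_subset_edgeHyperplane (σ : Fin D.numEdges) :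
    closure (D.edge σ) ⊆ D.edgeHyperplane σ :=
  closure_minimal (D.edge_subset_edgeHyperplane σ) (isClosed_hyperplane _ _)

theorem measurableSet_edge (σ : Fin D.numEdges) : MeasurableSet (D.edge σ) := by
  obtain ⟨U, hU, h⟩ := D.edge_isOpen σ
  rw [h]
  exact hU.measurableSet.inter (isClosed_hyperplane _ _).measurableSet

theorem isBounded_cell (hΩ : Bornology.IsBounded Ω) (K : Fin D.numCells) :
    Bornology.IsBounded (D.cell K) := hΩ.subset (D.cell_subset K)

theorem isBounded_edge (hΩ : Bornology.IsBounded Ω) (σ : Fin D.numEdges) :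
    Bornology.IsBounded (D.edge σ) := hΩ.closure.subset (D.edge_subset σ)

/-- The cell `K` translated so that `x_K` becomes the origin. -/
def centredCell (K : Fin D.numCells) : Set (Space d) := (D.center K + ·) ⁻¹' D.cell K

/-- The gauge of the cell `K` with respect to `x_K`. -/
def cellGauge (K : Fin D.numCells) (x : Space d) : ℝ := gauge (D.centredCell K) (x - D.center K)

/-- The affine function that vanishes at `x_K` and equals `1` on the hyperplane of `σ`; the gauge
of `K` coincides with it on the cone `D_{K,σ}`. -/
def edgeHeight (K : Fin D.numCells) (σ : Fin D.numEdges) : Space d → ℝ :=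
  coneHeight (D.edgeNormal σ) (D.edgeOffset σ) (D.center K)

variable {D} {K : Fin D.numCells} {σ τ : Fin D.numEdges}

theorem centerDist_pos (h : σ ∈ D.cellEdges K) : 0 < D.centerDist K σ := D.center_dist_pos K σ h

theorem inner_edgeNormal_center_ne (h : σ ∈ D.cellEdges K) :
    inner ℝ (D.edgeNormal σ) (D.center K) ≠ D.edgeOffset σ := by
  have h0 := centerDist_pos h
  rw [centerDist_eq, abs_pos, sub_ne_zero] at h0
  exact h0.symm

theorem edgeHeight_eq (K : Fin D.numCells) (σ : Fin D.numEdges) (x : Space d) :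
    D.edgeHeight K σ x = inner ℝ (D.normal K σ) (x - D.center K) / D.centerDist K σ := by
  rw [edgeHeight, coneHeight, normal, centerDist_eq, real_inner_smul_left]
  rcases lt_trichotomy (D.edgeOffset σ - inner ℝ (D.edgeNormal σ) (D.center K)) 0 with h | h | h
  · rw [Real.sign_of_neg h, abs_of_neg h, neg_one_mul, neg_div_neg_eq]
  · rw [h, abs_zero, div_zero, div_zero]
  · rw [Real.sign_of_pos h, abs_of_pos h, one_mul]

theorem isOpen_centredCell (K : Fin D.numCells) : IsOpen (D.centredCell K) :=
  (D.cell_isOpen K).preimage (continuous_const.add continuous_id)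

theorem zero_mem_centredCell (K : Fin D.numCells) : 0 ∈ D.centredCell K := by
  simpa [centredCell] using D.center_mem K

theorem starConvex_centredCell (K : Fin D.numCells) : StarConvex ℝ 0 (D.centredCell K) := by
  refine starConvex_zero_iff.2 fun x hx t ht0 ht1 => ?_
  have := (D.cell_starConvex K).add_smul_sub_mem hx ht0 ht1
  rwa [add_sub_cancel_left] at this

theorem isBounded_centredCell (hΩ : Bornology.IsBounded Ω) (K : Fin D.numCells) :
    Bornology.IsBounded (D.centredCell K) :=
  (isometry_add_left (D.center K)).antilipschitz.isBounded_preimage (D.isBounded_cell hΩ K)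

theorem mem_boundary_centredCell {x : Space d} :
    x ∈ closure (D.centredCell K) \ D.centredCell K ↔
      ∃ σ ∈ D.cellEdges K, D.center K + x ∈ closure (D.edge σ) := by
  have hcl : closure (D.centredCell K) = (D.center K + ·) ⁻¹' closure (D.cell K) :=
    ((Homeomorph.addLeft (D.center K)).preimage_closure _).symm
  rw [hcl, centredCell, ← Set.preimage_sdiff, D.cell_boundary K]
  simp only [Set.mem_preimage, Set.mem_iUnion, exists_prop]

theorem smul_mem_centredCell {p : Space d} (hp : p ∈ closure (D.centredCell K)) {t : ℝ}
    (ht : t ∈ Set.Ico (0 : ℝ) 1) : t • p ∈ D.centredCell K := by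
  -- Otherwise a whole segment of a ray from `x_K` would lie in the boundary of `K`, whereas the
  -- ray meets each of the finitely many hyperplanes of the edges of `K` at most once.
  by_contra hno
  refine (Set.Icc_infinite ht.2).mono (t := (D.cellEdges K).image fun σ => D.centerDist K σ /
      inner ℝ (D.normal K σ) p) (fun r hr => ?_) (Finset.finite_toSet _)
  obtain ⟨σ, hσ, hmem⟩ := mem_boundary_centredCell.1 (smul_mem_boundary_of_starConvex
    (starConvex_centredCell K) (zero_mem_centredCell K) hp ht.1 hno hr)
  have hr_mul := D.inner_normal K (D.closure_edge_subset_edgeHyperplane σ hmem)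
  rw [add_sub_cancel_left, inner_smul_right] at hr_mul
  have hne : inner ℝ (D.normal K σ) p ≠ 0 := right_ne_zero_of_mul
    (hr_mul.trans_ne (centerDist_pos hσ).ne')
  rw [Finset.coe_image]
  exact ⟨σ, hσ, (eq_div_of_mul_eq hne hr_mul).symm⟩

theorem cellGauge_center (K : Fin D.numCells) : D.cellGauge K (D.center K) = 0 := by
  rw [cellGauge, sub_self, gauge_zero]

theorem cellGauge_lt_one_iff {x : Space d} : D.cellGauge K x < 1 ↔ x ∈ D.cell K := by
  rw [cellGauge, gauge_lt_one_iff_mem (isOpen_centredCell K) (zero_mem_centredCell K)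
    (starConvex_centredCell K), centredCell, Set.mem_preimage, add_sub_cancel]

theorem cellGauge_homothety (h : σ ∈ D.cellEdges K) {y : Space d} (hy : y ∈ closure (D.edge σ))
    {t : ℝ} (ht : 0 ≤ t) : D.cellGauge K ((1 - t) • D.center K + t • y) = t := by
  have hone : gauge (D.centredCell K) (y - D.center K) = 1 :=
    (gauge_eq_one_iff_mem_boundary (isOpen_centredCell K) (zero_mem_centredCell K)
      (starConvex_centredCell K) fun _ hp _ => smul_mem_centredCell hp).2
      (mem_boundary_centredCell.2 ⟨σ, h, by rwa [add_sub_cancel]⟩)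
  rw [cellGauge, homothety_sub_center, gauge_smul_of_nonneg ht, hone, smul_eq_mul, mul_one]

theorem cellGauge_pos (hΩ : Bornology.IsBounded Ω) {x : Space d} (hx : x ≠ D.center K) :
    0 < D.cellGauge K x :=
  (gauge_pos (absorbent_nhds_zero ((isOpen_centredCell K).mem_nhds (zero_mem_centredCell K)))
    (NormedSpace.isVonNBounded_of_isBounded ℝ (isBounded_centredCell hΩ K))).2 (sub_ne_zero.2 hx)

theorem exists_eq_homothety (hΩ : Bornology.IsBounded Ω) {x : Space d} (hx : x ≠ D.center K) :
    ∃ σ ∈ D.cellEdges K, ∃ y ∈ closure (D.edge σ),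
      x = (1 - D.cellGauge K x) • D.center K + D.cellGauge K x • y := by
  have hpos := cellGauge_pos hΩ hx
  obtain ⟨σ, hσ, hy⟩ := mem_boundary_centredCell.1 ((gauge_eq_one_iff_mem_boundary
    (x := (D.cellGauge K x)⁻¹ • (x - D.center K)) (isOpen_centredCell K) (zero_mem_centredCell K)
    (starConvex_centredCell K) fun _ hp _ => smul_mem_centredCell hp).1 <| by
      rw [gauge_smul_of_nonneg (inv_nonneg.2 hpos.le)]
      exact inv_mul_cancel₀ hpos.ne')
  refine ⟨σ, hσ, _, hy, ?_⟩
  rw [smul_add, smul_smul, mul_inv_cancel₀ hpos.ne']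
  module

theorem edgeHeight_homothety (h : σ ∈ D.cellEdges K) {y : Space d}
    (hy : y ∈ D.edgeHyperplane σ) (t : ℝ) :
    D.edgeHeight K σ ((1 - t) • D.center K + t • y) = t :=
  coneHeight_homothety (inner_edgeNormal_center_ne h) hy t

theorem cellGauge_eq_edgeHeight (h : σ ∈ D.cellEdges K) {x : Space d} (hx : x ∈ D.cone K σ) :
    D.cellGauge K x = D.edgeHeight K σ x := by
  obtain ⟨t, ht, y, hy, rfl⟩ := hx
  rw [cellGauge_homothety h (subset_closure hy) ht.1.le,
    edgeHeight_homothety h (D.edge_subset_edgeHyperplane σ hy)]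

theorem cone_subset_cell (h : σ ∈ D.cellEdges K) : D.cone K σ ⊆ D.cell K := by
  rintro x ⟨t, ht, y, hy, rfl⟩
  rw [← cellGauge_lt_one_iff, cellGauge_homothety h (subset_closure hy) ht.1.le]
  exact ht.2

theorem cone_disjoint (hσ : σ ∈ D.cellEdges K) (hτ : τ ∈ D.cellEdges K) (hne : σ ≠ τ) :
    Disjoint (D.cone K σ) (D.cone K τ) := by
  rw [Set.disjoint_left]
  rintro x ⟨t, ht, y, hy, rfl⟩ ⟨s, hs, z, hz, hst⟩
  have hts : t = s := by
    rw [← cellGauge_homothety hσ (subset_closure hy) ht.1.le, hst,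
      cellGauge_homothety hτ (subset_closure hz) hs.1.le]
  subst hts
  have hyz : y = z := smul_right_injective _ ht.1.ne' (add_left_cancel hst)
  exact Set.disjoint_left.1 (D.edge_disjoint σ τ hne) hy (hyz ▸ hz)

theorem isOpen_cone (h : σ ∈ D.cellEdges K) : IsOpen (D.cone K σ) := by
  obtain ⟨U, hU, hσ⟩ := D.edge_isOpen σ
  change IsOpen (openCone (D.center K) (D.edge σ))
  rw [hσ]
  exact isOpen_openCone (inner_edgeNormal_center_ne h) hU

theorem isBounded_cone (hΩ : Bornology.IsBounded Ω) (K : Fin D.numCells) (σ : Fin D.numEdges) :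
    Bornology.IsBounded (D.cone K σ) := isBounded_openCone (D.isBounded_edge hΩ σ)

theorem volume_openCone_boundary_edge (hd : 0 < d) (hΩ : Bornology.IsBounded Ω)
    (h : σ ∈ D.cellEdges K) :
    volume (openCone (D.center K) (closure (D.edge σ) \ D.edge σ)) = 0 := by
  have hb : Bornology.IsBounded (closure (D.edge σ) \ D.edge σ) :=
    (D.isBounded_edge hΩ σ).closure.subset Set.sdiff_subset
  have hvol := volume_real_openCone hd (D.norm_edgeNormal σ) (inner_edgeNormal_center_ne h)
    (Set.sdiff_subset.trans (D.closure_edge_subset_edgeHyperplane σ))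
    (isClosed_closure.measurableSet.diff (D.measurableSet_edge σ)) hb
  rw [measureReal_def _ (closure (D.edge σ) \ D.edge σ), D.edge_boundary_null σ,
    ENNReal.toReal_zero, mul_zero, zero_div] at hvol
  exact (measureReal_eq_zero_iff (isBounded_openCone hb).measure_lt_top.ne).1 hvol

theorem ae_mem_cone (hd : 0 < d) (hΩ : Bornology.IsBounded Ω) (K : Fin D.numCells) :
    ∀ᵐ x, x ∈ D.cell K → ∃ σ ∈ D.cellEdges K, x ∈ D.cone K σ := by
  have : Nonempty (Fin d) := ⟨⟨0, hd⟩⟩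
  have hnull : ∀ᵐ x, ∀ σ ∈ D.cellEdges K,
      x ∉ openCone (D.center K) (closure (D.edge σ) \ D.edge σ) :=
    (eventually_all_finset _).2 fun σ hσ =>
      measure_eq_zero_iff_ae_notMem.1 (volume_openCone_boundary_edge hd hΩ hσ)
  filter_upwards [hnull, Measure.ae_ne volume (D.center K)] with x hx hxa hxK
  obtain ⟨σ, hσ, y, hy, hxy⟩ := exists_eq_homothety hΩ hxa
  have ht : D.cellGauge K x ∈ Set.Ioo (0 : ℝ) 1 :=
    ⟨cellGauge_pos hΩ hxa, cellGauge_lt_one_iff.2 hxK⟩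
  refine ⟨σ, hσ, _, ht, y, ?_, hxy⟩
  by_contra hno
  exact hx σ hσ ⟨_, ht, y, ⟨hy, hno⟩, hxy⟩

theorem volume_boundary_cell (K : Fin D.numCells) :
    volume (closure (D.cell K) \ D.cell K) = 0 := by
  rw [D.cell_boundary K]
  exact (measure_biUnion_null_iff (Finset.countable_toSet _)).2 fun σ _ =>
    measure_mono_null (D.closure_edge_subset_edgeHyperplane σ)
      (volume_hyperplane (D.edgeNormal_ne_zero σ) _)

theorem continuous_cellGauge (hΩ : Bornology.IsBounded Ω) (K : Fin D.numCells) :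
    Continuous (D.cellGauge K) :=
  (continuous_gauge_of_starConvex (isOpen_centredCell K) (zero_mem_centredCell K)
    (starConvex_centredCell K)
    (NormedSpace.isVonNBounded_of_isBounded ℝ (isBounded_centredCell hΩ K))
    fun _ hp _ => smul_mem_centredCell hp).comp (continuous_id.sub continuous_const)

theorem lipschitzWith_edgeHeight (h : σ ∈ D.cellEdges K) :
    LipschitzWith (D.centerDist K σ)⁻¹.toNNReal (D.edgeHeight K σ) := by
  have hpos := centerDist_pos h
  refine LipschitzWith.of_le_add_mul' _ fun x y => ?_
  have hinner := (real_inner_le_norm (D.normal K σ) (x - y)).trans_eq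
    (by rw [D.norm_normal h, one_mul, ← dist_eq_norm])
  rw [← sub_sub_sub_cancel_right x y (D.center K), inner_sub_right] at hinner
  rw [edgeHeight_eq, edgeHeight_eq, ← sub_le_iff_le_add', ← sub_div, inv_mul_eq_div]
  exact div_le_div_of_nonneg_right hinner hpos.le

theorem exists_lipschitzWith_cellGauge (hd : 0 < d) (hΩ : Bornology.IsBounded Ω)
    (K : Fin D.numCells) : ∃ L, LipschitzWith L (D.cellGauge K) := by
  have : Nonempty (Fin d) := ⟨⟨0, hd⟩⟩
  refine ⟨(D.cellEdges K).sup fun σ => (D.centerDist K σ)⁻¹.toNNReal,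
    lipschitzWith_of_continuous_selection (continuous_cellGauge hΩ K)
      (fun σ hσ => (lipschitzWith_edgeHeight hσ).weaken (Finset.le_sup (f := fun σ =>
        (D.centerDist K σ)⁻¹.toNNReal) hσ)) fun x => ?_⟩
  rcases eq_or_ne x (D.center K) with rfl | hx
  · obtain ⟨z, hz⟩ := exists_ne (D.center K)
    obtain ⟨σ, hσ, -⟩ := exists_eq_homothety hΩ hz
    exact ⟨σ, hσ, by rw [cellGauge_center, edgeHeight, coneHeight, sub_self, inner_zero_right,
      zero_div]⟩
  · obtain ⟨σ, hσ, y, hy, hxy⟩ := exists_eq_homothety hΩ hx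
    refine ⟨σ, hσ, ?_⟩
    conv_rhs => rw [hxy]
    exact (edgeHeight_homothety hσ (D.closure_edge_subset_edgeHyperplane σ hy) _).symm

end Discretisation

theorem hasLineDerivAt_of_affine {E : Type*} [AddCommGroup E] [Module ℝ E] {f : E → ℝ} {x v : E}
    {c : ℝ} (h : ∀ t : ℝ, f (x + t • v) = f x + t * c) : HasLineDerivAt ℝ f c x v := by
  rw [HasLineDerivAt, funext h]
  simpa using ((hasDerivAt_id (0 : ℝ)).mul_const c).const_add (f x)

theorem lineDeriv_inner_sub {d : ℕ} (b a x v : Space d) :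
    lineDeriv ℝ (fun x : Space d => inner ℝ b (x - a)) x v = inner ℝ b v := by
  refine (hasLineDerivAt_of_affine fun t => ?_).lineDeriv
  rw [add_sub_right_comm, inner_add_right, inner_smul_right]

theorem lipschitzWith_inner_sub {d : ℕ} (b a : Space d) :
    LipschitzWith ‖innerSL ℝ b‖₊ fun x : Space d => inner ℝ b (x - a) := fun x y => by
  simpa only [innerSL_apply_apply, edist_sub_right]
    using (innerSL ℝ b).lipschitz (x - a) (y - a)

namespace Discretisation

variable {d : ℕ} {Ω : Set (Space d)} {D : Discretisation Ω}
  {K L : Fin D.numCells} {σ : Fin D.numEdges}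

/-! ### Measures of edges, cones and cells -/

theorem surfaceMeasure_edge_ne_top (hΩ : Bornology.IsBounded Ω) (σ : Fin D.numEdges) :
    D.surfaceMeasure σ (D.edge σ) ≠ ⊤ :=
  (hyperplaneMeasure_lt_top _ _ (D.isBounded_edge hΩ σ)).ne

theorem edgeMeasure_pos (hΩ : Bornology.IsBounded Ω) (σ : Fin D.numEdges) :
    0 < D.edgeMeasure σ :=
  ENNReal.toReal_pos (D.edge_measure_pos σ).ne' (surfaceMeasure_edge_ne_top hΩ σ)

theorem cellMeasure_pos (hΩ : Bornology.IsBounded Ω) (K : Fin D.numCells) :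
    0 < D.cellMeasure K :=
  ENNReal.toReal_pos ((D.cell_isOpen K).measure_pos _ ⟨_, D.center_mem K⟩).ne'
    (D.isBounded_cell hΩ K).measure_lt_top.ne

theorem integrableOn_edge (hΩ : Bornology.IsBounded Ω) (σ : Fin D.numEdges) {F : Type*}
    [NormedAddCommGroup F] {f : Space d → F} (hf : Continuous f) :
    IntegrableOn f (D.edge σ) (D.surfaceMeasure σ) := by
  obtain ⟨C, hC⟩ := ((D.isBounded_edge hΩ σ).isCompact_closure.image hf).isBounded.exists_norm_le
  refine Measure.integrableOn_of_bounded (M := C) (surfaceMeasure_edge_ne_top hΩ σ)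
    hf.aestronglyMeasurable ?_
  filter_upwards [ae_restrict_mem (D.measurableSet_edge σ)] with x hx
  exact hC _ ⟨x, subset_closure hx, rfl⟩

theorem integrableOn_cone (hΩ : Bornology.IsBounded Ω) (K : Fin D.numCells) (σ : Fin D.numEdges)
    {F : Type*} [NormedAddCommGroup F] {f : Space d → F} (hf : Continuous f) :
    IntegrableOn f (D.cone K σ) :=
  (hf.continuousOn.integrableOn_compact
    (isBounded_cone hΩ K σ).isCompact_closure).mono_set subset_closure

theorem setIntegral_sub_edge (hΩ : Bornology.IsBounded Ω) (σ : Fin D.numEdges) (a : Space d) :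
    ∫ y in D.edge σ, (y - a) ∂(D.surfaceMeasure σ) = D.edgeMeasure σ • (D.barycentre σ - a) := by
  rw [integral_sub (f := fun y => y) (integrableOn_edge hΩ σ continuous_id)
    (integrableOn_edge hΩ σ continuous_const), setIntegral_const, barycentre, smul_sub, smul_smul,
    mul_inv_cancel₀ (edgeMeasure_pos hΩ σ).ne', one_smul]
  rfl

theorem inner_normal_barycentre (hΩ : Bornology.IsBounded Ω) (K : Fin D.numCells)
    (σ : Fin D.numEdges) :
    inner ℝ (D.normal K σ) (D.barycentre σ - D.center K) = D.centerDist K σ := by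
  refine mul_left_cancel₀ (edgeMeasure_pos hΩ σ).ne' ?_
  calc D.edgeMeasure σ * inner ℝ (D.normal K σ) (D.barycentre σ - D.center K)
      = ∫ y in D.edge σ, inner ℝ (D.normal K σ) (y - D.center K) ∂(D.surfaceMeasure σ) := by
        rw [integral_inner (integrableOn_edge hΩ σ (by fun_prop)), setIntegral_sub_edge hΩ,
          inner_smul_right]
    _ = ∫ _ in D.edge σ, D.centerDist K σ ∂(D.surfaceMeasure σ) :=
        setIntegral_congr_fun (D.measurableSet_edge σ) fun y hy =>
          D.inner_normal K (D.edge_subset_edgeHyperplane σ hy)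
    _ = D.edgeMeasure σ * D.centerDist K σ := setIntegral_const _

theorem norm_barycentre_sub_le (hΩ : Bornology.IsBounded Ω) (h : σ ∈ D.cellEdges K) :
    ‖D.barycentre σ - D.center K‖ ≤ Metric.diam (D.cell K) := by
  have hpos := edgeMeasure_pos hΩ σ
  have hle : ‖∫ y in D.edge σ, (y - D.center K) ∂(D.surfaceMeasure σ)‖ ≤
      Metric.diam (D.cell K) * D.edgeMeasure σ := by
    refine norm_setIntegral_le_of_norm_le_const
      (surfaceMeasure_edge_ne_top hΩ σ).lt_top fun y hy => ?_
    rw [← dist_eq_norm, ← Metric.diam_closure]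
    exact Metric.dist_le_diam_of_mem (D.isBounded_cell hΩ K).closure
      (D.edge_subset_boundary h hy).1 (subset_closure (D.center_mem K))
  rw [setIntegral_sub_edge hΩ, norm_smul, Real.norm_of_nonneg hpos.le, mul_comm] at hle
  exact le_of_mul_le_mul_right hle hpos

theorem volume_real_cone (hd : 0 < d) (hΩ : Bornology.IsBounded Ω) (h : σ ∈ D.cellEdges K) :
    volume.real (D.cone K σ) = D.centerDist K σ * D.edgeMeasure σ / d := by
  rw [centerDist_eq]
  exact volume_real_openCone hd (D.norm_edgeNormal σ) (inner_edgeNormal_center_ne h)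
    (D.edge_subset_edgeHyperplane σ) (D.measurableSet_edge σ) (D.isBounded_edge hΩ σ)

theorem setIntegral_sub_cone (hd : 0 < d) (hΩ : Bornology.IsBounded Ω) (h : σ ∈ D.cellEdges K) :
    ∫ x in D.cone K σ, (x - D.center K) =
      (D.centerDist K σ * D.edgeMeasure σ / (d + 1)) • (D.barycentre σ - D.center K) := by
  rw [mul_div_right_comm, mul_smul, ← setIntegral_sub_edge hΩ, centerDist_eq]
  exact setIntegral_sub_openCone hd (D.norm_edgeNormal σ) (inner_edgeNormal_center_ne h)
    (D.edge_subset_edgeHyperplane σ) (D.measurableSet_edge σ) (D.isBounded_edge hΩ σ)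

theorem setIntegral_cell (hd : 0 < d) (hΩ : Bornology.IsBounded Ω) (K : Fin D.numCells)
    {F : Type*} [NormedAddCommGroup F] [NormedSpace ℝ F] {f : Space d → F}
    (hf : IntegrableOn f (D.cell K)) :
    ∫ x in D.cell K, f x = ∑ σ ∈ D.cellEdges K, ∫ x in D.cone K σ, f x := by
  have hcover : (D.cell K : Set (Space d)) =ᵐ[volume] ⋃ σ ∈ D.cellEdges K, D.cone K σ := by
    refine eventuallyEq_set.2 ?_
    filter_upwards [ae_mem_cone hd hΩ K] with x hx
    simp only [Set.mem_iUnion, exists_prop]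
    exact ⟨hx, fun ⟨σ, hσ, hxσ⟩ => cone_subset_cell hσ hxσ⟩
  rw [setIntegral_congr_set hcover, integral_biUnion_finset]
  · exact fun σ hσ => (isOpen_cone hσ).measurableSet
  · exact fun σ hσ τ hτ hne => cone_disjoint hσ hτ hne
  · exact fun σ hσ => hf.mono_set (cone_subset_cell hσ)

theorem sum_volume_cone (hd : 0 < d) (hΩ : Bornology.IsBounded Ω) (K : Fin D.numCells) :
    ∑ σ ∈ D.cellEdges K, volume.real (D.cone K σ) = D.cellMeasure K := by
  have h := setIntegral_cell hd hΩ K (f := fun _ => (1 : ℝ))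
    (integrableOn_const (D.isBounded_cell hΩ K).measure_lt_top.ne)
  simp only [setIntegral_const, smul_eq_mul, mul_one] at h
  exact h.symm

theorem sum_centerDist_mul_edgeMeasure (hd : 0 < d) (hΩ : Bornology.IsBounded Ω)
    (K : Fin D.numCells) :
    ∑ σ ∈ D.cellEdges K, D.centerDist K σ * D.edgeMeasure σ = d * D.cellMeasure K := by
  have hd' : (d : ℝ) ≠ 0 := by positivity
  rw [← sum_volume_cone hd hΩ, Finset.mul_sum]
  refine Finset.sum_congr rfl fun σ hσ => ?_
  rw [volume_real_cone hd hΩ hσ, mul_div_cancel₀ _ hd']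

/-! ### Integration by parts against the tent function of a cell -/

variable (D) in
/-- The tent function of `K`: the continuous function that equals `1` at `x_K`, vanishes outside
`K` and is affine on every cone `D_{K,σ}`. -/
def tent (K : Fin D.numCells) (x : Space d) : ℝ := max (1 - D.cellGauge K x) 0

theorem tent_eq_zero {x : Space d} (hx : x ∉ D.cell K) : D.tent K x = 0 := by
  rw [← cellGauge_lt_one_iff, not_lt] at hx
  exact max_eq_right (sub_nonpos.2 hx)

theorem tent_eq (h : σ ∈ D.cellEdges K) {x : Space d} (hx : x ∈ D.cone K σ) :
    D.tent K x = 1 - inner ℝ (D.normal K σ) (x - D.center K) / D.centerDist K σ := by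
  have hlt := cellGauge_lt_one_iff.2 (cone_subset_cell h hx)
  rw [tent, max_eq_left (sub_nonneg.2 hlt.le), cellGauge_eq_edgeHeight h hx, edgeHeight_eq]

theorem exists_lipschitzWith_tent (hd : 0 < d) (hΩ : Bornology.IsBounded Ω)
    (K : Fin D.numCells) : ∃ C, LipschitzWith C (D.tent K) := by
  obtain ⟨C, hC⟩ := exists_lipschitzWith_cellGauge hd hΩ K
  exact ⟨0 + C, ((LipschitzWith.const 1).sub hC).max_const 0⟩

theorem hasCompactSupport_tent (hΩ : Bornology.IsBounded Ω) (K : Fin D.numCells) :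
    HasCompactSupport (D.tent K) :=
  HasCompactSupport.of_support_subset_isCompact (D.isBounded_cell hΩ K).isCompact_closure
    fun _ hx => subset_closure (by_contra fun h => hx (tent_eq_zero h))

theorem lineDeriv_tent_of_mem_cone (h : σ ∈ D.cellEdges K) {x : Space d}
    (hx : x ∈ D.cone K σ) (v : Space d) :
    lineDeriv ℝ (D.tent K) x (-v) = inner ℝ (D.normal K σ) v / D.centerDist K σ := by
  have haffine : D.tent K =ᶠ[𝓝 x] fun x =>
      1 - inner ℝ (D.normal K σ) (x - D.center K) / D.centerDist K σ :=
    ((isOpen_cone h).eventually_mem hx).mono fun _ => tent_eq h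
  rw [haffine.lineDeriv_eq]
  refine (hasLineDerivAt_of_affine fun t => ?_).lineDeriv
  rw [add_sub_right_comm, inner_add_right, inner_smul_right, inner_neg_right]
  ring

theorem ae_lineDeriv_tent (hd : 0 < d) (hΩ : Bornology.IsBounded Ω) (K : Fin D.numCells)
    (v : Space d) : ∀ᵐ x, lineDeriv ℝ (D.tent K) x (-v) = ∑ σ ∈ D.cellEdges K,
      (D.cone K σ).indicator (fun _ => inner ℝ (D.normal K σ) v / D.centerDist K σ) x := by
  filter_upwards [ae_mem_cone hd hΩ K, measure_eq_zero_iff_ae_notMem.1 (D.volume_boundary_cell K)]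
    with x hx hxb
  by_cases hxK : x ∈ D.cell K
  · obtain ⟨σ, hσ, hxσ⟩ := hx hxK
    rw [Finset.sum_eq_single_of_mem σ hσ fun τ hτ hne => Set.indicator_of_notMem
      (fun h => Set.disjoint_left.1 (cone_disjoint hτ hσ hne) h hxσ) _, Set.indicator_of_mem hxσ,
      lineDeriv_tent_of_mem_cone hσ hxσ]
  · have hzero : D.tent K =ᶠ[𝓝 x] fun _ => 0 :=
      (isClosed_closure.isOpen_compl.eventually_mem fun h => hxb ⟨h, hxK⟩).mono
        fun y hy => tent_eq_zero fun h => hy (subset_closure h)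
    rw [hzero.lineDeriv_eq, Finset.sum_eq_zero fun σ hσ => Set.indicator_of_notMem
      (fun h => hxK (cone_subset_cell hσ h)) _]
    exact (hasLineDerivAt_of_affine fun t => by rw [mul_zero, add_zero]).lineDeriv

theorem integral_lineDeriv_mul_tent (hd : 0 < d) (hΩ : Bornology.IsBounded Ω)
    (K : Fin D.numCells) (v : Space d) {f : Space d → ℝ} {C : NNReal} (hf : LipschitzWith C f) :
    ∫ x, lineDeriv ℝ f x v * D.tent K x = ∑ σ ∈ D.cellEdges K,
      inner ℝ (D.normal K σ) v / D.centerDist K σ * ∫ x in D.cone K σ, f x := by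
  obtain ⟨C', htent⟩ := exists_lipschitzWith_tent hd hΩ K
  rw [hf.integral_lineDeriv_mul_eq htent (hasCompactSupport_tent hΩ K) v]
  have hderiv : ∀ᵐ x, lineDeriv ℝ (D.tent K) x (-v) * f x = ∑ σ ∈ D.cellEdges K,
      (D.cone K σ).indicator
        (fun x => inner ℝ (D.normal K σ) v / D.centerDist K σ * f x) x := by
    filter_upwards [ae_lineDeriv_tent hd hΩ K v] with x hx
    rw [hx, Finset.sum_mul]
    exact Finset.sum_congr rfl fun σ _ => (Set.indicator_mul_left _ _ f).symm
  rw [integral_congr_ae hderiv, integral_finsetSum]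
  · refine Finset.sum_congr rfl fun σ hσ => ?_
    rw [integral_indicator (isOpen_cone hσ).measurableSet, integral_const_mul]
  · intro σ hσ
    rw [integrable_indicator_iff (isOpen_cone hσ).measurableSet]
    exact integrableOn_cone hΩ K σ (continuous_const.mul hf.continuous)

theorem sum_edgeMeasure_smul_normal (hd : 0 < d) (hΩ : Bornology.IsBounded Ω)
    (K : Fin D.numCells) : ∑ σ ∈ D.cellEdges K, D.edgeMeasure σ • D.normal K σ = 0 := by
  refine ext_inner_right ℝ fun v => ?_
  have hd' : (d : ℝ) ≠ 0 := by positivity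
  have hterm : ∀ σ ∈ D.cellEdges K, inner ℝ (D.normal K σ) v / D.centerDist K σ *
      volume.real (D.cone K σ) = inner ℝ (D.edgeMeasure σ • D.normal K σ) v / d := by
    intro σ hσ
    have := (centerDist_pos hσ).ne'
    rw [volume_real_cone hd hΩ hσ, real_inner_smul_left]
    field_simp
  have h := integral_lineDeriv_mul_tent hd hΩ K v (LipschitzWith.const (1 : ℝ))
  simp only [lineDeriv, deriv_const, zero_mul, integral_zero, setIntegral_const, smul_eq_mul,
    mul_one] at h
  rw [Finset.sum_congr rfl hterm, ← Finset.sum_div, ← sum_inner] at h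
  rw [inner_zero_left]
  exact (div_eq_zero_iff.1 h.symm).resolve_right hd'

theorem setIntegral_tent_cone (hd : 0 < d) (hΩ : Bornology.IsBounded Ω)
    (h : σ ∈ D.cellEdges K) :
    ∫ x in D.cone K σ, D.tent K x = D.centerDist K σ * D.edgeMeasure σ / (d * (d + 1)) := by
  have hpos := (centerDist_pos h).ne'
  rw [setIntegral_congr_fun (isOpen_cone h).measurableSet fun x hx => tent_eq h hx,
    integral_sub (integrableOn_cone hΩ K σ continuous_const)
      (integrableOn_cone hΩ K σ (by fun_prop)), integral_div,
    integral_inner (integrableOn_cone hΩ K σ (by fun_prop)), setIntegral_sub_cone hd hΩ h,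
    inner_smul_right, inner_normal_barycentre hΩ, setIntegral_const, volume_real_cone hd hΩ h,
    smul_eq_mul]
  field_simp
  ring

theorem integral_tent (hd : 0 < d) (hΩ : Bornology.IsBounded Ω) (K : Fin D.numCells) :
    ∫ x, D.tent K x = D.cellMeasure K / (d + 1) := by
  obtain ⟨C, hC⟩ := exists_lipschitzWith_tent hd hΩ K
  have hint := hC.continuous.integrable_of_hasCompactSupport (μ := volume)
    (hasCompactSupport_tent hΩ K)
  rw [← setIntegral_eq_integral_of_forall_compl_eq_zero fun x hx => tent_eq_zero hx,
    setIntegral_cell hd hΩ K hint.integrableOn,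
    Finset.sum_congr rfl fun σ hσ => setIntegral_tent_cone hd hΩ hσ, ← Finset.sum_div,
    sum_centerDist_mul_edgeMeasure hd hΩ]
  exact mul_div_mul_left _ _ (by positivity)

-- Both sides are the integral of the constant `(d + 1) (b · v)` against the tent function of `K`.
theorem sum_edgeMeasure_mul_inner_barycentre (hd : 0 < d) (hΩ : Bornology.IsBounded Ω)
    (K : Fin D.numCells) (v b : Space d) :
    ∑ σ ∈ D.cellEdges K, D.edgeMeasure σ * inner ℝ (D.normal K σ) v *
      inner ℝ b (D.barycentre σ - D.center K) = D.cellMeasure K * inner ℝ b v := by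
  have hd' : (d : ℝ) + 1 ≠ 0 := by positivity
  have hterm : ∀ σ ∈ D.cellEdges K, inner ℝ (D.normal K σ) v / D.centerDist K σ *
      ∫ x in D.cone K σ, inner ℝ b (x - D.center K) =
      (D.edgeMeasure σ * inner ℝ (D.normal K σ) v *
        inner ℝ b (D.barycentre σ - D.center K)) / (d + 1) := by
    intro σ hσ
    have hpos := (centerDist_pos hσ).ne'
    rw [integral_inner (integrableOn_cone hΩ K σ (by fun_prop)), setIntegral_sub_cone hd hΩ hσ,
      inner_smul_right]
    field_simp
  have h := integral_lineDeriv_mul_tent hd hΩ K v (lipschitzWith_inner_sub b (D.center K))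
  simp only [lineDeriv_inner_sub] at h
  rw [integral_const_mul, integral_tent hd hΩ, Finset.sum_congr rfl hterm, ← Finset.sum_div,
    mul_div_assoc', div_left_inj' hd'] at h
  rw [← h, mul_comm]

/-! ### Conservativity -/

theorem normal_eq_or_eq_neg (h : σ ∈ D.cellEdges K) :
    D.normal K σ = D.edgeNormal σ ∨ D.normal K σ = -D.edgeNormal σ := by
  have hne := sub_ne_zero.2 (inner_edgeNormal_center_ne h).symm
  rw [normal]
  rcases Real.sign_apply_eq_of_ne_zero _ hne with hs | hs
  · exact Or.inr (by rw [hs, neg_one_smul])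
  · exact Or.inl (by rw [hs, one_smul])

theorem normal_ne_normal (hK : σ ∈ D.cellEdges K) (hL : σ ∈ D.cellEdges L) (hne : K ≠ L) :
    D.normal K σ ≠ D.normal L σ := by
  intro heq
  obtain ⟨x, hx⟩ := D.edge_nonempty σ
  obtain ⟨t, ⟨htK, -⟩, htL, -⟩ :=
    ((D.normal_outward hK hx).and (D.normal_outward hL hx)).exists
  rw [← heq] at htL
  exact Set.disjoint_left.1 (D.cell_disjoint K L hne) htK htL

theorem normal_add_normal_eq_zero (hK : σ ∈ D.cellEdges K) (hL : σ ∈ D.cellEdges L)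
    (hne : K ≠ L) : D.normal K σ + D.normal L σ = 0 := by
  have hneq := normal_ne_normal hK hL hne
  rcases normal_eq_or_eq_neg hK with h1 | h1 <;> rcases normal_eq_or_eq_neg hL with h2 | h2 <;>
    rw [h1, h2] at hneq ⊢ <;> simp at hneq ⊢

theorem sum_sum_cellEdges_smul_normal_eq_zero (f : Fin D.numEdges → ℝ)
    (hf : ∀ σ, D.IsExterior σ → f σ = 0) :
    ∑ K, ∑ σ ∈ D.cellEdges K, f σ • D.normal K σ = 0 := by
  have hcomm : ∑ K, ∑ σ ∈ D.cellEdges K, f σ • D.normal K σ =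
      ∑ σ, ∑ K ∈ D.edgeCells σ, f σ • D.normal K σ :=
    Finset.sum_comm' fun K σ => by simp [edgeCells]
  rw [hcomm]
  refine Finset.sum_eq_zero fun σ _ => ?_
  rcases D.edge_cells σ with ⟨hext, -⟩ | hint
  · simp [hf σ hext]
  · obtain ⟨K, L, hne, hKL⟩ := Finset.card_eq_two.1 hint
    have hmem : ∀ M, M ∈ ({K, L} : Finset _) → σ ∈ D.cellEdges M := by simp [← hKL]
    rw [edgeCells, hKL, Finset.sum_pair hne, ← smul_add,
      normal_add_normal_eq_zero (hmem K (by simp)) (hmem L (by simp)) hne, smul_zero]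

end Discretisation

theorem setIntegral_indicator_of_subset {α F : Type*} [MeasurableSpace α] {μ : Measure α}
    [NormedAddCommGroup F] [NormedSpace ℝ F] {s t : Set α} (hs : MeasurableSet s) (hst : s ⊆ t)
    (f : α → F) : ∫ x in t, s.indicator f x ∂μ = ∫ x in s, f x ∂μ := by
  rw [setIntegral_indicator hs, Set.inter_eq_right.2 hst]

theorem abs_setIntegral_sub_le {d : ℕ} {s : Set (Space d)} (hs : Bornology.IsBounded s)
    {ψ : Space d → ℝ} (hψ : Continuous ψ) {c ε : ℝ} (h : ∀ x ∈ s, |ψ x - c| ≤ ε) :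
    |(∫ x in s, ψ x) - volume.real s * c| ≤ ε * volume.real s := by
  have hint : IntegrableOn ψ s :=
    (hψ.continuousOn.integrableOn_compact hs.isCompact_closure).mono_set subset_closure
  rw [← smul_eq_mul, ← setIntegral_const,
    ← integral_sub hint (integrableOn_const hs.measure_lt_top.ne)]
  exact norm_setIntegral_le_of_norm_le_const (f := fun x => ψ x - c) hs.measure_lt_top h

theorem abs_sub_sub_inner_gradient_le {E : Type*} [NormedAddCommGroup E] [InnerProductSpace ℝ E]
    [CompleteSpace E] {φ : E → ℝ} (hφ : Differentiable ℝ φ) {L : NNReal}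
    (hL : LipschitzWith L (gradient φ)) (x y : E) :
    |φ y - φ x - inner ℝ (gradient φ x) (y - x)| ≤ L * ‖y - x‖ ^ 2 := by
  have h := (convex_closedBall x ‖y - x‖).norm_image_sub_le_of_norm_fderiv_le' (f := φ)
    (φ := fderiv ℝ φ x) (C := L * ‖y - x‖) (𝕜 := ℝ) (x := x) (y := y) (fun z _ => hφ z)
    (fun z hz => ?_) (by simp) (by simp [dist_eq_norm])
  · rwa [inner_gradient_left, sq, ← mul_assoc]
  · rw [← LinearIsometryEquiv.norm_map (InnerProductSpace.toDual ℝ E).symm, map_sub]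
    exact (hL.norm_sub_le z x).trans
      (mul_le_mul_of_nonneg_left (mem_closedBall_iff_norm.1 hz) L.2)

theorem memL2_indicator_const {d : ℕ} {Ω : Set (Space d)} {F : Type*} [NormedAddCommGroup F]
    (hΩ : Bornology.IsBounded Ω) {s : Set (Space d)} (hs : MeasurableSet s) (c : F) :
    MemL2 Ω (s.indicator fun _ => c) := by
  have : IsFiniteMeasure (volume.restrict Ω) := isFiniteMeasure_restrict.2 hΩ.measure_lt_top.ne
  exact (memLp_const c).indicator hs

namespace Discretisation

variable {d : ℕ} {Ω : Set (Space d)} {D : Discretisation Ω}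
  {K : Fin D.numCells} {σ : Fin D.numEdges}

/-! ### Size and regularity -/

theorem diam_le_size (K : Fin D.numCells) : Metric.diam (D.cell K) ≤ D.size :=
  le_ciSup (f := fun K => Metric.diam (D.cell K)) (Set.finite_range _).bddAbove K

theorem size_nonneg : 0 ≤ D.size := Real.iSup_nonneg fun _ => Metric.diam_nonneg

theorem norm_sub_center_le_size (hΩ : Bornology.IsBounded Ω) {x : Space d} (hx : x ∈ D.cell K) :
    ‖x - D.center K‖ ≤ D.size := by
  rw [← dist_eq_norm]
  exact (Metric.dist_le_diam_of_mem (D.isBounded_cell hΩ K) hx (D.center_mem K)).trans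
    (diam_le_size K)

variable (D) in
/-- Shape regularity, the part of the bound `θ_D ≤ θ` that compares the diameter of every cell with
the distances from its centre to the hyperplanes of its edges. -/
def IsShapeRegular (θ : ℝ) : Prop :=
  ∀ K, ∀ σ ∈ D.cellEdges K, Metric.diam (D.cell K) ≤ θ * D.centerDist K σ

theorem isShapeRegular_of_regularity_le {θ : ℝ} (hθ : D.regularity ≤ θ) : D.IsShapeRegular θ := by
  intro K σ h
  rw [← div_le_iff₀ (centerDist_pos h)]
  refine le_trans (le_csSup (Set.Finite.bddAbove ?_) (Or.inr ⟨K, σ, h, rfl⟩)) hθ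
  refine Set.Finite.union ?_ ?_
  · refine (Set.finite_range fun p : Fin D.numEdges × Fin D.numCells × Fin D.numCells =>
      D.centerDist p.2.1 p.1 / D.centerDist p.2.2 p.1).subset ?_
    rintro r ⟨σ, -, K, -, L, -, rfl⟩
    exact ⟨(σ, K, L), rfl⟩
  · refine (Set.finite_range fun p : Fin D.numCells × Fin D.numEdges =>
      Metric.diam (D.cell p.1) / D.centerDist p.1 p.2).subset ?_
    rintro r ⟨K, σ, -, rfl⟩
    exact ⟨(K, σ), rfl⟩

theorem norm_barycentre_sub_le_mul_centerDist (hΩ : Bornology.IsBounded Ω) {θ : ℝ}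
    (hθ : D.IsShapeRegular θ) (h : σ ∈ D.cellEdges K) :
    ‖D.barycentre σ - D.center K‖ ≤ θ * D.centerDist K σ :=
  (norm_barycentre_sub_le hΩ h).trans (hθ K σ h)

theorem sum_cellMeasure_le (hΩ : Bornology.IsBounded Ω) :
    ∑ K, D.cellMeasure K ≤ volume.real Ω := by
  simp only [cellMeasure]
  rw [← measureReal_biUnion_finset (fun K _ L _ hne => D.cell_disjoint K L hne)
    (fun K _ => (D.cell_isOpen K).measurableSet)
    (fun K _ => (D.isBounded_cell hΩ K).measure_lt_top.ne)]
  exact measureReal_mono (Set.iUnion₂_subset fun K _ => D.cell_subset K) hΩ.measure_lt_top.ne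

/-! ### Bounds on the discrete gradient -/

variable (D) in
/-- The contribution of the cell `K` to the square of the semi-norm `|v|_X`. -/
def localEnergy (v : D.X) (K : Fin D.numCells) : ℝ :=
  ∑ σ ∈ D.cellEdges K, D.edgeMeasure σ / D.centerDist K σ * (v.2 σ - v.1 K) ^ 2

theorem edgeEnergy_nonneg (v : D.X) (h : σ ∈ D.cellEdges K) :
    0 ≤ D.edgeMeasure σ / D.centerDist K σ * (v.2 σ - v.1 K) ^ 2 :=
  mul_nonneg (div_nonneg measureReal_nonneg (centerDist_pos h).le) (sq_nonneg _)

theorem localEnergy_nonneg (v : D.X) (K : Fin D.numCells) : 0 ≤ D.localEnergy v K :=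
  Finset.sum_nonneg fun _ hσ => edgeEnergy_nonneg v hσ

theorem sum_localEnergy (v : D.X) : ∑ K, D.localEnergy v K = D.seminormX v ^ 2 :=
  (Real.sq_sqrt (Finset.sum_nonneg fun K _ => localEnergy_nonneg v K)).symm

theorem cellMeasure_smul_cellGradient (hΩ : Bornology.IsBounded Ω) (v : D.X)
    (K : Fin D.numCells) : D.cellMeasure K • D.cellGradient v K =
      ∑ σ ∈ D.cellEdges K, (D.edgeMeasure σ * (v.2 σ - v.1 K)) • D.normal K σ := by
  rw [cellGradient, smul_smul, mul_inv_cancel₀ (cellMeasure_pos hΩ K).ne', one_smul]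

theorem sq_sum_edgeMeasure_mul_abs_le (hd : 0 < d) (hΩ : Bornology.IsBounded Ω) (v : D.X)
    (K : Fin D.numCells) :
    (∑ σ ∈ D.cellEdges K, D.edgeMeasure σ * |v.2 σ - v.1 K|) ^ 2 ≤
      d * D.cellMeasure K * D.localEnergy v K := by
  rw [← sum_centerDist_mul_edgeMeasure hd hΩ, localEnergy]
  refine Finset.sum_sq_le_sum_mul_sum_of_sq_le_mul _
    (fun σ hσ => mul_nonneg (centerDist_pos hσ).le measureReal_nonneg)
    (fun σ hσ => edgeEnergy_nonneg v hσ) fun σ hσ => ?_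
  have hne := (centerDist_pos hσ).ne'
  rw [mul_pow, sq_abs]
  exact le_of_eq (by field_simp)

theorem cellMeasure_mul_norm_cellGradient_sq_le (hd : 0 < d) (hΩ : Bornology.IsBounded Ω)
    (v : D.X) (K : Fin D.numCells) :
    D.cellMeasure K * ‖D.cellGradient v K‖ ^ 2 ≤ d * D.localEnergy v K := by
  have hpos := cellMeasure_pos (D := D) hΩ K
  have hnorm : D.cellMeasure K * ‖D.cellGradient v K‖ ≤
      ∑ σ ∈ D.cellEdges K, D.edgeMeasure σ * |v.2 σ - v.1 K| := by
    rw [← Real.norm_of_nonneg hpos.le, ← norm_smul, cellMeasure_smul_cellGradient hΩ]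
    refine (norm_sum_le _ _).trans_eq (Finset.sum_congr rfl fun σ hσ => ?_)
    rw [norm_smul, D.norm_normal hσ, mul_one, norm_mul, Real.norm_eq_abs (v.2 σ - v.1 K),
      Real.norm_of_nonneg (edgeMeasure_pos hΩ σ).le]
  refine le_of_mul_le_mul_left ?_ hpos
  calc D.cellMeasure K * (D.cellMeasure K * ‖D.cellGradient v K‖ ^ 2)
      = (D.cellMeasure K * ‖D.cellGradient v K‖) ^ 2 := by ring
    _ ≤ (∑ σ ∈ D.cellEdges K, D.edgeMeasure σ * |v.2 σ - v.1 K|) ^ 2 := by gcongr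
    _ ≤ d * D.cellMeasure K * D.localEnergy v K := sq_sum_edgeMeasure_mul_abs_le hd hΩ v K
    _ = D.cellMeasure K * (d * D.localEnergy v K) := by ring

theorem residual_sq_le (hΩ : Bornology.IsBounded Ω) {θ : ℝ} (hθ : D.IsShapeRegular θ) (v : D.X)
    (h : σ ∈ D.cellEdges K) :
    D.residual v K σ ^ 2 ≤ 2 * d * ((v.2 σ - v.1 K) ^ 2 / D.centerDist K σ ^ 2 +
      θ ^ 2 * ‖D.cellGradient v K‖ ^ 2) := by
  have hpos := centerDist_pos h
  set s := inner ℝ (D.cellGradient v K) (D.barycentre σ - D.center K)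
  have hs : s ^ 2 ≤ (‖D.cellGradient v K‖ * (θ * D.centerDist K σ)) ^ 2 := by
    rw [← sq_abs]
    gcongr
    refine (abs_real_inner_le_norm _ _).trans ?_
    gcongr
    exact norm_barycentre_sub_le_mul_centerDist hΩ hθ h
  calc D.residual v K σ ^ 2 = d / D.centerDist K σ ^ 2 * (v.2 σ - v.1 K - s) ^ 2 := by
        rw [residual, mul_pow, div_pow, Real.sq_sqrt d.cast_nonneg]
    _ ≤ d / D.centerDist K σ ^ 2 * (2 * ((v.2 σ - v.1 K) ^ 2 +
        (‖D.cellGradient v K‖ * (θ * D.centerDist K σ)) ^ 2)) := by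
        gcongr
        linarith [sq_nonneg (v.2 σ - v.1 K + s)]
    _ = _ := by field_simp

theorem norm_edgeGradient_sq_le (v : D.X) (h : σ ∈ D.cellEdges K) :
    ‖D.edgeGradient v K σ‖ ^ 2 ≤ 2 * (‖D.cellGradient v K‖ ^ 2 + D.residual v K σ ^ 2) := by
  have htri : ‖D.edgeGradient v K σ‖ ≤ ‖D.cellGradient v K‖ + |D.residual v K σ| := by
    refine (norm_add_le _ _).trans_eq ?_
    rw [norm_smul, D.norm_normal h, mul_one, Real.norm_eq_abs]
  rw [← sq_abs (D.residual v K σ)]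
  exact (pow_le_pow_left₀ (norm_nonneg _) htri 2).trans add_sq_le

theorem volume_cone_mul_norm_edgeGradient_sq_le (hd : 0 < d) (hΩ : Bornology.IsBounded Ω) {θ : ℝ}
    (hθ : D.IsShapeRegular θ) (v : D.X) (h : σ ∈ D.cellEdges K) :
    volume.real (D.cone K σ) * ‖D.edgeGradient v K σ‖ ^ 2 ≤
      (2 + 4 * d * θ ^ 2) * (volume.real (D.cone K σ) * ‖D.cellGradient v K‖ ^ 2) +
        4 * (D.edgeMeasure σ / D.centerDist K σ * (v.2 σ - v.1 K) ^ 2) := by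
  have hpos := centerDist_pos h
  have hm := edgeMeasure_pos (D := D) hΩ σ
  have hbound := (norm_edgeGradient_sq_le v h).trans
    (mul_le_mul_of_nonneg_left (add_le_add_right (residual_sq_le hΩ hθ v h) _) zero_le_two)
  rw [volume_real_cone hd hΩ h]
  refine (mul_le_mul_of_nonneg_left hbound (by positivity)).trans_eq ?_
  field_simp
  ring

theorem sum_volume_cone_mul_norm_edgeGradient_sq_le (hd : 0 < d) (hΩ : Bornology.IsBounded Ω)
    {θ : ℝ} (hθ : D.IsShapeRegular θ) (v : D.X) :
    ∑ K, ∑ σ ∈ D.cellEdges K, volume.real (D.cone K σ) * ‖D.edgeGradient v K σ‖ ^ 2 ≤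
      ((2 + 4 * d * θ ^ 2) * d + 4) * D.seminormX v ^ 2 := by
  rw [← sum_localEnergy, Finset.mul_sum]
  refine Finset.sum_le_sum fun K _ => ?_
  calc ∑ σ ∈ D.cellEdges K, volume.real (D.cone K σ) * ‖D.edgeGradient v K σ‖ ^ 2
      ≤ ∑ σ ∈ D.cellEdges K,
          ((2 + 4 * d * θ ^ 2) * (volume.real (D.cone K σ) * ‖D.cellGradient v K‖ ^ 2) +
            4 * (D.edgeMeasure σ / D.centerDist K σ * (v.2 σ - v.1 K) ^ 2)) :=
        Finset.sum_le_sum fun σ hσ => volume_cone_mul_norm_edgeGradient_sq_le hd hΩ hθ v hσ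
    _ = (2 + 4 * d * θ ^ 2) * (D.cellMeasure K * ‖D.cellGradient v K‖ ^ 2) +
          4 * D.localEnergy v K := by
        rw [Finset.sum_add_distrib, ← Finset.mul_sum, ← Finset.mul_sum, ← Finset.sum_mul,
          sum_volume_cone hd hΩ, localEnergy]
    _ ≤ (2 + 4 * d * θ ^ 2) * (d * D.localEnergy v K) + 4 * D.localEnergy v K := by
        exact add_le_add_left (mul_le_mul_of_nonneg_left
          (cellMeasure_mul_norm_cellGradient_sq_le hd hΩ v K) (by positivity)) _
    _ = _ := by ring

theorem sum_edgeMeasure_mul_inner_barycentre_smul_normal (hd : 0 < d)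
    (hΩ : Bornology.IsBounded Ω) (K : Fin D.numCells) (b : Space d) :
    ∑ σ ∈ D.cellEdges K, (D.edgeMeasure σ * inner ℝ b (D.barycentre σ - D.center K)) •
      D.normal K σ = D.cellMeasure K • b := by
  refine ext_inner_right ℝ fun w => ?_
  rw [real_inner_smul_left, ← sum_edgeMeasure_mul_inner_barycentre hd hΩ, sum_inner]
  refine Finset.sum_congr rfl fun σ _ => ?_
  rw [real_inner_smul_left]
  ring

-- The stabilisation has zero mean on `K`, because `∇_K` is exact on affine functions.
theorem sum_volume_cone_smul_edgeGradient (hd : 0 < d) (hΩ : Bornology.IsBounded Ω) (v : D.X)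
    (K : Fin D.numCells) :
    ∑ σ ∈ D.cellEdges K, volume.real (D.cone K σ) • D.edgeGradient v K σ =
      D.cellMeasure K • D.cellGradient v K := by
  have hresidual : ∀ σ ∈ D.cellEdges K,
      volume.real (D.cone K σ) • D.residual v K σ • D.normal K σ =
      (Real.sqrt d / d) • ((D.edgeMeasure σ * (v.2 σ - v.1 K)) • D.normal K σ -
        (D.edgeMeasure σ * inner ℝ (D.cellGradient v K) (D.barycentre σ - D.center K)) •
          D.normal K σ) := by
    intro σ hσ
    have hne := (centerDist_pos hσ).ne'
    rw [← sub_smul, smul_smul, smul_smul, volume_real_cone hd hΩ hσ, residual]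
    congr 1
    field_simp
  simp only [edgeGradient, smul_add, Finset.sum_add_distrib]
  rw [← Finset.sum_smul, sum_volume_cone hd hΩ, add_eq_left, Finset.sum_congr rfl hresidual,
    ← Finset.smul_sum, Finset.sum_sub_distrib, ← cellMeasure_smul_cellGradient hΩ,
    sum_edgeMeasure_mul_inner_barycentre_smul_normal hd hΩ, sub_self, smul_zero]

/-! ### Piecewise constant functions -/

theorem sum_indicator_cell {F : Type*} [AddCommMonoid F] (c : Fin D.numCells → F) {x : Space d}
    (hx : x ∈ D.cell K) : ∑ L, (D.cell L).indicator (fun _ => c L) x = c K := by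
  rw [Finset.sum_eq_single_of_mem K (Finset.mem_univ K) fun L _ hne => Set.indicator_of_notMem
    (fun h => Set.disjoint_left.1 (D.cell_disjoint L K hne) h hx) _, Set.indicator_of_mem hx]

theorem sum_indicator_cone {F : Type*} [AddCommMonoid F]
    (c : Fin D.numCells → Fin D.numEdges → F) (hσ : σ ∈ D.cellEdges K) {x : Space d}
    (hx : x ∈ D.cone K σ) :
    ∑ L, ∑ τ ∈ D.cellEdges L, (D.cone L τ).indicator (fun _ => c L τ) x = c K σ := by
  rw [Finset.sum_eq_single_of_mem K (Finset.mem_univ K), Finset.sum_eq_single_of_mem σ hσ,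
    Set.indicator_of_mem hx]
  · exact fun τ hτ hne => Set.indicator_of_notMem
      (fun h => Set.disjoint_left.1 (cone_disjoint hτ hσ hne) h hx) _
  · exact fun L _ hne => Finset.sum_eq_zero fun τ hτ => Set.indicator_of_notMem
      (fun h => Set.disjoint_left.1 (D.cell_disjoint L K hne) (cone_subset_cell hτ h)
        (cone_subset_cell hσ hx)) _

theorem comp_reconstruction (v : D.X) {F : Type*} [AddCommMonoid F] (f : ℝ → F) (hf : f 0 = 0)
    (x : Space d) : f (D.reconstruction v x) =
      ∑ K, (D.cell K).indicator (fun _ => f (v.1 K)) x := by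
  by_cases h : ∃ K, x ∈ D.cell K
  · obtain ⟨K, hK⟩ := h
    rw [reconstruction, sum_indicator_cell _ hK, sum_indicator_cell _ hK]
  · push Not at h
    rw [reconstruction, Finset.sum_eq_zero fun K _ => Set.indicator_of_notMem (h K) _, hf,
      Finset.sum_eq_zero fun K _ => Set.indicator_of_notMem (h K) _]

theorem comp_discreteGradient (v : D.X) {F : Type*} [AddCommMonoid F] (f : Space d → F)
    (hf : f 0 = 0) (x : Space d) : f (D.discreteGradient v x) =
      ∑ K, ∑ σ ∈ D.cellEdges K, (D.cone K σ).indicator (fun _ => f (D.edgeGradient v K σ)) x := by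
  by_cases h : ∃ K, ∃ σ ∈ D.cellEdges K, x ∈ D.cone K σ
  · obtain ⟨K, σ, hσ, hx⟩ := h
    rw [discreteGradient, sum_indicator_cone _ hσ hx,
      sum_indicator_cone (fun K σ => f (D.edgeGradient v K σ)) hσ hx]
  · push Not at h
    rw [discreteGradient, Finset.sum_eq_zero fun K _ => Finset.sum_eq_zero fun σ hσ =>
      Set.indicator_of_notMem (h K σ hσ) _, hf, Finset.sum_eq_zero fun K _ =>
      Finset.sum_eq_zero fun σ hσ => Set.indicator_of_notMem (h K σ hσ) _]

theorem memL2_discreteGradient (hΩ : Bornology.IsBounded Ω) (v : D.X) :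
    MemL2 Ω (D.discreteGradient v) :=
  memLp_finsetSum _ fun _ _ => memLp_finsetSum _ fun _ hσ =>
    memL2_indicator_const hΩ (isOpen_cone hσ).measurableSet _

theorem memL2_reconstruction (hΩ : Bornology.IsBounded Ω) (v : D.X) :
    MemL2 Ω (D.reconstruction v) :=
  memLp_finsetSum _ fun K _ => memL2_indicator_const hΩ (D.cell_isOpen K).measurableSet _

theorem setIntegral_sum_cone {F : Type*} [NormedAddCommGroup F] [NormedSpace ℝ F]
    (f : Fin D.numCells → Fin D.numEdges → Space d → F)
    (hf : ∀ K, ∀ σ ∈ D.cellEdges K, IntegrableOn (f K σ) (D.cone K σ)) :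
    ∫ x in Ω, ∑ K, ∑ σ ∈ D.cellEdges K, (D.cone K σ).indicator (f K σ) x =
      ∑ K, ∑ σ ∈ D.cellEdges K, ∫ x in D.cone K σ, f K σ x := by
  have hint : ∀ K, ∀ σ ∈ D.cellEdges K,
      Integrable ((D.cone K σ).indicator (f K σ)) (volume.restrict Ω) := fun K σ hσ =>
    ((hf K σ hσ).integrable_indicator (isOpen_cone hσ).measurableSet).restrict
  rw [integral_finsetSum _ fun K _ => integrable_finsetSum _ fun σ hσ => hint K σ hσ]
  refine Finset.sum_congr rfl fun K _ => ?_
  rw [integral_finsetSum _ fun σ hσ => hint K σ hσ]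
  exact Finset.sum_congr rfl fun σ hσ => setIntegral_indicator_of_subset
    (isOpen_cone hσ).measurableSet ((cone_subset_cell hσ).trans (D.cell_subset K)) _

theorem setIntegral_sum_cell {F : Type*} [NormedAddCommGroup F] [NormedSpace ℝ F]
    (f : Fin D.numCells → Space d → F) (hf : ∀ K, IntegrableOn (f K) (D.cell K)) :
    ∫ x in Ω, ∑ K, (D.cell K).indicator (f K) x = ∑ K, ∫ x in D.cell K, f K x := by
  rw [integral_finsetSum _ fun K _ =>
    ((hf K).integrable_indicator (D.cell_isOpen K).measurableSet).restrict]
  exact Finset.sum_congr rfl fun K _ =>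
    setIntegral_indicator_of_subset (D.cell_isOpen K).measurableSet (D.cell_subset K) _

theorem integral_norm_discreteGradient_sq_le (hd : 0 < d) (hΩ : Bornology.IsBounded Ω) {θ : ℝ}
    (hθ : D.IsShapeRegular θ) (v : D.X) :
    ∫ x in Ω, ‖D.discreteGradient v x‖ ^ 2 ≤
      ((2 + 4 * d * θ ^ 2) * d + 4) * D.seminormX v ^ 2 := by
  simp only [comp_discreteGradient v (‖·‖ ^ 2) (by simp)]
  rw [setIntegral_sum_cone (fun L τ _ => ‖D.edgeGradient v L τ‖ ^ 2)
    fun K σ _ => integrableOn_cone hΩ K σ continuous_const]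
  simp only [setIntegral_const, smul_eq_mul]
  exact sum_volume_cone_mul_norm_edgeGradient_sq_le hd hΩ hθ v

theorem integral_abs_reconstruction (hΩ : Bornology.IsBounded Ω) (v : D.X) :
    ∫ x in Ω, |D.reconstruction v x| = ∑ K, |v.1 K| * D.cellMeasure K := by
  simp only [comp_reconstruction v (|·|) abs_zero]
  rw [setIntegral_sum_cell (fun K _ => |v.1 K|)
    fun K => integrableOn_const (D.isBounded_cell hΩ K).measure_lt_top.ne]
  refine Finset.sum_congr rfl fun K _ => ?_
  rw [setIntegral_const, smul_eq_mul, mul_comm, cellMeasure]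

theorem integral_inner_discreteGradient (hΩ : Bornology.IsBounded Ω) (v : D.X) {φ : Space d → ℝ}
    (hφ : Continuous φ) (e : Space d) :
    ∫ x in Ω, inner ℝ (D.discreteGradient v x) (φ x • e) =
      ∑ K, ∑ σ ∈ D.cellEdges K, inner ℝ (D.edgeGradient v K σ) e * ∫ x in D.cone K σ, φ x := by
  have hpointwise : ∀ x, inner ℝ (D.discreteGradient v x) (φ x • e) =
      ∑ K, ∑ σ ∈ D.cellEdges K,
        (D.cone K σ).indicator (fun x => inner ℝ (D.edgeGradient v K σ) e * φ x) x := by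
    intro x
    rw [inner_smul_right, comp_discreteGradient v (inner ℝ · e) (inner_zero_left e), mul_comm]
    simp only [Finset.sum_mul, Set.indicator_mul_left]
  simp only [hpointwise]
  rw [setIntegral_sum_cone (fun K σ x => inner ℝ (D.edgeGradient v K σ) e * φ x)
    fun K σ _ => integrableOn_cone hΩ K σ (continuous_const.mul hφ)]
  simp only [integral_const_mul]

theorem integral_reconstruction_mul (hΩ : Bornology.IsBounded Ω) (v : D.X) {ψ : Space d → ℝ}
    (hψ : Continuous ψ) :
    ∫ x in Ω, D.reconstruction v x * ψ x = ∑ K, v.1 K * ∫ x in D.cell K, ψ x := by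
  have hpointwise : ∀ x, D.reconstruction v x * ψ x =
      ∑ K, (D.cell K).indicator (fun x => v.1 K * ψ x) x := fun x => by
    simp only [reconstruction, Finset.sum_mul, Set.indicator_mul_left]
  simp only [hpointwise]
  rw [setIntegral_sum_cell]
  · simp only [integral_const_mul]
  · exact fun K => ((continuous_const.mul hψ).continuousOn.integrableOn_compact
      (D.isBounded_cell hΩ K).isCompact_closure).mono_set subset_closure

end Discretisation

namespace Discretisation

variable {d : ℕ} {Ω : Set (Space d)} {D : Discretisation Ω}
  {K : Fin D.numCells} {σ : Fin D.numEdges} {φ : Space d → ℝ} {L : ℝ≥0}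

/-! ### Consistency of the discrete gradient with integration by parts -/

theorem abs_sum_sum_cellEdges_le {f g : Fin D.numCells → Fin D.numEdges → ℝ}
    (h : ∀ K, ∀ σ ∈ D.cellEdges K, |f K σ| ≤ g K σ) :
    |∑ K, ∑ σ ∈ D.cellEdges K, f K σ| ≤ ∑ K, ∑ σ ∈ D.cellEdges K, g K σ :=
  (Finset.abs_sum_le_sum_abs _ _).trans (Finset.sum_le_sum fun K _ =>
    (Finset.abs_sum_le_sum_abs _ _).trans (Finset.sum_le_sum (h K)))

theorem abs_inner_edgeGradient_mul_quadrature_le (hΩ : Bornology.IsBounded Ω)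
    (hφ : LipschitzWith L φ) (v : D.X) (e : Space d) (h : σ ∈ D.cellEdges K) :
    |inner ℝ (D.edgeGradient v K σ) e *
      ((∫ x in D.cone K σ, φ x) - volume.real (D.cone K σ) * φ (D.center K))| ≤
      D.size * (‖e‖ * L) * (volume.real (D.cone K σ) +
        volume.real (D.cone K σ) * ‖D.edgeGradient v K σ‖ ^ 2) := by
  have hsize := size_nonneg (D := D)
  have hquadrature := abs_setIntegral_sub_le (isBounded_cone hΩ K σ) hφ.continuous
    (c := φ (D.center K)) (ε := L * D.size) fun x hx => (hφ.norm_sub_le _ _).trans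
      (by gcongr; exact norm_sub_center_le_size hΩ (cone_subset_cell h hx))
  calc |inner ℝ (D.edgeGradient v K σ) e *
        ((∫ x in D.cone K σ, φ x) - volume.real (D.cone K σ) * φ (D.center K))|
      ≤ (‖D.edgeGradient v K σ‖ * ‖e‖) * (L * D.size * volume.real (D.cone K σ)) := by
        rw [abs_mul]
        gcongr
        exact abs_real_inner_le_norm _ _
    _ = D.size * (‖e‖ * L) * (volume.real (D.cone K σ) * ‖D.edgeGradient v K σ‖) := by ring
    _ ≤ _ := by
        rw [← mul_one_add]
        gcongr
        nlinarith [sq_nonneg (‖D.edgeGradient v K σ‖ - 1)]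

theorem abs_integral_inner_discreteGradient_sub_le (hd : 0 < d) (hΩ : Bornology.IsBounded Ω)
    {θ : ℝ} (hθ : D.IsShapeRegular θ) (hφ : LipschitzWith L φ) (v : D.X) (e : Space d) :
    |(∫ x in Ω, inner ℝ (D.discreteGradient v x) (φ x • e)) -
      ∑ K, D.cellMeasure K * inner ℝ (D.cellGradient v K) e * φ (D.center K)| ≤
      D.size * (‖e‖ * L * (volume.real Ω +
        ((2 + 4 * d * θ ^ 2) * d + 4) * D.seminormX v ^ 2)) := by
  have hmean : ∀ K, D.cellMeasure K * inner ℝ (D.cellGradient v K) e * φ (D.center K) =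
      ∑ σ ∈ D.cellEdges K, inner ℝ (D.edgeGradient v K σ) e *
        (volume.real (D.cone K σ) * φ (D.center K)) := by
    intro K
    rw [← real_inner_smul_left, ← sum_volume_cone_smul_edgeGradient hd hΩ, sum_inner,
      Finset.sum_mul]
    refine Finset.sum_congr rfl fun σ _ => ?_
    rw [real_inner_smul_left]
    ring
  simp only [hmean, integral_inner_discreteGradient hΩ v hφ.continuous e,
    ← Finset.sum_sub_distrib, ← mul_sub]
  calc _ ≤ ∑ K, ∑ σ ∈ D.cellEdges K, D.size * (‖e‖ * L) * (volume.real (D.cone K σ) +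
        volume.real (D.cone K σ) * ‖D.edgeGradient v K σ‖ ^ 2) :=
        abs_sum_sum_cellEdges_le fun K σ hσ =>
          abs_inner_edgeGradient_mul_quadrature_le hΩ hφ v e hσ
    _ = D.size * (‖e‖ * L * (∑ K, D.cellMeasure K + ∑ K, ∑ σ ∈ D.cellEdges K,
          volume.real (D.cone K σ) * ‖D.edgeGradient v K σ‖ ^ 2)) := by
        simp only [← Finset.mul_sum, Finset.sum_add_distrib, sum_volume_cone hd hΩ, mul_assoc]
    _ ≤ _ := by
        have hsize := size_nonneg (D := D)
        gcongr
        · exact sum_cellMeasure_le hΩ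
        · exact sum_volume_cone_mul_norm_edgeGradient_sq_le hd hΩ hθ v

variable (D) in
/-- The flux of `φ e` through the boundary of `K`, with `φ` replaced, on each edge, by its value
at the barycentre. -/
def boundaryFlux (φ : Space d → ℝ) (e : Space d) (K : Fin D.numCells) : ℝ :=
  ∑ σ ∈ D.cellEdges K, D.edgeMeasure σ * inner ℝ (D.normal K σ) e * φ (D.barycentre σ)

-- The terms with `v_σ` cancel by conservativity: `n_{K,σ} = -n_{L,σ}` on interior edges.
theorem sum_cellGradient_add_sum_boundaryFlux (hΩ : Bornology.IsBounded Ω) {v : D.X}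
    (hv : v ∈ D.X0) (φ : Space d → ℝ) (e : Space d) :
    ∑ K, D.cellMeasure K * inner ℝ (D.cellGradient v K) e * φ (D.center K) +
      ∑ K, v.1 K * D.boundaryFlux φ e K =
      ∑ K, ∑ σ ∈ D.cellEdges K, D.edgeMeasure σ * (v.2 σ - v.1 K) * inner ℝ (D.normal K σ) e *
        (φ (D.center K) - φ (D.barycentre σ)) := by
  have hconservative := congrArg (fun x => inner ℝ x e)
    (sum_sum_cellEdges_smul_normal_eq_zero (D := D)
      (fun σ => D.edgeMeasure σ * v.2 σ * φ (D.barycentre σ)) fun σ hσ => by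
        rw [hv σ hσ, mul_zero, zero_mul])
  simp only [sum_inner, real_inner_smul_left, inner_zero_left] at hconservative
  have hgradient : ∀ K, D.cellMeasure K * inner ℝ (D.cellGradient v K) e * φ (D.center K) =
      ∑ σ ∈ D.cellEdges K,
        D.edgeMeasure σ * (v.2 σ - v.1 K) * inner ℝ (D.normal K σ) e * φ (D.center K) := by
    intro K
    rw [← real_inner_smul_left, cellMeasure_smul_cellGradient hΩ, sum_inner, Finset.sum_mul]
    simp only [real_inner_smul_left]
  rw [← sub_eq_zero, ← hconservative]
  simp only [hgradient, boundaryFlux, Finset.mul_sum, ← Finset.sum_add_distrib,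
    ← Finset.sum_sub_distrib]
  refine Finset.sum_congr rfl fun K _ => Finset.sum_congr rfl fun σ _ => ?_
  ring

theorem edgeMeasure_mul_abs_le (v : D.X) (h : σ ∈ D.cellEdges K) :
    D.edgeMeasure σ * |v.2 σ - v.1 K| ≤ D.centerDist K σ * D.edgeMeasure σ +
      D.edgeMeasure σ / D.centerDist K σ * (v.2 σ - v.1 K) ^ 2 := by
  have hδ := centerDist_pos h
  have hyoung : |v.2 σ - v.1 K| ≤
      D.centerDist K σ + (v.2 σ - v.1 K) ^ 2 / D.centerDist K σ := by
    rw [← sub_le_iff_le_add', le_div_iff₀ hδ, ← sq_abs (v.2 σ - v.1 K)]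
    nlinarith [sq_nonneg (|v.2 σ - v.1 K| - D.centerDist K σ),
      mul_nonneg (abs_nonneg (v.2 σ - v.1 K)) hδ.le]
  calc D.edgeMeasure σ * |v.2 σ - v.1 K|
      ≤ D.edgeMeasure σ * (D.centerDist K σ + (v.2 σ - v.1 K) ^ 2 / D.centerDist K σ) :=
        mul_le_mul_of_nonneg_left hyoung measureReal_nonneg
    _ = _ := by ring

theorem abs_edgeFlux_mul_sub_le (hΩ : Bornology.IsBounded Ω) (hφ : LipschitzWith L φ) (v : D.X)
    (e : Space d) (h : σ ∈ D.cellEdges K) :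
    |D.edgeMeasure σ * (v.2 σ - v.1 K) * inner ℝ (D.normal K σ) e *
      (φ (D.center K) - φ (D.barycentre σ))| ≤
      D.size * (‖e‖ * L) * (D.centerDist K σ * D.edgeMeasure σ +
        D.edgeMeasure σ / D.centerDist K σ * (v.2 σ - v.1 K) ^ 2) := by
  have hm := edgeMeasure_pos (D := D) hΩ σ
  have hsize := size_nonneg (D := D)
  have hvalue : |φ (D.center K) - φ (D.barycentre σ)| ≤ L * D.size := by
    refine (hφ.norm_sub_le _ _).trans ?_
    rw [norm_sub_rev]
    gcongr
    exact (norm_barycentre_sub_le hΩ h).trans (diam_le_size K)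
  have hnormal := abs_real_inner_le_norm (D.normal K σ) e
  rw [D.norm_normal h, one_mul] at hnormal
  rw [abs_mul, abs_mul, abs_mul, abs_of_pos hm]
  calc D.edgeMeasure σ * |v.2 σ - v.1 K| * |inner ℝ (D.normal K σ) e| *
        |φ (D.center K) - φ (D.barycentre σ)|
      ≤ D.edgeMeasure σ * |v.2 σ - v.1 K| * ‖e‖ * (L * D.size) := by gcongr
    _ = D.size * (‖e‖ * L) * (D.edgeMeasure σ * |v.2 σ - v.1 K|) := by ring
    _ ≤ _ := mul_le_mul_of_nonneg_left (edgeMeasure_mul_abs_le v h) (by positivity)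

theorem abs_sum_cellGradient_add_sum_boundaryFlux_le (hd : 0 < d) (hΩ : Bornology.IsBounded Ω)
    (hφ : LipschitzWith L φ) {v : D.X} (hv : v ∈ D.X0) (e : Space d) :
    |∑ K, D.cellMeasure K * inner ℝ (D.cellGradient v K) e * φ (D.center K) +
      ∑ K, v.1 K * D.boundaryFlux φ e K| ≤
      D.size * (‖e‖ * L * (d * volume.real Ω + D.seminormX v ^ 2)) := by
  rw [sum_cellGradient_add_sum_boundaryFlux hΩ hv]
  calc _ ≤ ∑ K, ∑ σ ∈ D.cellEdges K, D.size * (‖e‖ * L) *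
        (D.centerDist K σ * D.edgeMeasure σ +
          D.edgeMeasure σ / D.centerDist K σ * (v.2 σ - v.1 K) ^ 2) :=
        abs_sum_sum_cellEdges_le fun K σ hσ => abs_edgeFlux_mul_sub_le hΩ hφ v e hσ
    _ = D.size * (‖e‖ * L * (d * ∑ K, D.cellMeasure K + ∑ K, D.localEnergy v K)) := by
        simp only [← Finset.mul_sum, Finset.sum_add_distrib,
          sum_centerDist_mul_edgeMeasure hd hΩ, localEnergy, mul_assoc]
    _ ≤ _ := by
        have hsize := size_nonneg (D := D)
        rw [sum_localEnergy]
        gcongr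
        exact sum_cellMeasure_le hΩ

-- `K` is a closed polytope, and by Gauss' formula affine functions are integrated exactly.
theorem boundaryFlux_sub (hd : 0 < d) (hΩ : Bornology.IsBounded Ω) (φ : Space d → ℝ)
    (e b : Space d) (K : Fin D.numCells) :
    D.boundaryFlux φ e K - D.cellMeasure K * inner ℝ b e =
      ∑ σ ∈ D.cellEdges K, D.edgeMeasure σ * inner ℝ (D.normal K σ) e *
        (φ (D.barycentre σ) - φ (D.center K) - inner ℝ b (D.barycentre σ - D.center K)) := by
  have hclosed := congrArg (fun x => inner ℝ x e * φ (D.center K))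
    (sum_edgeMeasure_smul_normal (D := D) hd hΩ K)
  simp only [sum_inner, real_inner_smul_left, inner_zero_left, zero_mul,
    Finset.sum_mul] at hclosed
  rw [← sum_edgeMeasure_mul_inner_barycentre hd hΩ K e b, ← sub_eq_zero, ← hclosed, boundaryFlux]
  simp only [← Finset.sum_sub_distrib]
  refine Finset.sum_congr rfl fun σ _ => ?_
  ring

theorem abs_boundaryFlux_sub_le (hd : 0 < d) (hΩ : Bornology.IsBounded Ω) {θ : ℝ}
    (hθ : D.IsShapeRegular θ) (hφ : Differentiable ℝ φ) (hL : LipschitzWith L (gradient φ))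
    (e : Space d) (K : Fin D.numCells) :
    |D.boundaryFlux φ e K - D.cellMeasure K * inner ℝ (gradient φ (D.center K)) e| ≤
      D.size * (‖e‖ * L * θ * d) * D.cellMeasure K := by
  have hedge : ∀ σ ∈ D.cellEdges K, |D.edgeMeasure σ * inner ℝ (D.normal K σ) e *
      (φ (D.barycentre σ) - φ (D.center K) -
        inner ℝ (gradient φ (D.center K)) (D.barycentre σ - D.center K))| ≤
      D.size * (‖e‖ * L * θ) * (D.centerDist K σ * D.edgeMeasure σ) := by
    intro σ hσ
    have hm := edgeMeasure_pos (D := D) hΩ σ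
    have hnormal := abs_real_inner_le_norm (D.normal K σ) e
    rw [D.norm_normal hσ, one_mul] at hnormal
    have hsq : ‖D.barycentre σ - D.center K‖ ^ 2 ≤ D.size * (θ * D.centerDist K σ) := by
      rw [sq]
      exact mul_le_mul ((norm_barycentre_sub_le hΩ hσ).trans (diam_le_size K))
        (norm_barycentre_sub_le_mul_centerDist hΩ hθ hσ) (norm_nonneg _) size_nonneg
    rw [abs_mul, abs_mul, abs_of_pos hm]
    calc _ ≤ D.edgeMeasure σ * ‖e‖ * (L * (D.size * (θ * D.centerDist K σ))) := by
          gcongr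
          exact (abs_sub_sub_inner_gradient_le hφ hL _ _).trans (by gcongr)
      _ = _ := by ring
  rw [boundaryFlux_sub hd hΩ]
  calc _ ≤ ∑ σ ∈ D.cellEdges K,
        D.size * (‖e‖ * L * θ) * (D.centerDist K σ * D.edgeMeasure σ) :=
        (Finset.abs_sum_le_sum_abs _ _).trans (Finset.sum_le_sum hedge)
    _ = _ := by
        rw [← Finset.mul_sum, sum_centerDist_mul_edgeMeasure hd hΩ]
        ring

theorem abs_setIntegral_cell_inner_gradient_sub_le (hΩ : Bornology.IsBounded Ω)
    (hL : LipschitzWith L (gradient φ)) (e : Space d) (K : Fin D.numCells) :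
    |(∫ x in D.cell K, inner ℝ (gradient φ x) e) -
      D.cellMeasure K * inner ℝ (gradient φ (D.center K)) e| ≤
      D.size * (‖e‖ * L) * D.cellMeasure K := by
  refine abs_setIntegral_sub_le (D.isBounded_cell hΩ K) (hL.continuous.inner continuous_const)
    fun x hx => ?_
  rw [← inner_sub_left]
  calc |inner ℝ (gradient φ x - gradient φ (D.center K)) e|
      ≤ (L * D.size) * ‖e‖ := by
        refine (abs_real_inner_le_norm _ _).trans ?_
        gcongr
        exact (hL.norm_sub_le _ _).trans (by gcongr; exact norm_sub_center_le_size hΩ hx)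
    _ = D.size * (‖e‖ * L) := by ring

theorem abs_integral_reconstruction_mul_sub_le (hd : 0 < d) (hΩ : Bornology.IsBounded Ω) {θ : ℝ}
    (hθ : D.IsShapeRegular θ) (hφ : Differentiable ℝ φ) (hL : LipschitzWith L (gradient φ))
    (v : D.X) (e : Space d) :
    |(∫ x in Ω, D.reconstruction v x * inner ℝ (gradient φ x) e) -
      ∑ K, v.1 K * D.boundaryFlux φ e K| ≤
      D.size * (‖e‖ * L * (θ * d + 1) * ∫ x in Ω, |D.reconstruction v x|) := by
  rw [integral_reconstruction_mul hΩ v (hL.continuous.inner continuous_const),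
    integral_abs_reconstruction hΩ, ← Finset.sum_sub_distrib, ← mul_assoc, Finset.mul_sum]
  refine (Finset.abs_sum_le_sum_abs _ _).trans (Finset.sum_le_sum fun K _ => ?_)
  have hflux := abs_boundaryFlux_sub_le hd hΩ hθ hφ hL e K
  rw [abs_sub_comm] at hflux
  rw [← mul_sub, abs_mul]
  calc _ ≤ |v.1 K| * (D.size * (‖e‖ * L) * D.cellMeasure K +
        D.size * (‖e‖ * L * θ * d) * D.cellMeasure K) :=
        mul_le_mul_of_nonneg_left ((abs_sub_le _ _ _).trans (add_le_add
          (abs_setIntegral_cell_inner_gradient_sub_le hΩ hL e K) hflux)) (abs_nonneg _)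
    _ = _ := by ring

theorem abs_integral_inner_discreteGradient_add_le (hd : 0 < d) (hΩ : Bornology.IsBounded Ω)
    {θ : ℝ} (hθ : D.IsShapeRegular θ) {v : D.X} (hv : v ∈ D.X0) (hφL : LipschitzWith L φ)
    (hφ : Differentiable ℝ φ) {L' : ℝ≥0} (hL' : LipschitzWith L' (gradient φ)) (e : Space d) :
    |(∫ x in Ω, inner ℝ (D.discreteGradient v x) (φ x • e)) +
      ∫ x in Ω, D.reconstruction v x * inner ℝ (gradient φ x) e| ≤
      D.size * (‖e‖ * L * (volume.real Ω + ((2 + 4 * d * θ ^ 2) * d + 4) * D.seminormX v ^ 2) +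
        ‖e‖ * L * (d * volume.real Ω + D.seminormX v ^ 2) +
        ‖e‖ * L' * (θ * d + 1) * ∫ x in Ω, |D.reconstruction v x|) := by
  have hgradient := abs_integral_inner_discreteGradient_sub_le hd hΩ hθ hφL v e
  have hflux := abs_sum_cellGradient_add_sum_boundaryFlux_le hd hΩ hφL hv e
  have hvalue := abs_integral_reconstruction_mul_sub_le hd hΩ hθ hφ hL' v e
  rw [abs_le] at hgradient hflux hvalue ⊢
  constructor <;> linarith [hgradient.1, hgradient.2, hflux.1, hflux.2, hvalue.1, hvalue.2]

end Discretisation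

/-! ### Intersections of slabs -/

section Slab

variable {E : Type*} [NormedAddCommGroup E] [InnerProductSpace ℝ E]

/-- The open slab of half-width `ε` about the hyperplane `ν · x = c`, for a unit vector `ν`. -/
def slab (ν : E) (c ε : ℝ) : Set E := {x | |inner ℝ ν x - c| < ε}

theorem isOpen_slab (ν : E) (c ε : ℝ) : IsOpen (slab ν c ε) :=
  isOpen_lt (by fun_prop) continuous_const

theorem inner_coe_orthogonal {ν : E} (v : (Submodule.span ℝ {ν})ᗮ) : inner ℝ ν (v : E) = 0 :=
  Submodule.mem_orthogonal_singleton_iff_inner_right.1 v.2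

theorem inner_smul_add_orthogonal {ν : E} (hν : ‖ν‖ = 1) (s : ℝ) (v : (Submodule.span ℝ {ν})ᗮ) :
    inner ℝ ν (s • ν + (v : E)) = s := by
  rw [inner_add_right, inner_coe_orthogonal, inner_smul_right, real_inner_self_eq_norm_sq, hν]
  ring

theorem norm_coe_orthogonal_le {ν : E} (s : ℝ) (v : (Submodule.span ℝ {ν})ᗮ) :
    ‖(v : E)‖ ≤ ‖s • ν + (v : E)‖ := by
  have h : ‖s • ν + (v : E)‖ ^ 2 = ‖s • ν‖ ^ 2 + ‖(v : E)‖ ^ 2 := by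
    rw [norm_add_sq_real, real_inner_smul_left, inner_coe_orthogonal]
    ring
  exact le_of_sq_le_sq (by linarith [sq_nonneg ‖s • ν‖]) (norm_nonneg _)

theorem slab_smul (ν : E) (c ε : ℝ) {r : ℝ} (hr : 0 < r) :
    slab (r • ν) c ε = slab ν (c / r) (ε / r) := by
  ext x
  change |_| < ε ↔ |_| < ε / r
  rw [lt_div_iff₀ hr, ← abs_of_pos hr, ← abs_mul, abs_of_pos hr, real_inner_smul_left, sub_mul,
    div_mul_cancel₀ _ hr.ne', mul_comm r]

variable [FiniteDimensional ℝ E] [MeasurableSpace E] [BorelSpace E]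

theorem exists_volume_inter_slab_le_of_norm_eq_one {ν : E} (hν : ‖ν‖ = 1) (R : ℝ) :
    ∃ C : ℝ, 0 ≤ C ∧ ∀ c ε : ℝ, 0 < ε →
      volume (Metric.closedBall 0 R ∩ slab ν c ε) ≤ ENNReal.ofReal (C * ε) := by
  let B : Set (Submodule.span ℝ {ν})ᗮ := Metric.closedBall 0 R
  refine ⟨2 * volume.real B, by positivity, fun c ε hε => ?_⟩
  rw [← (measurePreserving_smul_add_orthogonal hν).measure_preimage_emb
    (measurableEmbedding_smul_add_orthogonal hν), Measure.volume_eq_prod]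
  calc (volume.prod volume) _ ≤ (volume.prod volume) (Metric.ball c ε ×ˢ B) := by
        refine measure_mono fun p hp => ⟨?_, mem_closedBall_zero_iff.2
          ((norm_coe_orthogonal_le p.1 p.2).trans (mem_closedBall_zero_iff.1 hp.1))⟩
        have h : |inner ℝ ν (p.1 • ν + (p.2 : E)) - c| < ε := hp.2
        rwa [inner_smul_add_orthogonal hν] at h
    _ = ENNReal.ofReal (2 * volume.real B * ε) := by
        rw [Measure.prod_prod, Real.volume_ball, ← ofReal_measureReal
          Metric.isBounded_closedBall.measure_lt_top.ne, ← ENNReal.ofReal_mul (by positivity)]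
        congr 1
        ring

theorem exists_volume_inter_slab_le {p : E} (hp : p ≠ 0) (R : ℝ) :
    ∃ C : ℝ, 0 ≤ C ∧ ∀ c ε : ℝ, 0 < ε →
      volume (Metric.closedBall 0 R ∩ slab p c ε) ≤ ENNReal.ofReal (C * ε) := by
  have hp0 : 0 < ‖p‖ := norm_pos_iff.2 hp
  obtain ⟨C, hC, h⟩ := exists_volume_inter_slab_le_of_norm_eq_one
    (norm_smul_inv_norm (𝕜 := ℝ) hp) R
  refine ⟨C / ‖p‖, by positivity, fun c ε hε => ?_⟩
  have hslab := slab_smul (‖p‖⁻¹ • p) c ε hp0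
  rw [smul_inv_smul₀ hp0.ne'] at hslab
  rw [hslab, div_mul_eq_mul_div, mul_div_assoc]
  exact h _ _ (by positivity)

/-- Slicing in the direction `ν` reduces the claim to one slab in the hyperplane `ν^⊥`. -/
theorem exists_volume_inter_slab_inter_slab_le {ν p : E} (hν : ‖ν‖ = 1)
    (hp : p - inner ℝ ν p • ν ≠ 0) (R : ℝ) :
    ∃ C : ℝ, 0 ≤ C ∧ ∀ c c' ε : ℝ, 0 < ε →
      volume (Metric.closedBall 0 R ∩ (slab ν c ε ∩ slab p c' ε)) ≤
        ENNReal.ofReal (C * ε ^ 2) := by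
  have hmem : p - inner ℝ ν p • ν ∈ (Submodule.span ℝ {ν})ᗮ := by
    rw [Submodule.mem_orthogonal_singleton_iff_inner_right, inner_sub_right, inner_smul_right,
      real_inner_self_eq_norm_sq, hν]
    ring
  obtain ⟨C, hC, hslab⟩ := exists_volume_inter_slab_le
    (p := (⟨_, hmem⟩ : (Submodule.span ℝ {ν})ᗮ)) (by simpa [Subtype.ext_iff] using hp) R
  refine ⟨2 * C, by positivity, fun c c' ε hε => ?_⟩
  have he := measurableEmbedding_smul_add_orthogonal hν
  have hmeas : MeasurableSet (Metric.closedBall (0 : E) R ∩ (slab ν c ε ∩ slab p c' ε)) :=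
    measurableSet_closedBall.inter
      ((isOpen_slab ν c ε).inter (isOpen_slab p c' ε)).measurableSet
  rw [← (measurePreserving_smul_add_orthogonal hν).measure_preimage_emb he,
    Measure.volume_eq_prod, Measure.prod_apply (he.measurable hmeas)]
  calc _ ≤ ∫⁻ s : ℝ, (Metric.ball c ε).indicator (fun _ => ENNReal.ofReal (C * ε)) s := by
        refine lintegral_mono fun s => ?_
        have hsub : ∀ v : (Submodule.span ℝ {ν})ᗮ, s • ν + (v : E) ∈
            Metric.closedBall (0 : E) R ∩ (slab ν c ε ∩ slab p c' ε) → s ∈ Metric.ball c ε ∧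
              v ∈ Metric.closedBall 0 R ∩ slab ⟨_, hmem⟩ (c' - s * inner ℝ p ν) ε := by
          rintro v ⟨h1, (h2 : |_| < ε), (h3 : |_| < ε)⟩
          rw [inner_smul_add_orthogonal hν] at h2
          refine ⟨h2, mem_closedBall_zero_iff.2
            ((norm_coe_orthogonal_le s v).trans (mem_closedBall_zero_iff.1 h1)), ?_⟩
          change |_| < ε
          rw [Submodule.coe_inner, inner_sub_left, real_inner_smul_left, inner_coe_orthogonal]
          rw [inner_add_right, inner_smul_right] at h3
          convert h3 using 2
          ring
        by_cases hs : s ∈ Metric.ball c ε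
        · rw [Set.indicator_of_mem hs]
          exact (measure_mono fun v hv => (hsub v hv).2).trans (hslab _ ε hε)
        · rw [Set.indicator_of_notMem hs, nonpos_iff_eq_zero]
          exact measure_mono_null (fun v hv => hs (hsub v hv).1) measure_empty
    _ = ENNReal.ofReal (2 * C * ε ^ 2) := by
        rw [lintegral_indicator_const measurableSet_ball, Real.volume_ball,
          ← ENNReal.ofReal_mul (by positivity)]
        congr 1
        ring

end Slab

section Hyperplanes

variable {d : ℕ} {ν ν' : Space d} {c c' : ℝ}

theorem mem_slab_of_norm_sub_lt {x w : Space d} {ε : ℝ} (hν : ‖ν‖ = 1) (hw : w ∈ hyperplane ν c)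
    (hxw : ‖x - w‖ < ε) : x ∈ slab ν c ε := by
  have hwc : inner ℝ ν w = c := hw
  change |_| < ε
  rw [← hwc, ← inner_sub_right]
  refine (abs_real_inner_le_norm ν (x - w)).trans_lt ?_
  rwa [hν, one_mul]

theorem exists_disjoint_slab_of_parallel {τ : ℝ} (hτ : |τ| = 1)
    (hne : hyperplane ν c ≠ hyperplane (τ • ν) c') :
    ∃ η > 0, ∀ ε : ℝ, 2 * ε ≤ η → Disjoint (slab ν c ε) (slab (τ • ν) c' ε) := by
  have hτ0 : τ ≠ 0 := fun h => by simp [h] at hτ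
  have hη : τ * c - c' ≠ 0 := fun h => hne <| Set.ext fun x => by
    change inner ℝ ν x = c ↔ inner ℝ (τ • ν) x = c'
    rw [real_inner_smul_left, ← sub_eq_zero.1 h, mul_right_inj' hτ0]
  refine ⟨|τ * c - c'|, abs_pos.2 hη, fun ε hε => Set.disjoint_left.2 ?_⟩
  rintro x (h1 : |_| < ε) (h2 : |_| < ε)
  have h3 : |τ * inner ℝ ν x - τ * c| < ε := by rwa [← mul_sub, abs_mul, hτ, one_mul]
  rw [real_inner_smul_left] at h2
  rw [abs_sub_comm] at h3
  linarith [abs_sub_le (τ * c) (τ * inner ℝ ν x) c']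

theorem exists_volume_inter_parallel_slabs_le {τ : ℝ} (hτ : |τ| = 1)
    (hne : hyperplane ν c ≠ hyperplane (τ • ν) c') (R : ℝ) :
    ∃ C : ℝ, 0 ≤ C ∧ ∀ ε : ℝ,
      volume (Metric.closedBall 0 R ∩ (slab ν c ε ∩ slab (τ • ν) c' ε)) ≤
        ENNReal.ofReal (C * ε ^ 2) := by
  obtain ⟨η, hη, hdisj⟩ := exists_disjoint_slab_of_parallel hτ hne
  let B : Set (Space d) := Metric.closedBall 0 R
  refine ⟨volume.real B * (2 / η) ^ 2, by positivity, fun ε => ?_⟩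
  rcases le_or_gt (2 * ε) η with h | h
  · simp [(hdisj ε h).inter_eq]
  · have hone : 1 ≤ (2 / η * ε) ^ 2 :=
      one_le_pow₀ (by rw [div_mul_eq_mul_div, one_le_div hη]; exact h.le)
    calc volume _ ≤ volume B := measure_mono Set.inter_subset_left
      _ = ENNReal.ofReal (volume.real B) :=
          (ofReal_measureReal Metric.isBounded_closedBall.measure_lt_top.ne).symm
      _ ≤ _ := by
          rw [mul_assoc, ← mul_pow]
          exact ENNReal.ofReal_le_ofReal (le_mul_of_one_le_right measureReal_nonneg hone)

theorem exists_volume_inter_slabs_le (hν : ‖ν‖ = 1) (hν' : ‖ν'‖ = 1)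
    (hne : hyperplane ν c ≠ hyperplane ν' c') (R : ℝ) :
    ∃ C : ℝ, 0 ≤ C ∧ ∀ ε : ℝ, 0 < ε →
      volume (Metric.closedBall 0 R ∩ (slab ν c ε ∩ slab ν' c' ε)) ≤
        ENNReal.ofReal (C * ε ^ 2) := by
  by_cases hp : ν' - inner ℝ ν ν' • ν = 0
  · have hτ : ν' = (inner ℝ ν ν' : ℝ) • ν := sub_eq_zero.1 hp
    have hτ1 : |inner ℝ ν ν'| = (1 : ℝ) := by
      rw [← hν']
      conv_rhs => rw [hτ, norm_smul, hν, mul_one, Real.norm_eq_abs]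
    rw [hτ] at hne ⊢
    obtain ⟨C, hC, h⟩ := exists_volume_inter_parallel_slabs_le hτ1 hne R
    exact ⟨C, hC, fun ε _ => h ε⟩
  · obtain ⟨C, hC, h⟩ := exists_volume_inter_slab_inter_slab_le hν hp R
    exact ⟨C, hC, fun ε => h c c' ε⟩

end Hyperplanes

/-! ### The boundary of a polyhedral set -/

section Boundary

variable {d : ℕ} {Ω : Set (Space d)}

/-- A bounded polyhedral set, possibly disconnected: its boundary is contained in a finite union of
hyperplanes and it has no slits. -/
structure IsPolyhedral (Ω : Set (Space d)) : Prop where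
  isBounded : Bornology.IsBounded Ω
  interior_closure : interior (closure Ω) = Ω
  boundary_subset : ∃ H : Finset (Space d × ℝ), (∀ h ∈ H, h.1 ≠ 0) ∧
    closure Ω \ Ω ⊆ ⋃ h ∈ H, hyperplane h.1 h.2

theorem IsPolyhedralDomain.isPolyhedral (hΩ : IsPolyhedralDomain Ω) : IsPolyhedral Ω :=
  ⟨hΩ.isBounded, hΩ.interior_closure, hΩ.boundary_subset⟩

theorem IsPolyhedral.isOpen (hΩ : IsPolyhedral Ω) : IsOpen Ω :=
  hΩ.interior_closure ▸ isOpen_interior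

theorem IsPolyhedral.exists_unit_normals (hΩ : IsPolyhedral Ω) :
    ∃ H : Finset (Space d × ℝ), (∀ h ∈ H, ‖h.1‖ = 1) ∧
      closure Ω \ Ω ⊆ ⋃ h ∈ H, hyperplane h.1 h.2 := by
  classical
  obtain ⟨H, hH, hsub⟩ := hΩ.boundary_subset
  refine ⟨H.image fun h => (‖h.1‖⁻¹ • h.1, ‖h.1‖⁻¹ * h.2), fun h hh => ?_, fun x hx => ?_⟩
  · obtain ⟨k, hk, rfl⟩ := Finset.mem_image.1 hh
    exact norm_smul_inv_norm (𝕜 := ℝ) (hH k hk)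
  · obtain ⟨k, hk, hxk⟩ := Set.mem_iUnion₂.1 (hsub hx)
    refine Set.mem_iUnion₂.2 ⟨_, Finset.mem_image_of_mem _ hk, ?_⟩
    have hxk' : inner ℝ k.1 x = k.2 := hxk
    change inner ℝ (‖k.1‖⁻¹ • k.1) x = ‖k.1‖⁻¹ * k.2
    rw [real_inner_smul_left, hxk']

theorem subset_of_isPreconnected_of_disjoint_boundary (ho : IsOpen Ω) {S : Set (Space d)}
    (hS : IsPreconnected S) (hne : (S ∩ Ω).Nonempty) (hdisj : Disjoint S (closure Ω \ Ω)) :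
    S ⊆ Ω :=
  hS.subset_of_closure_inter_subset ho hne fun _ hw =>
    of_not_not fun hwΩ => Set.disjoint_left.1 hdisj hw.2 ⟨hw.1, hwΩ⟩

theorem exists_mem_segment_boundary (ho : IsOpen Ω) {x y : Space d} (hx : x ∈ Ω) (hy : y ∉ Ω) :
    ∃ z ∈ segment ℝ x y, z ∈ closure Ω \ Ω := by
  by_contra! hno
  exact hy (subset_of_isPreconnected_of_disjoint_boundary ho (convex_segment x y).isPreconnected
    ⟨x, left_mem_segment ℝ x y, hx⟩ (Set.disjoint_left.2 hno) (right_mem_segment ℝ x y))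

/-- Both open halves of `B` lie in `Ω`, so that `B` lies in the closure of `Ω`, which has no
slits. -/
theorem subset_of_boundary_subset_hyperplane (hΩ : interior (closure Ω) = Ω) {ν : Space d}
    (hν : ν ≠ 0) {c : ℝ} {B : Set (Space d)} (hB : IsOpen B) (hBc : Convex ℝ B)
    (hb : B ∩ (closure Ω \ Ω) ⊆ hyperplane ν c) {p q : Space d} (hp : p ∈ B ∩ Ω)
    (hpc : c < inner ℝ ν p) (hq : q ∈ B ∩ Ω) (hqc : inner ℝ ν q < c) : B ⊆ Ω := by
  have ho : IsOpen Ω := hΩ ▸ isOpen_interior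
  have hlin : IsLinearMap ℝ (fun x : Space d => inner ℝ ν x) := (innerₛₗ ℝ ν).isLinear
  have hupper : B ∩ {x | c < inner ℝ ν x} ⊆ Ω :=
    subset_of_isPreconnected_of_disjoint_boundary ho
      (hBc.inter (convex_halfSpace_gt hlin c)).isPreconnected ⟨p, ⟨hp.1, hpc⟩, hp.2⟩
      (Set.disjoint_left.2 fun x hx hxb => hx.2.ne' (hb ⟨hx.1, hxb⟩))
  have hlower : B ∩ {x | inner ℝ ν x < c} ⊆ Ω :=
    subset_of_isPreconnected_of_disjoint_boundary ho
      (hBc.inter (convex_halfSpace_lt hlin c)).isPreconnected ⟨q, ⟨hq.1, hqc⟩, hq.2⟩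
      (Set.disjoint_left.2 fun x hx hxb => hx.2.ne (hb ⟨hx.1, hxb⟩))
  have hdense : Dense (hyperplane ν c)ᶜ :=
    Measure.dense_of_ae (μ := volume) (compl_mem_ae_iff.2 (volume_hyperplane hν c))
  have hsub : B ∩ (hyperplane ν c)ᶜ ⊆ Ω := fun x hx =>
    (lt_or_gt_of_ne (show inner ℝ ν x ≠ c from hx.2)).elim (fun h => hlower ⟨hx.1, h⟩)
      fun h => hupper ⟨hx.1, h⟩
  rw [← hΩ]
  exact interior_maximal
    ((hdense.open_subset_closure_inter hB).trans (closure_mono hsub)) hB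

theorem exists_translate_notMem_or_mem_two_slabs (hΩ : interior (closure Ω) = Ω)
    {H : Finset (Space d × ℝ)} (hH : ∀ h ∈ H, ‖h.1‖ = 1)
    (hsub : closure Ω \ Ω ⊆ ⋃ h ∈ H, hyperplane h.1 h.2) {ε : ℝ} {x y : Space d}
    (hx : x ∈ Ω) (hy : y ∉ Ω) (hxy : ‖x - y‖ < ε) :
    (∃ h ∈ H, x + (2 * ε) • h.1 ∉ Ω ∨ x + (2 * ε) • -h.1 ∉ Ω) ∨
      ∃ h ∈ H, ∃ k ∈ H, hyperplane h.1 h.2 ≠ hyperplane k.1 k.2 ∧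
        x ∈ slab h.1 h.2 (4 * ε) ∩ slab k.1 k.2 (4 * ε) := by
  have hε : 0 < ε := (norm_nonneg _).trans_lt hxy
  obtain ⟨z, hzseg, hz⟩ := exists_mem_segment_boundary (hΩ ▸ isOpen_interior) hx hy
  have hxz : ‖x - z‖ < ε := by
    rw [norm_sub_rev]
    exact (norm_sub_le_of_mem_segment hzseg).trans_lt (by rwa [norm_sub_rev])
  obtain ⟨h, hh, hzh⟩ := Set.mem_iUnion₂.1 (hsub hz)
  by_contra! hcon
  obtain ⟨htrans, hslabs⟩ := hcon
  have hν := hH h hh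
  have hxh : |inner ℝ h.1 x - h.2| < ε := mem_slab_of_norm_sub_lt hν hzh hxz
  have hboundary : Metric.ball x (4 * ε) ∩ (closure Ω \ Ω) ⊆ hyperplane h.1 h.2 := by
    rintro w ⟨hw, hwb⟩
    obtain ⟨k, hk, hwk⟩ := Set.mem_iUnion₂.1 (hsub hwb)
    have hxk := mem_slab_of_norm_sub_lt (hH k hk) hwk (mem_ball_iff_norm'.1 hw)
    by_contra hwh
    exact hslabs h hh k hk (fun heq => hwh (heq ▸ hwk)) ⟨by
      change |_| < 4 * ε
      linarith, hxk⟩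
  have hball : ∀ n : Space d, ‖n‖ = 1 → x + (2 * ε) • n ∈ Metric.ball x (4 * ε) := fun n hn => by
    rw [mem_ball_iff_norm, add_sub_cancel_left, norm_smul, hn, mul_one, Real.norm_eq_abs,
      abs_of_pos (by positivity)]
    linarith
  have hνν : inner ℝ h.1 h.1 = (1 : ℝ) := by rw [real_inner_self_eq_norm_sq, hν, one_pow]
  rw [abs_lt] at hxh
  refine hz.2 (subset_of_boundary_subset_hyperplane hΩ (norm_ne_zero_iff.1 (hν ▸ one_ne_zero))
    Metric.isOpen_ball (convex_ball _ _) hboundary ⟨hball _ hν, (htrans h hh).1⟩ ?_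
    ⟨hball _ (by rwa [norm_neg]), (htrans h hh).2⟩ ?_ (mem_ball_iff_norm'.2 (by linarith)))
  · rw [inner_add_right, inner_smul_right, hνν]
    linarith
  · rw [inner_add_right, inner_smul_right, inner_neg_right, hνν]
    linarith

end Boundary

/-! ### The mass of a boundary layer -/

section LTwo

variable {α E : Type*} [MeasurableSpace α] {μ : Measure α} [NormedAddCommGroup E]

theorem eLpNorm_two_sq (f : α → E) : eLpNorm f 2 μ ^ 2 = ∫⁻ x, ‖f x‖ₑ ^ 2 ∂μ := by
  simpa using eLpNorm_nnreal_pow_eq_lintegral (f := f) (μ := μ) (p := 2) two_ne_zero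

theorem sq_lintegral_mul_le {a b : α → ℝ≥0∞} (ha : AEMeasurable a μ) (hb : AEMeasurable b μ) :
    (∫⁻ x, a x * b x ∂μ) ^ 2 ≤ (∫⁻ x, a x ∂μ) * ∫⁻ x, a x * b x ^ 2 ∂μ := by
  have hsqrt : ∀ t : ℝ≥0∞, (t ^ (2⁻¹ : ℝ)) ^ 2 = t := fun t => by
    rw [← ENNReal.rpow_mul_natCast]; norm_num
  have hsplit : ∀ x, a x * b x = a x ^ (2⁻¹ : ℝ) * (a x ^ (2⁻¹ : ℝ) * b x) := fun x => by
    rw [← mul_assoc, ← sq, hsqrt]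
  have holder := ENNReal.lintegral_mul_le_Lp_mul_Lq μ Real.HolderConjugate.two_two
    (ha.pow_const (2⁻¹ : ℝ)) ((ha.pow_const (2⁻¹ : ℝ)).mul hb)
  simp only [Pi.mul_apply, ← hsplit, ENNReal.rpow_two, one_div, mul_pow, hsqrt] at holder
  calc _ ≤ _ := pow_le_pow_left' holder 2
    _ = _ := by rw [mul_pow, hsqrt, hsqrt]

end LTwo

section BoundaryLayer

variable {d : ℕ}

theorem eLpNorm_comp_add_right {E : Type*} [NormedAddCommGroup E] {f : Space d → E}
    (hf : AEStronglyMeasurable f volume) (p : ℝ≥0∞) (h : Space d) :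
    eLpNorm (fun x => f (x + h)) p volume = eLpNorm f p volume :=
  eLpNorm_comp_measurePreserving hf (measurePreserving_add_right volume h)

/-- The points whose distance to the complement of `Ω` is at least `ε`. -/
def inset (Ω : Set (Space d)) (ε : ℝ) : Set (Space d) := {x | ∀ y, y ∉ Ω → ε ≤ ‖x - y‖}

/-- The points close to two distinct hyperplanes of the finite family `H`. A hyperplane is encoded
as a pair of a normal vector and a constant. -/
def crossings (H : Finset (Space d × ℝ)) (ε : ℝ) : Set (Space d) :=
  ⋃ h ∈ H, ⋃ k ∈ H, ⋃ _ : hyperplane h.1 h.2 ≠ hyperplane k.1 k.2,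
    slab h.1 h.2 ε ∩ slab k.1 k.2 ε

theorem isClosed_inset (Ω : Set (Space d)) (ε : ℝ) : IsClosed (inset Ω ε) := by
  simp only [inset, Set.ofPred_forall]
  exact isClosed_iInter fun y => isClosed_iInter fun _ =>
    isClosed_le continuous_const (by fun_prop)

theorem inset_subset {ε : ℝ} (hε : 0 < ε) (Ω : Set (Space d)) : inset Ω ε ⊆ Ω := fun x hx => by
  by_contra hxΩ
  have := hx x hxΩ
  rw [sub_self, norm_zero] at this
  linarith

theorem isOpen_crossings (H : Finset (Space d × ℝ)) (ε : ℝ) : IsOpen (crossings H ε) :=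
  isOpen_biUnion fun _ _ => isOpen_biUnion fun _ _ => isOpen_iUnion fun _ =>
    (isOpen_slab _ _ _).inter (isOpen_slab _ _ _)

theorem exists_volume_inter_crossings_le {H : Finset (Space d × ℝ)} (hH : ∀ h ∈ H, ‖h.1‖ = 1)
    (R : ℝ) : ∃ C : ℝ≥0, ∀ ε : ℝ, 0 < ε →
      volume (Metric.closedBall 0 R ∩ crossings H ε) ≤ C * ENNReal.ofReal ε ^ 2 := by
  have hpair : ∀ h k : Space d × ℝ, ∃ C : ℝ≥0, h ∈ H → k ∈ H → ∀ ε : ℝ, 0 < ε →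
      volume (Metric.closedBall 0 R ∩ ⋃ _ : hyperplane h.1 h.2 ≠ hyperplane k.1 k.2,
        slab h.1 h.2 ε ∩ slab k.1 k.2 ε) ≤ C * ENNReal.ofReal ε ^ 2 := by
    intro h k
    by_cases hhk : h ∈ H ∧ k ∈ H ∧ hyperplane h.1 h.2 ≠ hyperplane k.1 k.2
    · obtain ⟨hh, hk, hne⟩ := hhk
      obtain ⟨C, hC, hvol⟩ := exists_volume_inter_slabs_le (hH h hh) (hH k hk) hne R
      refine ⟨C.toNNReal, fun _ _ ε hε => ?_⟩
      simp only [ne_eq, hne, not_false_eq_true, Set.iUnion_true]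
      refine (hvol ε hε).trans_eq ?_
      rw [ENNReal.ofReal_mul hC, ENNReal.ofReal_pow hε.le]
      rfl
    · refine ⟨0, fun hh hk ε _ => ?_⟩
      have heq : ¬ hyperplane h.1 h.2 ≠ hyperplane k.1 k.2 := fun hne => hhk ⟨hh, hk, hne⟩
      simp [heq]
  choose C hC using hpair
  refine ⟨∑ h ∈ H, ∑ k ∈ H, C h k, fun ε hε => ?_⟩
  simp only [crossings, Set.inter_iUnion₂, ENNReal.ofNNReal_finsetSum, Finset.sum_mul]
  exact (measure_biUnion_finset_le _ _).trans <| Finset.sum_le_sum fun h hh =>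
    (measure_biUnion_finset_le _ _).trans <| Finset.sum_le_sum fun k hk => hC h k hh hk ε hε

variable {Ω : Set (Space d)}

theorem enorm_sq_indicator_compl_inset_le (hΩ : interior (closure Ω) = Ω)
    {H : Finset (Space d × ℝ)} (hH : ∀ h ∈ H, ‖h.1‖ = 1)
    (hsub : closure Ω \ Ω ⊆ ⋃ h ∈ H, hyperplane h.1 h.2) {B : Set (Space d)} (hB : Ω ⊆ B)
    {f : Space d → ℝ} {M : ℝ≥0∞} (hM : ∀ x, ‖f x‖ₑ ≤ M) (h0 : ∀ x, x ∉ Ω → f x = 0)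
    (ε : ℝ) (x : Space d) :
    ‖(inset Ω ε)ᶜ.indicator f x‖ₑ ^ 2 ≤
      (∑ h ∈ H, (‖f (x + (2 * ε) • h.1) - f x‖ₑ ^ 2 + ‖f (x + (2 * ε) • -h.1) - f x‖ₑ ^ 2)) +
        (B ∩ crossings H (4 * ε)).indicator (fun _ => M ^ 2) x := by
  by_cases hx : x ∈ Ω ∧ x ∈ (inset Ω ε)ᶜ
  swap
  · have : (inset Ω ε)ᶜ.indicator f x = 0 :=
      Set.indicator_apply_eq_zero.2 fun hxε => h0 x fun hxΩ => hx ⟨hxΩ, hxε⟩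
    simp [this]
  obtain ⟨hxΩ, hxε⟩ := hx
  rw [Set.indicator_of_mem hxε]
  simp only [inset, Set.mem_compl_iff, Set.mem_ofPred_eq, not_forall, not_le] at hxε
  obtain ⟨y, hy, hxy⟩ := hxε
  rcases exists_translate_notMem_or_mem_two_slabs hΩ hH hsub hxΩ hy hxy with
    ⟨h, hh, hout⟩ | ⟨h, hh, k, hk, hne, hmem⟩
  · refine le_add_right (le_trans ?_ (Finset.single_le_sum (fun _ _ => zero_le) hh))
    rcases hout with hout | hout
    · refine le_add_right (le_of_eq ?_)
      rw [h0 _ hout, zero_sub, enorm_neg]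
    · refine le_add_left (le_of_eq ?_)
      rw [h0 _ hout, zero_sub, enorm_neg]
  · have hcross : x ∈ crossings H (4 * ε) :=
      Set.mem_biUnion hh (Set.mem_biUnion hk (Set.mem_iUnion.2 ⟨hne, hmem⟩))
    refine le_add_left ?_
    rw [Set.indicator_of_mem (Set.mem_inter (hB hxΩ) hcross)]
    exact pow_le_pow_left' (hM x) 2

/-- Near the boundary either a translation of length `2ε` leaves `Ω`, so that `f` is an increment
of itself, or two of the hyperplanes are close, which happens on a set of measure `O(ε²)`. -/
theorem exists_eLpNorm_indicator_compl_inset_le (hΩ : IsPolyhedral Ω) {f : Space d → ℝ}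
    (hf : Measurable f) {M A : ℝ≥0} (hM : ∀ x, ‖f x‖ₑ ≤ M) (h0 : ∀ x, x ∉ Ω → f x = 0)
    (hA : ∀ h, eLpNorm (fun x => f (x + h) - f x) 2 volume ≤ A * ‖h‖ₑ) :
    ∃ C : ℝ≥0, ∀ ε : ℝ, 0 < ε →
      eLpNorm ((inset Ω ε)ᶜ.indicator f) 2 volume ≤ C * ENNReal.ofReal ε := by
  obtain ⟨H, hH, hsub⟩ := hΩ.exists_unit_normals
  obtain ⟨R, hR⟩ := hΩ.isBounded.subset_closedBall 0
  obtain ⟨C, hC⟩ := exists_volume_inter_crossings_le hH R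
  refine ⟨NNReal.sqrt (H.card * (8 * A ^ 2) + 16 * M ^ 2 * C), fun ε hε => ?_⟩
  have hincr : ∀ h : Space d, ‖h‖ = 1 →
      ∫⁻ x, ‖f (x + (2 * ε) • h) - f x‖ₑ ^ 2 ≤ 4 * A ^ 2 * ENNReal.ofReal ε ^ 2 := fun h hh => by
    rw [← eLpNorm_two_sq]
    refine (pow_le_pow_left' (hA _) 2).trans_eq ?_
    rw [← ofReal_norm, norm_smul, hh, mul_one, Real.norm_of_nonneg (by positivity),
      ENNReal.ofReal_mul zero_le_two, ENNReal.ofReal_ofNat]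
    ring
  have hmeas : ∀ h : Space d, Measurable fun x => ‖f (x + h) - f x‖ₑ ^ 2 := fun h => by fun_prop
  set W := Metric.closedBall 0 R ∩ crossings H (4 * ε)
  have hW : MeasurableSet W :=
    Metric.isClosed_closedBall.measurableSet.inter (isOpen_crossings _ _).measurableSet
  rw [← ENNReal.pow_le_pow_left_iff two_ne_zero, eLpNorm_two_sq, mul_pow, ← ENNReal.coe_pow,
    NNReal.sq_sqrt]
  calc _ ≤ _ := lintegral_mono
          (enorm_sq_indicator_compl_inset_le hΩ.interior_closure hH hsub hR hM h0 ε)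
    _ = (∑ h ∈ H, ((∫⁻ x, ‖f (x + (2 * ε) • h.1) - f x‖ₑ ^ 2) +
          ∫⁻ x, ‖f (x + (2 * ε) • -h.1) - f x‖ₑ ^ 2)) + (M : ℝ≥0∞) ^ 2 * volume W := by
        rw [lintegral_add_right _ (measurable_const.indicator hW), lintegral_indicator_const hW,
          lintegral_finsetSum _ fun h _ => by fun_prop]
        simp only [lintegral_add_left (hmeas _)]
    _ ≤ (∑ _h ∈ H, (4 * A ^ 2 * ENNReal.ofReal ε ^ 2 + 4 * A ^ 2 * ENNReal.ofReal ε ^ 2)) +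
          (M : ℝ≥0∞) ^ 2 * (C * ENNReal.ofReal (4 * ε) ^ 2) := by
        gcongr with h hh
        · exact hincr _ (hH h hh)
        · exact hincr _ (by rw [norm_neg, hH h hh])
        · exact hC _ (by positivity)
    _ = _ := by
        rw [Finset.sum_const, nsmul_eq_mul, ENNReal.ofReal_mul zero_le_four,
          ENNReal.ofReal_ofNat]
        push_cast
        ring

theorem eLpNorm_integral_increment_le {F : Type*} [NormedAddCommGroup F] [NormedSpace ℝ F]
    {k : Space d → F} (hk : StronglyMeasurable k) {g : Space d → ℝ} (hg : Measurable g) {B : ℝ≥0∞}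
    (hB : ∀ z, k z ≠ 0 → eLpNorm (fun x => g (x - z) - g x) 2 volume ≤ B) :
    eLpNorm (fun x => ∫ z, (g (x - z) - g x) • k z) 2 volume ≤ (∫⁻ z, ‖k z‖ₑ) * B := by
  set N := ∫⁻ z, ‖k z‖ₑ
  have hkm : Measurable fun z => ‖k z‖ₑ := hk.enorm
  rw [← ENNReal.pow_le_pow_left_iff two_ne_zero, eLpNorm_two_sq]
  calc ∫⁻ x, ‖∫ z, (g (x - z) - g x) • k z‖ₑ ^ 2
      ≤ ∫⁻ x, (∫⁻ z, ‖k z‖ₑ * ‖g (x - z) - g x‖ₑ) ^ 2 := by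
        gcongr with x
        refine (enorm_integral_le_lintegral_enorm _).trans_eq ?_
        simp only [enorm_smul, mul_comm]
    _ ≤ ∫⁻ x, N * ∫⁻ z, ‖k z‖ₑ * ‖g (x - z) - g x‖ₑ ^ 2 := by
        gcongr with x
        exact sq_lintegral_mul_le hkm.aemeasurable (by fun_prop)
    _ = N * ∫⁻ z, ‖k z‖ₑ * ∫⁻ x, ‖g (x - z) - g x‖ₑ ^ 2 := by
        rw [lintegral_const_mul _ (Measurable.lintegral_prod_right (by fun_prop)),
          lintegral_lintegral_swap (by fun_prop)]
        congr with z
        exact lintegral_const_mul _ (by fun_prop)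
    _ ≤ N * ∫⁻ z, ‖k z‖ₑ * B ^ 2 := by
        refine mul_le_mul_right (lintegral_mono fun z => ?_) N
        rcases eq_or_ne (k z) 0 with hz | hz
        · simp [hz]
        · rw [← eLpNorm_two_sq]
          gcongr
          exact hB z hz
    _ = (N * B) ^ 2 := by
        rw [lintegral_mul_const _ hkm]
        ring

end BoundaryLayer

/-! ### Mollification -/

section Mollifier

variable {d : ℕ} {ε : ℝ}

/-- The bump function from which the mollifiers are built by scaling. -/
def standardBump (d : ℕ) : ContDiffBump (0 : Space d) := ⟨1 / 2, 1, by norm_num, by norm_num⟩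

/-- The standard mollifier `ε⁻ᵈ ρ(z / ε)`, supported in the ball of radius `ε` and of integral
one. -/
def mollifier (d : ℕ) (ε : ℝ) (z : Space d) : ℝ :=
  (ε ^ d)⁻¹ * (standardBump d).normed volume (ε⁻¹ • z)

theorem contDiff_mollifier : ContDiff ℝ ∞ (mollifier d ε) :=
  contDiff_const.mul ((ContDiffBump.contDiff_normed _).comp (contDiff_const_smul _))

theorem norm_lt_of_mollifier_ne_zero (hε : 0 < ε) {z : Space d} (hz : mollifier d ε z ≠ 0) :
    ‖z‖ < ε := by
  have hmem : ε⁻¹ • z ∈ Metric.ball (0 : Space d) 1 := by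
    rw [show (1 : ℝ) = (standardBump d).rOut from rfl,
      ← (standardBump d).support_normed_eq (μ := volume)]
    exact right_ne_zero_of_mul hz
  rwa [mem_ball_zero_iff, norm_smul, Real.norm_of_nonneg (inv_nonneg.2 hε.le),
    inv_mul_lt_iff₀ hε, mul_one] at hmem

theorem hasCompactSupport_mollifier (hε : 0 < ε) : HasCompactSupport (mollifier d ε) :=
  HasCompactSupport.of_support_subset_isCompact (isCompact_closedBall (0 : Space d) ε)
    fun z hz => by simpa using (norm_lt_of_mollifier_ne_zero hε hz).le

theorem mollifier_nonneg (hε : 0 < ε) (z : Space d) : 0 ≤ mollifier d ε z :=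
  mul_nonneg (by positivity) (ContDiffBump.nonneg_normed _ _)

theorem integral_rescale {E : Type*} [NormedAddCommGroup E] [NormedSpace ℝ E] (hε : 0 < ε)
    (f : Space d → E) : ∫ z, (ε ^ d)⁻¹ • f (ε⁻¹ • z) = ∫ z, f z := by
  rw [integral_smul, Measure.integral_comp_inv_smul_of_nonneg _ _ hε.le,
    finrank_euclideanSpace_fin, inv_smul_smul₀ (by positivity)]

theorem integral_mollifier (hε : 0 < ε) : ∫ z, mollifier d ε z = 1 :=
  (integral_rescale hε _).trans (ContDiffBump.integral_normed _)

theorem lintegral_enorm_mollifier (hε : 0 < ε) : ∫⁻ z, ‖mollifier d ε z‖ₑ = 1 := by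
  rw [← ofReal_integral_norm_eq_lintegral_enorm
    (contDiff_mollifier.continuous.integrable_of_hasCompactSupport
      (hasCompactSupport_mollifier hε))]
  simp only [Real.norm_of_nonneg (mollifier_nonneg hε _), integral_mollifier hε,
    ENNReal.ofReal_one]

theorem exists_lintegral_enorm_fderiv_mollifier_le (d : ℕ) : ∃ C : ℝ≥0, ∀ ε : ℝ, 0 < ε →
    ∫⁻ z, ‖fderiv ℝ (mollifier d ε) z‖ₑ ≤ C * ENNReal.ofReal ε⁻¹ := by
  set ρ := (standardBump d).normed volume
  have hρ : ContDiff ℝ ∞ ρ := ContDiffBump.contDiff_normed _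
  refine ⟨(∫ z, ‖fderiv ℝ ρ z‖).toNNReal, fun ε hε => ?_⟩
  have hfderiv : ∀ z, ‖fderiv ℝ (mollifier d ε) z‖ =
      ε⁻¹ * ((ε ^ d)⁻¹ • ‖fderiv ℝ ρ (ε⁻¹ • z)‖) := fun z => by
    have : fderiv ℝ (mollifier d ε) z = (ε ^ d)⁻¹ • ε⁻¹ • fderiv ℝ ρ (ε⁻¹ • z) := by
      rw [← fderiv_comp_smul]
      exact fderiv_const_mul ((hρ.comp (contDiff_const_smul _)).differentiable (by simp) z) _
    rw [this, norm_smul, norm_smul, Real.norm_of_nonneg (by positivity),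
      Real.norm_of_nonneg (by positivity), smul_eq_mul, mul_left_comm]
  rw [← ofReal_integral_norm_eq_lintegral_enorm
    ((contDiff_mollifier.continuous_fderiv (by simp)).integrable_of_hasCompactSupport
      ((hasCompactSupport_mollifier hε).fderiv ℝ))]
  simp only [hfderiv]
  rw [integral_const_mul, integral_rescale hε (fun z => ‖fderiv ℝ ρ z‖),
    ENNReal.ofReal_mul (by positivity), mul_comm]
  rfl

theorem integral_fderiv_eq_zero {k : Space d → ℝ} (hk : ContDiff ℝ 1 k)
    (hkc : HasCompactSupport k) : ∫ z, fderiv ℝ k z = 0 := by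
  have hint : Integrable (fderiv ℝ k) :=
    (hk.continuous_fderiv one_ne_zero).integrable_of_hasCompactSupport (hkc.fderiv ℝ)
  ext e
  rw [ContinuousLinearMap.integral_apply hint, zero_apply]
  have := integral_mul_fderiv_eq_neg_fderiv_mul_of_integrable (μ := volume) (v := e)
    (f := fun _ : Space d => (1 : ℝ)) (g := k) (by simp)
    (by simpa using hint.apply_continuousLinearMap e)
    (by simpa using hk.continuous.integrable_of_hasCompactSupport hkc)
    (fun _ _ => differentiableAt_const _) (fun _ _ => hk.differentiable one_ne_zero _)
  simpa using this

/-- The convolution of `g` with the mollifier of scale `ε`. -/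
def mollify (ε : ℝ) (g : Space d → ℝ) : Space d → ℝ :=
  convolution (mollifier d ε) g (ContinuousLinearMap.mul ℝ ℝ) volume

variable {g : Space d → ℝ}

theorem contDiff_mollify (hε : 0 < ε) (hg : LocallyIntegrable g) :
    ContDiff ℝ ∞ (mollify ε g) :=
  (hasCompactSupport_mollifier hε).contDiff_convolution_left _ contDiff_mollifier hg

theorem support_mollify_subset (hε : 0 < ε) (Ω : Set (Space d)) (f : Space d → ℝ) :
    Function.support (mollify ε ((inset Ω (2 * ε)).indicator f)) ⊆ inset Ω ε := by
  refine (support_convolution_subset_swap _).trans ?_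
  rintro _ ⟨a, ha, z, hz, rfl⟩ y hy
  have hz' := norm_lt_of_mollifier_ne_zero hε hz
  have ha' := Set.mem_of_indicator_ne_zero ha y hy
  have := norm_sub_le (a + z - y) z
  rw [show a + z - y - z = a - y by abel] at this
  linarith

theorem mollify_sub_eq_integral (hε : 0 < ε) (hg : LocallyIntegrable g) (x : Space d) :
    mollify ε g x - g x = ∫ z, (g (x - z) - g x) • mollifier d ε z := by
  have hc := contDiff_mollifier.continuous (𝕜 := ℝ) (f := mollifier d ε)
  have hi : Integrable fun z => g (x - z) * mollifier d ε z := by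
    simpa [ConvolutionExistsAt, mul_comm] using
      (hasCompactSupport_mollifier hε).convolutionExists_left (ContinuousLinearMap.mul ℝ ℝ) hc hg x
  have hi' : Integrable fun z => g x * mollifier d ε z :=
    (hc.integrable_of_hasCompactSupport (hasCompactSupport_mollifier hε)).const_mul _
  simp only [smul_eq_mul, sub_mul]
  rw [integral_sub hi hi', integral_const_mul, integral_mollifier hε, mul_one]
  simp only [mollify, convolution, ContinuousLinearMap.mul_apply', mul_comm]

theorem fderiv_mollify_eq_integral (hε : 0 < ε) (hg : LocallyIntegrable g) (x : Space d) :
    fderiv ℝ (mollify ε g) x = ∫ z, (g (x - z) - g x) • fderiv ℝ (mollifier d ε) z := by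
  have hk := (contDiff_mollifier (d := d) (ε := ε)).of_le (m := 1) (by simp)
  have hkc := hasCompactSupport_mollifier (d := d) hε
  have hc := hk.continuous_fderiv one_ne_zero
  have hprecomp : ∀ (A : Space d →L[ℝ] ℝ) (t : ℝ),
      (ContinuousLinearMap.mul ℝ ℝ).precompL (Space d) A t = t • A := fun A t => by
    ext e
    simp [ContinuousLinearMap.precompL_apply, mul_comm]
  have hi : Integrable fun z => g (x - z) • fderiv ℝ (mollifier d ε) z := by
    simpa only [ConvolutionExistsAt, hprecomp] using (hkc.fderiv ℝ).convolutionExists_left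
      ((ContinuousLinearMap.mul ℝ ℝ).precompL (Space d)) hc hg x
  have hi' : Integrable fun z => g x • fderiv ℝ (mollifier d ε) z :=
    (hc.integrable_of_hasCompactSupport (hkc.fderiv ℝ)).smul (g x)
  simp only [sub_smul]
  rw [integral_sub hi hi', integral_smul, integral_fderiv_eq_zero hk hkc, smul_zero, sub_zero,
    mollify, (hkc.hasFDerivAt_convolution_left _ hk hg x).fderiv]
  simp only [convolution, hprecomp]

theorem norm_gradient (φ : Space d → ℝ) (x : Space d) : ‖gradient φ x‖ = ‖fderiv ℝ φ x‖ :=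
  LinearIsometryEquiv.norm_map _ _

theorem eLpNorm_mollify_sub_le (hε : 0 < ε) (hg : LocallyIntegrable g) (hgm : Measurable g)
    {B : ℝ≥0∞} (hB : ∀ z, ‖z‖ ≤ ε → eLpNorm (fun x => g (x - z) - g x) 2 volume ≤ B) :
    eLpNorm (fun x => mollify ε g x - g x) 2 volume ≤ B := by
  simp only [mollify_sub_eq_integral hε hg]
  refine (eLpNorm_integral_increment_le contDiff_mollifier.continuous.stronglyMeasurable hgm
    fun z hz => hB z (norm_lt_of_mollifier_ne_zero hε hz).le).trans_eq ?_
  rw [lintegral_enorm_mollifier hε, one_mul]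

theorem eLpNorm_gradient_mollify_le (hε : 0 < ε) (hg : LocallyIntegrable g) (hgm : Measurable g)
    {B : ℝ≥0∞} (hB : ∀ z, ‖z‖ ≤ ε → eLpNorm (fun x => g (x - z) - g x) 2 volume ≤ B) :
    eLpNorm (gradient (mollify ε g)) 2 volume ≤
      (∫⁻ z, ‖fderiv ℝ (mollifier d ε) z‖ₑ) * B := by
  have htsupport : tsupport (mollifier d ε) ⊆ Metric.closedBall 0 ε :=
    closure_minimal (fun z hz => by simpa using (norm_lt_of_mollifier_ne_zero hε hz).le)
      Metric.isClosed_closedBall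
  rw [eLpNorm_congr_norm_ae (g := fderiv ℝ (mollify ε g)) (.of_forall (norm_gradient _))]
  simp only [funext (fderiv_mollify_eq_integral hε hg)]
  exact eLpNorm_integral_increment_le
    (contDiff_mollifier.continuous_fderiv (by simp)).stronglyMeasurable hgm fun z hz =>
      hB z (by simpa using htsupport (support_fderiv_subset ℝ hz))

end Mollifier

section Approximation

variable {d : ℕ} {Ω : Set (Space d)}

theorem eLpNorm_increment_sub_le {f r : Space d → ℝ} (hf : Measurable f) (hr : Measurable r)
    (z : Space d) :
    eLpNorm (fun x => (f (x - z) - r (x - z)) - (f x - r x)) 2 volume ≤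
      eLpNorm (fun x => f (x - z) - f x) 2 volume + 2 * eLpNorm r 2 volume := by
  have hrz : eLpNorm (fun x => r (x - z)) 2 volume = eLpNorm r 2 volume := by
    simpa only [sub_eq_add_neg] using eLpNorm_comp_add_right hr.aestronglyMeasurable 2 (-z)
  calc _ = eLpNorm ((fun x => f (x - z) - f x) - ((fun x => r (x - z)) - r)) 2 volume := by
        congr with x
        simp only [Pi.sub_apply]
        ring
    _ ≤ _ := eLpNorm_sub_le (Measurable.aestronglyMeasurable (by fun_prop))
        (Measurable.aestronglyMeasurable (by fun_prop)) one_le_two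
    _ ≤ _ := by
        gcongr
        refine (eLpNorm_sub_le (Measurable.aestronglyMeasurable (by fun_prop))
          (Measurable.aestronglyMeasurable (by fun_prop)) one_le_two).trans_eq ?_
        rw [hrz, two_mul]

theorem memLp_of_bounded_of_eq_zero_off (hΩm : MeasurableSet Ω) (hΩ : Bornology.IsBounded Ω)
    {f : Space d → ℝ} (hf : Measurable f) {M : ℝ} (hM : ∀ x, ‖f x‖ ≤ M)
    (h0 : ∀ x, x ∉ Ω → f x = 0) (p : ℝ≥0∞) : MemLp f p := by
  have : IsFiniteMeasure (volume.restrict Ω) := ⟨by simpa using hΩ.measure_lt_top⟩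
  rw [← Set.indicator_eq_self.2 (Function.support_subset_iff'.2 h0),
    memLp_indicator_iff_restrict hΩm]
  exact MemLp.of_bound hf.aestronglyMeasurable M (.of_forall hM)

theorem isTestFunction_mollify (hΩ : Bornology.IsBounded Ω) {ε : ℝ} (hε : 0 < ε)
    {f : Space d → ℝ} (hf : LocallyIntegrable ((inset Ω (2 * ε)).indicator f)) :
    IsTestFunction Ω (mollify ε ((inset Ω (2 * ε)).indicator f)) := by
  have hsupp := support_mollify_subset hε Ω f
  have hsub := inset_subset hε Ω
  exact ⟨contDiff_mollify hε hf,
    HasCompactSupport.of_support_subset_isCompact (Metric.isCompact_of_isClosed_isBounded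
      (isClosed_inset Ω ε) (hΩ.subset hsub)) hsupp,
    (closure_minimal hsupp (isClosed_inset Ω ε)).trans hsub⟩

theorem exists_eLpNorm_indicator_inset_le (hΩ : IsPolyhedral Ω) {f : Space d → ℝ}
    (hf : Measurable f) {M A : ℝ≥0} (hM : ∀ x, ‖f x‖ₑ ≤ M) (h0 : ∀ x, x ∉ Ω → f x = 0)
    (hA : ∀ h, eLpNorm (fun x => f (x + h) - f x) 2 volume ≤ A * ‖h‖ₑ) :
    ∃ C : ℝ≥0, ∀ ε : ℝ, 0 < ε →
      eLpNorm (fun x => (inset Ω (2 * ε)).indicator f x - f x) 2 volume ≤ C * ENNReal.ofReal ε ∧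
      ∀ z : Space d, ‖z‖ ≤ ε → eLpNorm (fun x => (inset Ω (2 * ε)).indicator f (x - z) -
        (inset Ω (2 * ε)).indicator f x) 2 volume ≤ C * ENNReal.ofReal ε := by
  obtain ⟨C, hC⟩ := exists_eLpNorm_indicator_compl_inset_le hΩ hf hM h0 hA
  refine ⟨A + 4 * C, fun ε hε => ?_⟩
  have hr : eLpNorm ((inset Ω (2 * ε))ᶜ.indicator f) 2 volume ≤ 2 * C * ENNReal.ofReal ε := by
    refine (hC (2 * ε) (by positivity)).trans_eq ?_
    rw [ENNReal.ofReal_mul zero_le_two, ENNReal.ofReal_ofNat]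
    ring
  simp only [fun x => eq_sub_of_add_eq
    (congrFun (Set.indicator_self_add_compl (inset Ω (2 * ε)) f) x)]
  refine ⟨?_, fun z hz => ?_⟩
  · simp only [sub_sub_cancel_left]
    refine (eLpNorm_neg _ 2 volume).le.trans (hr.trans ?_)
    push_cast
    gcongr
    calc (2 * C : ℝ≥0∞) ≤ 4 * C := by gcongr; norm_num
      _ ≤ A + 4 * C := le_add_self
  · have hz' : ‖-z‖ₑ ≤ ENNReal.ofReal ε := by
      rw [enorm_neg, ← ofReal_norm]
      gcongr
    have hfz : eLpNorm (fun x => f (x - z) - f x) 2 volume ≤ A * ENNReal.ofReal ε := by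
      simpa only [sub_eq_add_neg] using (hA (-z)).trans (by gcongr)
    refine (eLpNorm_increment_sub_le hf (hf.indicator
      (isClosed_inset Ω (2 * ε)).measurableSet.compl) z).trans ?_
    calc _ ≤ A * ENNReal.ofReal ε + 2 * (2 * C * ENNReal.ofReal ε) := by gcongr
      _ = _ := by push_cast; ring

theorem exists_testFunction_near (hΩ : IsPolyhedral Ω) {f : Space d → ℝ} (hf : Measurable f)
    {M A : ℝ≥0} (hM : ∀ x, ‖f x‖ₑ ≤ M) (h0 : ∀ x, x ∉ Ω → f x = 0)
    (hA : ∀ h, eLpNorm (fun x => f (x + h) - f x) 2 volume ≤ A * ‖h‖ₑ) :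
    ∃ C : ℝ≥0, ∀ ε : ℝ, 0 < ε → ∃ w : Space d → ℝ, IsTestFunction Ω w ∧
      eLpNorm (fun x => w x - f x) 2 volume ≤ C * ENNReal.ofReal ε ∧
      eLpNorm (gradient w) 2 volume ≤ C := by
  obtain ⟨C₁, hC₁⟩ := exists_eLpNorm_indicator_inset_le hΩ hf hM h0 hA
  obtain ⟨C₂, hC₂⟩ := exists_lintegral_enorm_fderiv_mollifier_le d
  refine ⟨2 * C₁ + C₂ * C₁, fun ε hε => ?_⟩
  obtain ⟨hgf, hincr⟩ := hC₁ ε hε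
  have hins := (isClosed_inset Ω (2 * ε)).measurableSet
  set g := (inset Ω (2 * ε)).indicator f
  have hgm : Measurable g := hf.indicator hins
  have hfi : Integrable f := memLp_one_iff_integrable.1 <|
    memLp_of_bounded_of_eq_zero_off hΩ.isOpen.measurableSet hΩ.isBounded hf (M := M)
      (fun x => enorm_le_coe.1 (hM x)) h0 1
  have hg : LocallyIntegrable g := (hfi.indicator hins).locallyIntegrable
  have hw := isTestFunction_mollify hΩ.isBounded hε hg
  refine ⟨mollify ε g, hw, ?_, ?_⟩
  · calc _ = eLpNorm ((fun x => mollify ε g x - g x) + fun x => g x - f x) 2 volume := by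
          congr with x
          exact (sub_add_sub_cancel _ _ _).symm
      _ ≤ C₁ * ENNReal.ofReal ε + C₁ * ENNReal.ofReal ε :=
          (eLpNorm_add_le (hw.1.continuous.measurable.sub hgm).aestronglyMeasurable
            (hgm.sub hf).aestronglyMeasurable one_le_two).trans
            (add_le_add (eLpNorm_mollify_sub_le hε hg hgm hincr) hgf)
      _ = 2 * C₁ * ENNReal.ofReal ε := by ring
      _ ≤ _ := by
          push_cast
          gcongr
          exact le_self_add
  · calc _ ≤ _ := eLpNorm_gradient_mollify_le hε hg hgm hincr
      _ ≤ C₂ * ENNReal.ofReal ε⁻¹ * (C₁ * ENNReal.ofReal ε) := by gcongr; exact hC₂ ε hε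
      _ = C₂ * C₁ * ENNReal.ofReal (ε⁻¹ * ε) := by
          rw [ENNReal.ofReal_mul (by positivity)]
          ring
      _ ≤ _ := by
          rw [inv_mul_cancel₀ hε.ne', ENNReal.ofReal_one, mul_one]
          push_cast
          exact le_add_self

end Approximation

/-! ### Functions with zero trace -/

section InnerLTwo

variable {α F : Type*} [MeasurableSpace α] {μ : Measure α} [NormedAddCommGroup F]
  [InnerProductSpace ℝ F]

theorem inner_toLp {f g : α → F} (hf : MemLp f 2 μ) (hg : MemLp g 2 μ) :
    inner ℝ (hf.toLp f) (hg.toLp g) = ∫ x, inner ℝ (f x) (g x) ∂μ := by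
  rw [L2.inner_def]
  apply integral_congr_ae
  filter_upwards [hf.coeFn_toLp, hg.coeFn_toLp] with x hfx hgx
  rw [hfx, hgx]

theorem abs_integral_inner_le {f g : α → F} (hf : MemLp f 2 μ) (hg : MemLp g 2 μ) :
    |∫ x, inner ℝ (f x) (g x) ∂μ| ≤ (eLpNorm f 2 μ).toReal * (eLpNorm g 2 μ).toReal := by
  rw [← inner_toLp hf hg, ← Lp.norm_toLp f hf, ← Lp.norm_toLp g hg]
  exact abs_real_inner_le_norm _ _

theorem eLpNorm_le_of_forall_abs_integral_inner_le {E : Type*} [NormedAddCommGroup E]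
    [NormedSpace ℝ E] [FiniteDimensional ℝ E] [MeasurableSpace E] [BorelSpace E] {ν : Measure E}
    [IsFiniteMeasureOnCompacts ν] {g : E → F} (hg : MemLp g 2 ν) {B : ℝ≥0}
    (h : ∀ φ : E → F, ContDiff ℝ ∞ φ → HasCompactSupport φ →
      |∫ x, inner ℝ (g x) (φ x) ∂ν| ≤ B * (eLpNorm φ 2 ν).toReal) : eLpNorm g 2 ν ≤ B := by
  have hbound : ∀ f : Lp F 2 ν, inner ℝ (hg.toLp g) f ≤ B * ‖f‖ := fun f => by
    have hclosed : IsClosed {f : Lp F 2 ν | inner ℝ (hg.toLp g) f ≤ B * ‖f‖} :=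
      isClosed_le (by fun_prop) (by fun_prop)
    refine hclosed.closure_subset_iff.2 ?_ (Lp.dense_hasCompactSupport_contDiff (by simp) f)
    rintro f ⟨φ, hfφ, hφc, hφ⟩
    have hφ2 : MemLp φ 2 ν := hφ.continuous.memLp_of_hasCompactSupport hφc
    obtain rfl : f = hφ2.toLp φ := Lp.ext (hfφ.trans hφ2.coeFn_toLp.symm)
    rw [Set.mem_ofPred_eq, inner_toLp, Lp.norm_toLp]
    exact (le_abs_self _).trans (h φ hφ hφc)
  have hself := hbound (hg.toLp g)
  rw [real_inner_self_eq_norm_mul_norm] at hself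
  have hnorm : ‖hg.toLp g‖ ≤ B := by
    by_contra! hlt
    exact hself.not_gt (mul_lt_mul_of_pos_right hlt (B.2.trans_lt hlt))
  rw [Lp.norm_toLp] at hnorm
  exact (ENNReal.toReal_le_toReal hg.eLpNorm_ne_top ENNReal.coe_ne_top).1 hnorm

end InnerLTwo

section ZeroTrace

variable {d : ℕ} {Ω : Set (Space d)}

/-- The extension by zero of `u` to `ℝ^d` has a weak gradient, the extension by zero of `G`. -/
def HasZeroTraceGradient (Ω : Set (Space d)) (u : Space d → ℝ) (G : Space d → Space d) : Prop :=
  MemL2 Ω u ∧ MemL2 Ω G ∧ ∀ φ : Space d → ℝ, ContDiff ℝ ∞ φ → HasCompactSupport φ →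
    ∀ e : Space d, ∫ x in Ω, inner ℝ (G x) (φ x • e) = -∫ x in Ω, u x * inner ℝ (gradient φ x) e

theorem gradient_comp_sub_const (φ : Space d → ℝ) (a x : Space d) :
    gradient (fun y => φ (y - a)) x = gradient φ (x - a) := by
  rw [gradient, gradient, fderiv_comp_sub]

theorem continuous_gradient {φ : Space d → ℝ} (hφ : ContDiff ℝ 1 φ) : Continuous (gradient φ) :=
  (InnerProductSpace.toDual ℝ (Space d)).symm.continuous.comp (hφ.continuous_fderiv one_ne_zero)

theorem hasDerivAt_integral_mul_comp_sub_smul {u φ : Space d → ℝ} (hu : Integrable u)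
    (hφ : ContDiff ℝ 1 φ) (hφc : HasCompactSupport φ) (h : Space d) (t : ℝ) :
    HasDerivAt (fun s => ∫ x, u x * φ (x - s • h))
      (∫ x, u x * inner ℝ (gradient φ (x - t • h)) (-h)) t := by
  obtain ⟨L, hL⟩ :=
    (hφ.continuous_fderiv one_ne_zero).bounded_above_of_compact_support (hφc.fderiv ℝ)
  obtain ⟨N, hN⟩ := hφ.continuous.bounded_above_of_compact_support hφc
  have hgrad := continuous_gradient hφ
  have hφcont := hφ.continuous
  refine (hasDerivAt_integral_of_dominated_loc_of_deriv_le (s := Set.univ) (x₀ := t)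
    (F := fun s x => u x * φ (x - s • h))
    (F' := fun s x => u x * inner ℝ (gradient φ (x - s • h)) (-h))
    (bound := fun x => ‖u x‖ * (L * ‖h‖)) univ_mem (.of_forall fun s => ?_) ?_ ?_
    (.of_forall fun x s _ => ?_) (hu.norm.mul_const _) (.of_forall fun x s _ => ?_)).2
  · exact hu.aestronglyMeasurable.mul (by fun_prop)
  · exact hu.mul_bdd (c := N) (by fun_prop) (.of_forall fun x => hN _)
  · exact hu.aestronglyMeasurable.mul
      (Continuous.aestronglyMeasurable (by fun_prop))
  · rw [norm_mul]
    gcongr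
    calc _ ≤ ‖gradient φ (x - s • h)‖ * ‖-h‖ := norm_inner_le_norm _ _
      _ ≤ _ := by
        rw [norm_gradient, norm_neg]
        gcongr
        exact hL _
  · have hline : HasDerivAt (fun s : ℝ => x - s • h) (-h) s := by
      simpa using ((hasDerivAt_id s).smul_const h).const_sub x
    rw [inner_gradient_left]
    exact ((hφ.differentiable one_ne_zero _).hasFDerivAt.comp_hasDerivAt s hline).const_mul _

theorem memLp_of_memL2_of_eq_zero_off {E : Type*} [NormedAddCommGroup E]
    (hΩ : MeasurableSet Ω) {f : Space d → E} (hf : MemL2 Ω f) (h0 : ∀ x, x ∉ Ω → f x = 0) :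
    MemLp f 2 := by
  rw [← Set.indicator_eq_self.2 (Function.support_subset_iff'.2 h0)]
  exact (memLp_indicator_iff_restrict hΩ).2 hf

theorem integrable_of_memL2_of_eq_zero_off {E : Type*} [NormedAddCommGroup E]
    (hΩ : Bornology.IsBounded Ω) {f : Space d → E} (hf : MemL2 Ω f) (h0 : ∀ x, x ∉ Ω → f x = 0) :
    Integrable f := by
  have : IsFiniteMeasure (volume.restrict Ω) := ⟨by simpa using hΩ.measure_lt_top⟩
  exact (integrableOn_iff_integrable_of_support_subset (Function.support_subset_iff'.2 h0)).1
    (MemLp.integrable one_le_two hf)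

theorem HasZeroTraceGradient.abs_integral_mul_inner_gradient_le {u : Space d → ℝ}
    {G : Space d → Space d} (hu : HasZeroTraceGradient Ω u G) (h0 : ∀ x, x ∉ Ω → u x = 0)
    {φ : Space d → ℝ} (hφ : ContDiff ℝ ∞ φ) (hφc : HasCompactSupport φ) (a e : Space d) :
    |∫ x, u x * inner ℝ (gradient φ (x - a)) e| ≤
      (normL2 Ω G).toReal * ‖e‖ * (eLpNorm φ 2 volume).toReal := by
  obtain ⟨-, hG, hibp⟩ := hu
  have hφa : ContDiff ℝ ∞ fun x => φ (x - a) := hφ.comp (by fun_prop)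
  have hφac : HasCompactSupport fun x => φ (x - a) :=
    hφc.comp_homeomorph (Homeomorph.subRight a)
  have hφae : MemLp (fun x => φ (x - a) • e) 2 volume :=
    (hφa.smul contDiff_const).continuous.memLp_of_hasCompactSupport
      (hφac.smul_right (f' := fun _ => e))
  have hibp' := hibp _ hφa hφac e
  simp only [gradient_comp_sub_const] at hibp'
  have hset : ∫ x in Ω, u x * inner ℝ (gradient φ (x - a)) e =
      ∫ x, u x * inner ℝ (gradient φ (x - a)) e :=
    setIntegral_eq_integral_of_forall_compl_eq_zero fun x hx => by rw [h0 x hx, zero_mul]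
  have hnorm : eLpNorm (fun x => φ (x - a) • e) 2 volume ≤ ‖e‖ₑ * eLpNorm φ 2 volume := by
    simp only [sub_eq_add_neg]
    rw [← eLpNorm_comp_add_right hφ.continuous.aestronglyMeasurable 2 (-a)]
    refine eLpNorm_le_mul_eLpNorm_of_ae_le_mul'' 2 (by fun_prop) (.of_forall fun x => ?_)
    rw [enorm_smul, mul_comm]
  have hφ2 : eLpNorm φ 2 volume ≠ ⊤ :=
    (hφ.continuous.memLp_of_hasCompactSupport hφc).eLpNorm_ne_top
  rw [← hset, ← abs_neg, ← hibp', mul_assoc, ← toReal_enorm e, ← ENNReal.toReal_mul]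
  refine (abs_integral_inner_le hG (hφae.restrict Ω)).trans ?_
  exact mul_le_mul_of_nonneg_left (ENNReal.toReal_mono (ENNReal.mul_ne_top enorm_ne_top hφ2)
    ((eLpNorm_mono_measure _ Measure.restrict_le_self).trans hnorm)) ENNReal.toReal_nonneg

theorem HasZeroTraceGradient.eLpNorm_increment_le {u : Space d → ℝ} {G : Space d → Space d}
    (hu : HasZeroTraceGradient Ω u G) (hΩm : MeasurableSet Ω) (hΩ : Bornology.IsBounded Ω)
    (h0 : ∀ x, x ∉ Ω → u x = 0) (h : Space d) :
    eLpNorm (fun x => u (x + h) - u x) 2 volume ≤ normL2 Ω G * ‖h‖ₑ := by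
  have hu2 : MemLp u 2 := memLp_of_memL2_of_eq_zero_off hΩm hu.1 h0
  have huh : MemLp (fun x => u (x + h)) 2 :=
    hu2.comp_measurePreserving (measurePreserving_add_right volume h)
  have hui : Integrable u := integrable_of_memL2_of_eq_zero_off hΩ hu.1 h0
  have hG : normL2 Ω G ≠ ⊤ := hu.2.1.eLpNorm_ne_top
  rw [← ENNReal.coe_toNNReal hG, enorm_eq_nnnorm, ← ENNReal.coe_mul]
  refine eLpNorm_le_of_forall_abs_integral_inner_le (huh.sub hu2) fun φ hφ hφc => ?_
  have hφ2 : MemLp φ 2 := hφ.continuous.memLp_of_hasCompactSupport hφc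
  have hshift : ∫ x, inner ℝ (u (x + h) - u x) (φ x) =
      (∫ x, u x * φ (x - (1 : ℝ) • h)) - ∫ x, u x * φ (x - (0 : ℝ) • h) := by
    rw [← integral_add_right_eq_self (fun x => u x * φ (x - (1 : ℝ) • h)) h]
    simp only [one_smul, zero_smul, sub_zero, add_sub_cancel_right]
    rw [← integral_sub (μ := volume) (f := fun x => u (x + h) * φ x) (g := fun x => u x * φ x)
      (huh.integrable_mul hφ2) (hu2.integrable_mul hφ2)]
    simp only [RCLike.inner_apply, conj_trivial, mul_comm (φ _), sub_mul]
  simp only [Pi.sub_apply]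
  rw [hshift, ← Real.norm_eq_abs]
  refine norm_image_sub_le_of_norm_deriv_le_segment_01'
    (fun t _ => (hasDerivAt_integral_mul_comp_sub_smul hui (hφ.of_le (by simp)) hφc h
      t).hasDerivWithinAt) fun t _ => ?_
  simpa [ENNReal.coe_toNNReal_eq_toReal] using
    hu.abs_integral_mul_inner_gradient_le h0 hφ hφc (t • h) (-h)

end ZeroTrace

/-! ### Weak limits -/

section Hilbert

variable {H : Type*} [NormedAddCommGroup H] [InnerProductSpace ℝ H] {ι : Type*} {l : Filter ι}
  {F : ι → H} {C : ℝ}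

theorem tendsto_inner_of_dense (hF : ∀ i, ‖F i‖ ≤ C) {S : Set H} (hS : Dense S) {G : H}
    (h : ∀ s ∈ S, Tendsto (fun i => inner ℝ (F i) s) l (𝓝 (inner ℝ G s))) (g : H) :
    Tendsto (fun i => inner ℝ (F i) g) l (𝓝 (inner ℝ G g)) := by
  rw [Metric.tendsto_nhds]
  intro ε hε
  obtain ⟨s, hs, hsg⟩ := hS.exists_dist_lt g (ε := ε / (2 * (|C| + ‖G‖ + 1))) (by positivity)
  rw [dist_eq_norm, lt_div_iff₀ (by positivity)] at hsg
  filter_upwards [(Metric.tendsto_nhds.1 (h s hs)) (ε / 2) (by positivity)] with i hi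
  have hsplit : inner ℝ (F i) g - inner ℝ G g =
      (inner ℝ (F i) s - inner ℝ G s) + inner ℝ (F i - G) (g - s) := by
    simp only [inner_sub_left, inner_sub_right]; ring
  have hrest : |inner ℝ (F i - G) (g - s)| ≤ (|C| + ‖G‖ + 1) * ‖g - s‖ := by
    refine (abs_real_inner_le_norm _ _).trans ?_
    gcongr
    linarith [norm_sub_le (F i) G, (hF i).trans (le_abs_self C)]
  rw [Real.dist_eq] at hi ⊢
  rw [hsplit]
  linarith [abs_add_le (inner ℝ (F i) s - inner ℝ G s) (inner ℝ (F i - G) (g - s))]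

theorem exists_weak_limit [CompleteSpace H] [l.NeBot] (hF : ∀ i, ‖F i‖ ≤ C) {S : Set H}
    (hS : Dense S) (h : ∀ s ∈ S, ∃ a, Tendsto (fun i => inner ℝ (F i) s) l (𝓝 a)) :
    ∃ G : H, ‖G‖ ≤ C ∧ ∀ g, Tendsto (fun i => inner ℝ (F i) g) l (𝓝 (inner ℝ G g)) := by
  -- Banach–Alaoglu gives a weak limit along an ultrafilter, and the dense set identifies it.
  obtain ⟨x, hx, hlim⟩ := isCompact_iff_ultrafilter_le_nhds.1
    (WeakDual.isCompact_closedBall (0 : StrongDual ℝ H) C)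
    ((Ultrafilter.of l).map fun i => StrongDual.toWeakDual (InnerProductSpace.toDual ℝ H (F i)))
    (le_principal_iff.2 (Filter.mem_map.2 (univ_mem' fun i => by simpa using hF i)))
  have hlimU : ∀ g, Tendsto (fun i => inner ℝ (F i) g) (Ultrafilter.of l)
      (𝓝 (inner ℝ ((InnerProductSpace.toDual ℝ H).symm (WeakDual.toStrongDual x)) g)) := by
    intro g
    rw [InnerProductSpace.toDual_symm_apply]
    exact ((WeakDual.eval_continuous g).tendsto x).comp hlim
  refine ⟨(InnerProductSpace.toDual ℝ H).symm (WeakDual.toStrongDual x), ?_,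
    tendsto_inner_of_dense hF hS fun s hs => ?_⟩
  · rw [LinearIsometryEquiv.norm_map]
    simpa using hx
  · obtain ⟨a, ha⟩ := h s hs
    rwa [tendsto_nhds_unique (hlimU s) (ha.mono_left (Ultrafilter.of_le l))]

theorem mem_topologicalClosure_of_weak_limit {H' : Type*} [NormedAddCommGroup H']
    [InnerProductSpace ℝ H'] [CompleteSpace H] [CompleteSpace H'] [l.NeBot]
    (V : Submodule ℝ (WithLp 2 (H' × H))) {w : ι → H'}
    (hV : ∀ i, WithLp.toLp 2 (w i, F i) ∈ V.topologicalClosure) {u : H'}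
    (hw : Tendsto w l (𝓝 u)) {G : H}
    (hF : ∀ g, Tendsto (fun i => inner ℝ (F i) g) l (𝓝 (inner ℝ G g))) :
    WithLp.toLp 2 (u, G) ∈ V.topologicalClosure := by
  rw [← Submodule.orthogonal_orthogonal_eq_closure] at hV ⊢
  rw [Submodule.mem_orthogonal']
  intro z hz
  have horth : ∀ i, inner ℝ (w i) z.fst + inner ℝ (F i) z.snd = 0 := fun i => by
    have hinner := (Submodule.mem_orthogonal' _ _).1 (hV i) z hz
    rwa [WithLp.prod_inner_apply] at hinner
  have hsum := (hw.inner (tendsto_const_nhds (x := z.fst))).add (hF z.snd)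
  simp only [horth] at hsum
  rw [WithLp.prod_inner_apply]
  exact tendsto_nhds_unique hsum tendsto_const_nhds

end Hilbert

section WeakLimit

variable {d : ℕ} {Ω : Set (Space d)} {ι : Type*} {l : Filter ι}

namespace MemL2

variable {F : Type*} [NormedAddCommGroup F] {f g : Space d → F}

/-- The class in `L²(Ω)` of a square integrable function. -/
def toL2 (hf : MemL2 Ω f) : Lp F 2 (volume.restrict Ω) :=
  MemLp.toLp f hf

theorem coeFn_toL2 (hf : MemL2 Ω f) : hf.toL2 =ᵐ[volume.restrict Ω] f :=
  MemLp.coeFn_toLp hf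

theorem eq_toL2 (hf : MemL2 Ω f) {k : Lp F 2 (volume.restrict Ω)}
    (h : k =ᵐ[volume.restrict Ω] f) : k = hf.toL2 :=
  Lp.ext (h.trans hf.coeFn_toL2.symm)

theorem norm_toL2_le (hf : MemL2 Ω f) {C : ℝ≥0} (h : normL2 Ω f ≤ C) : ‖hf.toL2‖ ≤ C :=
  (Lp.norm_toLp f hf).trans_le (ENNReal.toReal_le_coe_of_le_coe h)

theorem tendsto_toL2_iff {w : ι → Space d → F} (hw : ∀ i, MemL2 Ω (w i)) (hf : MemL2 Ω f) :
    Tendsto (fun i => (hw i).toL2) l (𝓝 hf.toL2) ↔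
      Tendsto (fun i => normL2 Ω fun x => w i x - f x) l (𝓝 0) :=
  Lp.tendsto_Lp_iff_tendsto_eLpNorm'' w hw f hf

variable [InnerProductSpace ℝ F]

theorem inner_toL2 (hf : MemL2 Ω f) (hg : MemL2 Ω g) :
    inner ℝ hf.toL2 hg.toL2 = ∫ x in Ω, inner ℝ (f x) (g x) :=
  inner_toLp hf hg

theorem integrable_inner (hf : MemL2 Ω f) (hg : MemL2 Ω g) :
    Integrable (fun x => inner ℝ (f x) (g x)) (volume.restrict Ω) := by
  refine (L2.integrable_inner (𝕜 := ℝ) hf.toL2 hg.toL2).congr ?_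
  filter_upwards [hf.coeFn_toL2, hg.coeFn_toL2] with x hfx hgx
  rw [hfx, hgx]

end MemL2

theorem memL2_of_hasCompactSupport {F : Type*} [NormedAddCommGroup F] {f : Space d → F}
    (hf : Continuous f) (hfc : HasCompactSupport f) : MemL2 Ω f :=
  (hf.memLp_of_hasCompactSupport hfc).restrict Ω

theorem hasCompactSupport_gradient {φ : Space d → ℝ} (hφ : HasCompactSupport φ) :
    HasCompactSupport (gradient φ) :=
  (hφ.fderiv ℝ).comp_left (map_zero (InnerProductSpace.toDual ℝ (Space d)).symm)

theorem memL2_gradient {φ : Space d → ℝ} (hφ : ContDiff ℝ 1 φ) (hφc : HasCompactSupport φ) :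
    MemL2 Ω (gradient φ) :=
  memL2_of_hasCompactSupport (continuous_gradient hφ) (hasCompactSupport_gradient hφc)

theorem memL2_smul_const {φ : Space d → ℝ} (hφ : Continuous φ) (hφc : HasCompactSupport φ)
    (e : Space d) : MemL2 Ω fun x => φ x • e :=
  memL2_of_hasCompactSupport (hφ.smul continuous_const) (hφc.smul_right (f' := fun _ => e))

theorem integral_inner_eq_sum {G ψ : Space d → Space d} (hG : MemL2 Ω G) (hψ : Continuous ψ)
    (hψc : HasCompactSupport ψ) : ∫ x in Ω, inner ℝ (G x) (ψ x) =
      ∑ j, ∫ x in Ω, inner ℝ (G x) (ψ x j • EuclideanSpace.single j (1 : ℝ)) := by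
  rw [← integral_finsetSum _ fun j _ => ?_]
  · refine integral_congr_ae (.of_forall fun x => ?_)
    have hbasis := (EuclideanSpace.basisFun (Fin d) ℝ).sum_repr (ψ x)
    simp only [EuclideanSpace.basisFun_repr, EuclideanSpace.basisFun_apply] at hbasis
    simp only [← inner_sum, hbasis]
  · exact hG.integrable_inner (memL2_smul_const (φ := fun x => ψ x j) (by fun_prop)
      (hψc.comp_left (g := fun y : Space d => y j) rfl) _)

theorem tendsto_integral_inner_of_forall_smul {F : ι → Space d → Space d}
    (hF : ∀ i, MemL2 Ω (F i)) {a : (Space d → ℝ) → Space d → ℝ}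
    (h : ∀ φ : Space d → ℝ, ContDiff ℝ ∞ φ → HasCompactSupport φ → ∀ e : Space d,
      Tendsto (fun i => ∫ x in Ω, inner ℝ (F i x) (φ x • e)) l (𝓝 (a φ e)))
    {ψ : Space d → Space d} (hψ : ContDiff ℝ ∞ ψ) (hψc : HasCompactSupport ψ) :
    Tendsto (fun i => ∫ x in Ω, inner ℝ (F i x) (ψ x)) l
      (𝓝 (∑ j, a (fun x => ψ x j) (EuclideanSpace.single j 1))) := by
  simp only [integral_inner_eq_sum (hF _) hψ.continuous hψc]
  exact tendsto_finsetSum _ fun j _ => h _ (by fun_prop)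
    (hψc.comp_left (g := fun y : Space d => y j) rfl) _

theorem tendsto_integral_mul {w : ι → Space d → ℝ} {u k : Space d → ℝ}
    (hw : ∀ i, MemL2 Ω (w i)) (hu : MemL2 Ω u)
    (hlim : Tendsto (fun i => normL2 Ω fun x => w i x - u x) l (𝓝 0)) (hk : MemL2 Ω k) :
    Tendsto (fun i => ∫ x in Ω, w i x * k x) l (𝓝 (∫ x in Ω, u x * k x)) := by
  have hinner : ∀ {f : Space d → ℝ} (hf : MemL2 Ω f),
      ∫ x in Ω, f x * k x = inner ℝ hk.toL2 hf.toL2 := fun hf => by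
    simp [MemL2.inner_toL2]
  simp only [hinner (hw _), hinner hu]
  exact tendsto_const_nhds.inner ((MemL2.tendsto_toL2_iff hw hu).2 hlim)

theorem HasZeroTraceGradient.hasWeakGradient {u : Space d → ℝ} {G : Space d → Space d}
    (h : HasZeroTraceGradient Ω u G) : HasWeakGradient Ω u G := by
  refine ⟨h.1, h.2.1, fun φ hφ => ext_inner_right ℝ fun e => ?_⟩
  have hugrad : Integrable (fun x => u x • gradient φ x) (volume.restrict Ω) :=
    memLp_one_iff_integrable.1
      (MemLp.smul (memL2_gradient (hφ.1.of_le (by simp)) hφ.2.1) h.1)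
  have hφG : Integrable (fun x => φ x • G x) (volume.restrict Ω) :=
    memLp_one_iff_integrable.1
      (MemLp.smul h.2.1 (memL2_of_hasCompactSupport hφ.1.continuous hφ.2.1))
  have hibp := h.2.2 φ hφ.1 hφ.2.1 e
  simp only [inner_smul_right] at hibp
  rw [inner_neg_left, real_inner_comm, ← integral_inner hugrad, real_inner_comm,
    ← integral_inner hφG]
  simp only [real_inner_comm _ e, real_inner_smul_left]
  linarith

theorem exists_hasZeroTraceGradient [l.NeBot] {w : ι → Space d → ℝ}
    {F : ι → Space d → Space d} {u : Space d → ℝ} (hw : ∀ i, MemL2 Ω (w i))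
    (hF : ∀ i, MemL2 Ω (F i)) (hu : MemL2 Ω u) {C : ℝ≥0} (hFC : ∀ i, normL2 Ω (F i) ≤ C)
    (hlim : Tendsto (fun i => normL2 Ω fun x => w i x - u x) l (𝓝 0))
    (hdual : ∀ φ : Space d → ℝ, ContDiff ℝ ∞ φ → HasCompactSupport φ → ∀ e : Space d,
      Tendsto (fun i => (∫ x in Ω, inner ℝ (F i x) (φ x • e)) +
        ∫ x in Ω, w i x * inner ℝ (gradient φ x) e) l (𝓝 0)) :
    ∃ G, HasZeroTraceGradient Ω u G ∧ normL2 Ω G ≤ C ∧ WeaklyTendstoL2 Ω F l G := by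
  have hφ : ∀ φ : Space d → ℝ, ContDiff ℝ ∞ φ → HasCompactSupport φ → ∀ e : Space d,
      Tendsto (fun i => ∫ x in Ω, inner ℝ (F i x) (φ x • e)) l
        (𝓝 (-∫ x in Ω, u x * inner ℝ (gradient φ x) e)) := fun φ hφ hφc e => by
    simpa using (hdual φ hφ hφc e).sub (tendsto_integral_mul hw hu hlim
      (MemLp.inner_const (memL2_gradient (hφ.of_le (by simp)) hφc) e))
  obtain ⟨G, hGC, hG⟩ := exists_weak_limit (l := l) (fun i => (hF i).norm_toL2_le (hFC i))
    (Lp.dense_hasCompactSupport_contDiff (by simp)) (by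
      rintro f ⟨ψ, hfψ, hψc, hψ⟩
      have hψ2 : MemL2 Ω ψ := memL2_of_hasCompactSupport hψ.continuous hψc
      obtain rfl : f = hψ2.toL2 := hψ2.eq_toL2 hfψ
      simp only [MemL2.inner_toL2]
      exact ⟨_, tendsto_integral_inner_of_forall_smul hF hφ hψ hψc⟩)
  have hG2 : MemL2 Ω G := Lp.memLp G
  have hweak : WeaklyTendstoL2 Ω F l G := ⟨hF, hG2, fun g hg => by
    have hlimg := hG hg.toL2
    rw [hG2.eq_toL2 (k := G) .rfl] at hlimg
    simpa only [MemL2.inner_toL2] using hlimg⟩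
  refine ⟨G, ⟨hu, hG2, fun φ hφ' hφc e => ?_⟩, ?_, hweak⟩
  · exact tendsto_nhds_unique (hweak.2.2 _ (memL2_smul_const hφ'.continuous hφc e))
      (hφ φ hφ' hφc e)
  · rw [normL2, ← Lp.enorm_def, enorm_le_coe]
    exact hGC

theorem gradient_add {φ ψ : Space d → ℝ} (hφ : Differentiable ℝ φ) (hψ : Differentiable ℝ ψ)
    (x : Space d) : gradient (φ + ψ) x = gradient φ x + gradient ψ x := by
  rw [gradient, fderiv_add (hφ x) (hψ x), map_add, gradient, gradient]

theorem gradient_const_smul {φ : Space d → ℝ} (hφ : Differentiable ℝ φ) (c : ℝ) (x : Space d) :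
    gradient (c • φ) x = c • gradient φ x := by
  rw [gradient, fderiv_const_smul (hφ x), map_smulₛₗ, gradient]
  rfl

namespace IsTestFunction

variable {φ ψ : Space d → ℝ}

theorem differentiable (hφ : IsTestFunction Ω φ) : Differentiable ℝ φ :=
  hφ.1.differentiable (by simp)

theorem add (hφ : IsTestFunction Ω φ) (hψ : IsTestFunction Ω ψ) : IsTestFunction Ω (φ + ψ) :=
  ⟨hφ.1.add hψ.1, hφ.2.1.add hψ.2.1, (tsupport_add φ ψ).trans (Set.union_subset hφ.2.2 hψ.2.2)⟩

theorem const_smul (hφ : IsTestFunction Ω φ) (c : ℝ) : IsTestFunction Ω (c • φ) :=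
  ⟨hφ.1.const_smul c, hφ.2.1.smul_left (f := fun _ => c),
    (closure_mono (Function.support_const_smul_subset c φ)).trans hφ.2.2⟩

theorem memL2 (hφ : IsTestFunction Ω φ) : MemL2 Ω φ :=
  memL2_of_hasCompactSupport hφ.1.continuous hφ.2.1

theorem memL2_gradient (hφ : IsTestFunction Ω φ) : MemL2 Ω (gradient φ) :=
  HybridFV.memL2_gradient (hφ.1.of_le (by simp)) hφ.2.1

theorem eq_zero (hφ : IsTestFunction Ω φ) {x : Space d} (hx : x ∉ Ω) : φ x = 0 :=
  image_eq_zero_of_notMem_tsupport fun h => hx (hφ.2.2 h)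

theorem gradient_eq_zero (hφ : IsTestFunction Ω φ) {x : Space d} (hx : x ∉ Ω) :
    gradient φ x = 0 := by
  rw [gradient, fderiv_of_notMem_tsupport ℝ fun h => hx (hφ.2.2 h), map_zero]

theorem hasZeroTraceGradient (hφ : IsTestFunction Ω φ) :
    HasZeroTraceGradient Ω φ (gradient φ) := by
  refine ⟨hφ.memL2, hφ.memL2_gradient, fun ψ hψ hψc e => ?_⟩
  have hφ' : Continuous fun x => fderiv ℝ φ x e :=
    (hφ.1.continuous_fderiv (by simp)).clm_apply continuous_const
  have hψ' : Continuous fun x => fderiv ℝ ψ x e :=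
    (hψ.continuous_fderiv (by simp)).clm_apply continuous_const
  rw [setIntegral_eq_integral_of_forall_compl_eq_zero fun x hx => by
      rw [hφ.gradient_eq_zero hx, inner_zero_left],
    setIntegral_eq_integral_of_forall_compl_eq_zero (f := fun x => φ x * inner ℝ (gradient ψ x) e)
      fun x hx => by rw [hφ.eq_zero hx, zero_mul]]
  simp only [inner_smul_right, inner_gradient_left]
  rw [integral_mul_fderiv_eq_neg_fderiv_mul_of_integrable
    ((hψ'.mul hφ.1.continuous).integrable_of_hasCompactSupport hφ.2.1.mul_left)
    ((hψ.continuous.mul hφ').integrable_of_hasCompactSupport hψc.mul_right)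
    ((hψ.continuous.mul hφ.1.continuous).integrable_of_hasCompactSupport hψc.mul_right)
    (fun x _ => hψ.differentiable (by simp) x) fun x _ => hφ.differentiable x]
  simp only [mul_comm]

end IsTestFunction

/-- The pairs `(φ, ∇φ)` for `φ ∈ C_c^∞(Ω)`, as a subspace of `L²(Ω) × L²(Ω)^d`. -/
def testPairs (Ω : Set (Space d)) :
    Submodule ℝ (WithLp 2 (Lp ℝ 2 (volume.restrict Ω) × Lp (Space d) 2 (volume.restrict Ω))) where
  carrier := {p | ∃ φ, IsTestFunction Ω φ ∧ p.fst =ᵐ[volume.restrict Ω] φ ∧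
    p.snd =ᵐ[volume.restrict Ω] gradient φ}
  add_mem' := by
    rintro p q ⟨φ, hφ, hpφ, hpgrad⟩ ⟨ψ, hψ, hqψ, hqgrad⟩
    refine ⟨_, hφ.add hψ, (Lp.coeFn_add _ _).trans (hpφ.add hqψ), ?_⟩
    exact (Lp.coeFn_add _ _).trans ((hpgrad.add hqgrad).trans
      (.of_forall fun x => (gradient_add hφ.differentiable hψ.differentiable x).symm))
  zero_mem' := by
    refine ⟨0, ⟨contDiff_const, HasCompactSupport.zero, by simp [tsupport]⟩,
      Lp.coeFn_zero _ _ _, (Lp.coeFn_zero _ _ _).trans (.of_forall fun x => ?_)⟩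
    simp [gradient]
  smul_mem' := by
    rintro c p ⟨φ, hφ, hpφ, hpgrad⟩
    refine ⟨_, hφ.const_smul c, (Lp.coeFn_smul _ _).trans (hpφ.const_smul c), ?_⟩
    exact (Lp.coeFn_smul _ _).trans ((hpgrad.const_smul c).trans
      (.of_forall fun x => (gradient_const_smul hφ.differentiable c x).symm))

/-- The pair `(u, G)` is a limit in `L²` of pairs `(φ, ∇φ)` with `φ ∈ C_c^∞(Ω)`; this is
membership in `H¹_0(Ω)`, with the gradient recorded. -/
def IsTestLimit (Ω : Set (Space d)) (u : Space d → ℝ) (G : Space d → Space d) : Prop :=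
  ∃ (hu : MemL2 Ω u) (hG : MemL2 Ω G),
    WithLp.toLp 2 (hu.toL2, hG.toL2) ∈ (testPairs Ω).topologicalClosure

theorem IsTestFunction.isTestLimit {φ : Space d → ℝ} (hφ : IsTestFunction Ω φ) :
    IsTestLimit Ω φ (gradient φ) :=
  ⟨hφ.memL2, hφ.memL2_gradient, (testPairs Ω).le_topologicalClosure
    ⟨φ, hφ, hφ.memL2.coeFn_toL2, hφ.memL2_gradient.coeFn_toL2⟩⟩

theorem IsTestLimit.memH10 {u : Space d → ℝ} {G : Space d → Space d} (h : IsTestLimit Ω u G)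
    (hw : HasWeakGradient Ω u G) : MemH10 Ω u := by
  obtain ⟨hu, hG, hcl⟩ := h
  obtain ⟨p, hp, hlim⟩ := mem_closure_iff_seq_limit.1 hcl
  choose φ hφ hfst hsnd using hp
  refine ⟨G, hw, φ, hφ, ?_, ?_⟩
  · refine (MemL2.tendsto_toL2_iff (fun n => (hφ n).memL2) hu).1 ?_
    exact (((WithLp.continuous_fst _ _ _).tendsto _).comp hlim).congr
      fun n => (hφ n).memL2.eq_toL2 (hfst n)
  · refine (MemL2.tendsto_toL2_iff (fun n => (hφ n).memL2_gradient) hG).1 ?_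
    exact (((WithLp.continuous_snd _ _ _).tendsto _).comp hlim).congr
      fun n => (hφ n).memL2_gradient.eq_toL2 (hsnd n)

theorem isTestLimit_of_tendsto [l.NeBot] {w : ι → Space d → ℝ} {F : ι → Space d → Space d}
    (hw : ∀ n, HasZeroTraceGradient Ω (w n) (F n)) (hT : ∀ n, IsTestLimit Ω (w n) (F n))
    {u : Space d → ℝ} {G : Space d → Space d} (hu : HasZeroTraceGradient Ω u G)
    (hlim : Tendsto (fun n => normL2 Ω fun x => w n x - u x) l (𝓝 0)) {C : ℝ≥0}
    (hFC : ∀ n, normL2 Ω (F n) ≤ C) : IsTestLimit Ω u G := by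
  refine ⟨hu.1, hu.2.1, mem_topologicalClosure_of_weak_limit _ (fun n => (hT n).2.2)
    ((MemL2.tendsto_toL2_iff (fun n => (hw n).1) hu.1).2 hlim)
    (tendsto_inner_of_dense (fun n => (hw n).2.1.norm_toL2_le (hFC n))
      (Lp.dense_hasCompactSupport_contDiff (by simp)) ?_)⟩
  rintro f ⟨ψ, hfψ, hψc, hψ⟩
  have hψ2 : MemL2 Ω ψ := memL2_of_hasCompactSupport hψ.continuous hψc
  obtain rfl : f = hψ2.toL2 := hψ2.eq_toL2 hfψ
  simp only [MemL2.inner_toL2]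
  rw [integral_inner_eq_sum hu.2.1 hψ.continuous hψc]
  refine tendsto_integral_inner_of_forall_smul (fun n => (hw n).2.1)
    (a := fun φ e => ∫ x in Ω, inner ℝ (G x) (φ x • e)) (fun φ hφ hφc e => ?_) hψ hψc
  simp only [(hw _).2.2 φ hφ hφc e, hu.2.2 φ hφ hφc e]
  exact (tendsto_integral_mul (fun n => (hw n).1) hu.1 hlim
    (MemLp.inner_const (memL2_gradient (hφ.of_le (by simp)) hφc) e)).neg

theorem HasZeroTraceGradient.isTestLimit_of_bounded (hΩ : IsPolyhedral Ω)
    {u : Space d → ℝ} {G : Space d → Space d} (h : HasZeroTraceGradient Ω u G)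
    (hum : Measurable u) {M : ℝ≥0} (hM : ∀ x, ‖u x‖ₑ ≤ M) (h0 : ∀ x, x ∉ Ω → u x = 0) :
    IsTestLimit Ω u G := by
  have hG : normL2 Ω G ≠ ⊤ := h.2.1.eLpNorm_ne_top
  obtain ⟨C, happrox⟩ := exists_testFunction_near hΩ hum hM h0 (A := (normL2 Ω G).toNNReal)
    fun z => by
      rw [ENNReal.coe_toNNReal hG]
      exact h.eLpNorm_increment_le hΩ.isOpen.measurableSet hΩ.isBounded h0 z
  choose! w hw hwu hgrad using happrox
  have hpos : ∀ n : ℕ, 0 < 1 / ((n : ℝ) + 1) := fun n => by positivity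
  refine isTestLimit_of_tendsto (l := atTop) (w := fun n : ℕ => w (1 / ((n : ℝ) + 1)))
    (fun n => (hw _ (hpos n)).hasZeroTraceGradient) (fun n => (hw _ (hpos n)).isTestLimit) h
    (tendsto_of_tendsto_of_tendsto_of_le_of_le tendsto_const_nhds ?_ (fun n => zero_le)
      fun n => (eLpNorm_mono_measure _ Measure.restrict_le_self).trans (hwu _ (hpos n)))
    fun n => (eLpNorm_mono_measure _ Measure.restrict_le_self).trans (hgrad _ (hpos n))
  simpa using ENNReal.Tendsto.const_mul
    (ENNReal.tendsto_ofReal (tendsto_one_div_add_atTop_nhds_zero_nat (𝕜 := ℝ)))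
    (.inr ENNReal.coe_ne_top)

end WeakLimit

/-! ### Convergence along a family of discretisations -/

section Convergence

variable {d : ℕ} {Ω : Set (Space d)} {ι : Type*}

theorem normL2_eq_ofReal_sqrt {F : Type*} [NormedAddCommGroup F] {f : Space d → F}
    (hf : MemL2 Ω f) : normL2 Ω f = ENNReal.ofReal √(∫ x in Ω, ‖f x‖ ^ 2) := by
  rw [normL2, MemLp.eLpNorm_eq_integral_rpow_norm two_ne_zero ENNReal.ofNat_ne_top hf]
  simp [Real.sqrt_eq_rpow]

theorem tendsto_normL2_comp_sub {f : ℝ → ℝ} (hf : LipschitzWith 1 f) {l : Filter ι}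
    {w : ι → Space d → ℝ} {u : Space d → ℝ}
    (hlim : Tendsto (fun i => normL2 Ω fun x => w i x - u x) l (𝓝 0)) :
    Tendsto (fun i => normL2 Ω fun x => f (w i x) - f (u x)) l (𝓝 0) :=
  tendsto_of_tendsto_of_tendsto_of_le_of_le tendsto_const_nhds hlim (fun _ => zero_le)
    fun i => eLpNorm_mono fun x => by simpa using hf.norm_sub_le (w i x) (u x)

theorem tendsto_integral_abs (hΩ : Bornology.IsBounded Ω) {l : Filter ι} {w : ι → Space d → ℝ}
    {u : Space d → ℝ} (hw : ∀ i, MemL2 Ω (w i)) (hu : MemL2 Ω u)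
    (hlim : Tendsto (fun i => normL2 Ω fun x => w i x - u x) l (𝓝 0)) :
    Tendsto (fun i => ∫ x in Ω, |w i x|) l (𝓝 (∫ x in Ω, |u x|)) := by
  have : IsFiniteMeasure (volume.restrict Ω) := ⟨by simpa using hΩ.measure_lt_top⟩
  simpa using tendsto_integral_mul (k := fun _ => 1) (fun i => MemLp.norm (hw i)) (MemLp.norm hu)
    (tendsto_normL2_comp_sub lipschitzWith_one_norm hlim) (memLp_const 1)

theorem exists_lipschitzWith_gradient {φ : Space d → ℝ} (hφ : ContDiff ℝ ∞ φ)
    (hφc : HasCompactSupport φ) : ∃ L, LipschitzWith L (gradient φ) := by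
  obtain ⟨L, hL⟩ := (hφ.fderiv_right (m := ∞) (by simp)).lipschitzWith_of_hasCompactSupport
    (hφc.fderiv ℝ) (by simp)
  exact ⟨_, (InnerProductSpace.toDual ℝ (Space d)).symm.lipschitz.comp hL⟩

theorem neBot_sizeToZero {D : ι → Discretisation Ω}
    (hsize : ∀ δ : ℝ, 0 < δ → ∃ i, (D i).size < δ) : (sizeToZero D).NeBot := by
  refine comap_neBot fun t ht => ?_
  obtain ⟨δ, hδ, hball⟩ := Metric.mem_nhds_iff.1 ht
  obtain ⟨i, hi⟩ := hsize δ hδ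
  refine ⟨i, hball ?_⟩
  rwa [Metric.mem_ball, Real.dist_0_eq_abs, abs_of_nonneg (D i).size_nonneg]

theorem tendsto_duality (hd : 0 < d) (hΩ : Bornology.IsBounded Ω) {D : ι → Discretisation Ω}
    {θ : ℝ} (hθ : ∀ i, (D i).IsShapeRegular θ) {v : ∀ i, (D i).X} (hv : ∀ i, v i ∈ (D i).X0)
    {C : ℝ} (hC : ∀ i, (D i).seminormX (v i) ≤ C) {u : Space d → ℝ} (hu : MemL2 Ω u)
    (hlim : Tendsto (fun i => normL2 Ω fun x => (D i).reconstruction (v i) x - u x)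
      (sizeToZero D) (𝓝 0)) {φ : Space d → ℝ} (hφ : ContDiff ℝ ∞ φ) (hφc : HasCompactSupport φ)
    (e : Space d) :
    Tendsto (fun i => (∫ x in Ω, inner ℝ ((D i).discreteGradient (v i) x) (φ x • e)) +
      ∫ x in Ω, (D i).reconstruction (v i) x * inner ℝ (gradient φ x) e) (sizeToZero D) (𝓝 0) := by
  obtain ⟨L, hL⟩ := hφ.lipschitzWith_of_hasCompactSupport hφc (by simp)
  obtain ⟨L', hL'⟩ := exists_lipschitzWith_gradient hφ hφc
  have hsize : Tendsto (fun i => (D i).size) (sizeToZero D) (𝓝 0) := tendsto_comap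
  have hbound : Tendsto (fun i => (D i).size *
      (‖e‖ * L * (volume.real Ω + ((2 + 4 * d * θ ^ 2) * d + 4) * C ^ 2) +
        ‖e‖ * L * (d * volume.real Ω + C ^ 2) +
        ‖e‖ * L' * (θ * d + 1) * ∫ x in Ω, |(D i).reconstruction (v i) x|))
      (sizeToZero D) (𝓝 0) := by
    simpa only [zero_mul] using hsize.mul (tendsto_const_nhds.add
      ((tendsto_integral_abs hΩ (fun i => (D i).memL2_reconstruction hΩ (v i)) hu
        hlim).const_mul _))
  refine squeeze_zero_norm (fun i => ?_) hbound
  refine ((D i).abs_integral_inner_discreteGradient_add_le hd hΩ (hθ i) (hv i) hL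
    (hφ.differentiable (by simp)) hL' e).trans ?_
  have hs : (D i).seminormX (v i) ^ 2 ≤ C ^ 2 :=
    pow_le_pow_left₀ (Real.sqrt_nonneg _) (hC i) 2
  gcongr
  exact (D i).size_nonneg

theorem Discretisation.normL2_discreteGradient_le (D : Discretisation Ω) (hd : 0 < d)
    (hΩ : Bornology.IsBounded Ω) {θ : ℝ} (hθ : D.IsShapeRegular θ) {v : D.X} {C : ℝ}
    (hC : D.seminormX v ≤ C) : normL2 Ω (D.discreteGradient v) ≤
      Real.toNNReal √(((2 + 4 * d * θ ^ 2) * d + 4) * C ^ 2) := by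
  rw [normL2_eq_ofReal_sqrt (D.memL2_discreteGradient hΩ v)]
  refine ENNReal.ofReal_le_ofReal (Real.sqrt_le_sqrt ?_)
  refine (D.integral_norm_discreteGradient_sq_le hd hΩ hθ v).trans ?_
  gcongr
  exact Real.sqrt_nonneg _

theorem exists_weakLimit_discreteGradient (hd : 0 < d) (hΩ : Bornology.IsBounded Ω)
    {D : ι → Discretisation Ω} [(sizeToZero D).NeBot] {θ : ℝ}
    (hθ : ∀ i, (D i).IsShapeRegular θ) {v : ∀ i, (D i).X} (hv : ∀ i, v i ∈ (D i).X0) {C : ℝ}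
    (hC : ∀ i, (D i).seminormX (v i) ≤ C) {u : Space d → ℝ} (hu : MemL2 Ω u)
    (hlim : Tendsto (fun i => normL2 Ω fun x => (D i).reconstruction (v i) x - u x)
      (sizeToZero D) (𝓝 0)) :
    ∃ G, HasZeroTraceGradient Ω u G ∧
      normL2 Ω G ≤ Real.toNNReal √(((2 + 4 * d * θ ^ 2) * d + 4) * C ^ 2) ∧
      WeaklyTendstoL2 Ω (fun i => (D i).discreteGradient (v i)) (sizeToZero D) G :=
  exists_hasZeroTraceGradient (fun i => (D i).memL2_reconstruction hΩ (v i))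
    (fun i => (D i).memL2_discreteGradient hΩ (v i)) hu
    (fun i => (D i).normL2_discreteGradient_le hd hΩ (hθ i) (hC i)) hlim
    fun _ hφ hφc => tendsto_duality hd hΩ hθ hv hC hu hlim hφ hφc

/-- The truncation of `t` at the levels `± M`; it makes the limit function bounded, so that
it can be regularised. -/
def clamp (M t : ℝ) : ℝ := max (-M) (min M t)

theorem lipschitzWith_clamp (M : ℝ) : LipschitzWith 1 (clamp M) :=
  (LipschitzWith.id.const_min M).const_max (-M)

theorem clamp_zero {M : ℝ} (hM : 0 ≤ M) : clamp M 0 = 0 := by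
  simp [clamp, hM]

theorem abs_clamp_le {M : ℝ} (hM : 0 ≤ M) (t : ℝ) : |clamp M t| ≤ M :=
  abs_le.2 ⟨le_max_left _ _, max_le (by linarith) (min_le_left _ _)⟩

theorem clamp_of_abs_le {M t : ℝ} (h : |t| ≤ M) : clamp M t = t := by
  rw [clamp, min_eq_right (abs_le.1 h).2, max_eq_right (abs_le.1 h).1]

theorem abs_clamp_sub_self_le {M : ℝ} (hM : 0 ≤ M) (t : ℝ) : |clamp M t - t| ≤ |t| := by
  grind [clamp]

theorem MemL2.clamp_comp {u : Space d → ℝ} (hu : MemL2 Ω u) {M : ℝ} (hM : 0 ≤ M) :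
    MemL2 Ω fun x => clamp M (u x) :=
  (lipschitzWith_clamp M).comp_memLp (clamp_zero hM) hu

theorem tendsto_normL2_clamp_sub {u : Space d → ℝ} (hu : MemL2 Ω u) :
    Tendsto (fun n : ℕ => normL2 Ω fun x => clamp n (u x) - u x) atTop (𝓝 0) := by
  have hsub : ∀ n : ℕ, MemL2 Ω fun x => clamp n (u x) - u x := fun n =>
    MemLp.sub (hu.clamp_comp n.cast_nonneg) hu
  have hint : Tendsto (fun n : ℕ => ∫ x in Ω, ‖clamp n (u x) - u x‖ ^ 2) atTop
      (𝓝 (∫ _ in Ω, 0)) := by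
    refine tendsto_integral_of_dominated_convergence (fun x => ‖u x‖ ^ 2)
      (fun n => (hsub n).1.norm.pow 2) (MemLp.integrable_norm_pow hu two_ne_zero)
      (fun n => .of_forall fun x => ?_) (.of_forall fun x => ?_)
    · rw [norm_pow, norm_norm]
      exact pow_le_pow_left₀ (norm_nonneg _) (abs_clamp_sub_self_le n.cast_nonneg _) 2
    · refine tendsto_const_nhds.congr' ?_
      filter_upwards [eventually_ge_atTop ⌈|u x|⌉₊] with n hn
      simp [clamp_of_abs_le (Nat.ceil_le.1 hn)]
  simp only [normL2_eq_ofReal_sqrt (hsub _)]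
  simpa using ENNReal.tendsto_ofReal hint.sqrt

namespace Discretisation

variable (D : Discretisation Ω)

/-- The discrete function obtained by truncating every value of `v` at the levels `± M`. -/
def truncate (M : ℝ) (v : D.X) : D.X := (fun K => clamp M (v.1 K), fun σ => clamp M (v.2 σ))

theorem truncate_mem_X0 {M : ℝ} (hM : 0 ≤ M) {v : D.X} (hv : v ∈ D.X0) :
    D.truncate M v ∈ D.X0 :=
  fun σ hσ => by simp only [truncate, hv σ hσ, clamp_zero hM]

theorem seminormX_truncate_le (M : ℝ) (v : D.X) :
    D.seminormX (D.truncate M v) ≤ D.seminormX v := by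
  refine Real.sqrt_le_sqrt (Finset.sum_le_sum fun K _ => Finset.sum_le_sum fun σ _ => ?_)
  refine mul_le_mul_of_nonneg_left (sq_le_sq.2 ?_)
    (div_nonneg measureReal_nonneg Metric.infDist_nonneg)
  simpa [truncate] using (lipschitzWith_clamp M).norm_sub_le (v.2 σ) (v.1 K)

theorem reconstruction_truncate {M : ℝ} (hM : 0 ≤ M) (v : D.X) (x : Space d) :
    D.reconstruction (D.truncate M v) x = clamp M (D.reconstruction v x) := by
  rw [D.comp_reconstruction v (clamp M) (clamp_zero hM)]
  rfl

end Discretisation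

theorem exists_hasZeroTraceGradient_clamp (hd : 0 < d) (hΩ : Bornology.IsBounded Ω)
    {D : ι → Discretisation Ω} [(sizeToZero D).NeBot] {θ : ℝ}
    (hθ : ∀ i, (D i).IsShapeRegular θ) {v : ∀ i, (D i).X} (hv : ∀ i, v i ∈ (D i).X0) {C : ℝ}
    (hC : ∀ i, (D i).seminormX (v i) ≤ C) {u : Space d → ℝ} (hu : MemL2 Ω u)
    (hlim : Tendsto (fun i => normL2 Ω fun x => (D i).reconstruction (v i) x - u x)
      (sizeToZero D) (𝓝 0)) {M : ℝ} (hM : 0 ≤ M) :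
    ∃ H, HasZeroTraceGradient Ω (fun x => clamp M (u x)) H ∧
      normL2 Ω H ≤ Real.toNNReal √(((2 + 4 * d * θ ^ 2) * d + 4) * C ^ 2) := by
  have hlim_clamp : Tendsto (fun i => normL2 Ω fun x =>
      (D i).reconstruction ((D i).truncate M (v i)) x - clamp M (u x)) (sizeToZero D) (𝓝 0) := by
    simpa only [(D _).reconstruction_truncate hM] using
      tendsto_normL2_comp_sub (lipschitzWith_clamp M) hlim
  obtain ⟨H, hH, hHC, -⟩ := exists_weakLimit_discreteGradient hd hΩ hθ
    (fun i => (D i).truncate_mem_X0 hM (hv i))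
    (fun i => ((D i).seminormX_truncate_le M (v i)).trans (hC i)) (hu.clamp_comp hM) hlim_clamp
  exact ⟨H, hH, hHC⟩

theorem HasZeroTraceGradient.congr_ae {u u' : Space d → ℝ} {G : Space d → Space d}
    (h : HasZeroTraceGradient Ω u G) (huu' : u =ᵐ[volume.restrict Ω] u') :
    HasZeroTraceGradient Ω u' G :=
  ⟨MemLp.ae_eq huu' h.1, h.2.1, fun φ hφ hφc e => (h.2.2 φ hφ hφc e).trans
    (congrArg Neg.neg (integral_congr_ae (huu'.mono fun x hx => by simp only [hx])))⟩

theorem HasZeroTraceGradient.isTestLimit_of_clamp (hΩ : IsPolyhedral Ω) {u : Space d → ℝ}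
    {G : Space d → Space d} (hG : HasZeroTraceGradient Ω u G) {C : ℝ≥0}
    (h : ∀ n : ℕ, ∃ H, HasZeroTraceGradient Ω (fun x => clamp n (u x)) H ∧ normL2 Ω H ≤ C) :
    IsTestLimit Ω u G := by
  choose H hH hHC using h
  obtain ⟨u', hu', hu'0, huu'⟩ : ∃ u' : Space d → ℝ, Measurable u' ∧ (∀ x, x ∉ Ω → u' x = 0) ∧
      u =ᵐ[volume.restrict Ω] u' := by
    have hum : AEStronglyMeasurable u (volume.restrict Ω) := hG.1.1
    refine ⟨Ω.indicator (hum.mk u), hum.stronglyMeasurable_mk.measurable.indicator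
      hΩ.isOpen.measurableSet, fun x hx => Set.indicator_of_notMem hx _, ?_⟩
    exact hum.ae_eq_mk.trans (indicator_ae_eq_restrict hΩ.isOpen.measurableSet).symm
  have hH' : ∀ n : ℕ, HasZeroTraceGradient Ω (fun x => clamp n (u' x)) (H n) := fun n =>
    (hH n).congr_ae (huu'.fun_comp (clamp n))
  refine isTestLimit_of_tendsto (l := atTop) hH' (fun n => ?_) hG ?_ hHC
  · refine (hH' n).isTestLimit_of_bounded hΩ
      ((lipschitzWith_clamp n).continuous.measurable.comp hu') (M := n) (fun x => ?_)
      fun x hx => by rw [hu'0 x hx, clamp_zero n.cast_nonneg]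
    rw [enorm_le_coe, ← NNReal.coe_le_coe]
    exact abs_clamp_le n.cast_nonneg _
  · refine (tendsto_normL2_clamp_sub hG.1).congr fun n => eLpNorm_congr_ae ?_
    exact huu'.mono fun x hx => by simp only [hx]

end Convergence

end HybridFV

end

theorem lemma4p2_general {d : ℕ} (hd : 0 < d) {Ω : Set (HybridFV.Space d)}
    (hΩ : HybridFV.IsPolyhedral Ω) {ι : Type*} {D : ι → HybridFV.Discretisation Ω}
    (hsize : ∀ δ : ℝ, 0 < δ → ∃ i, (D i).size < δ)
    {θ : ℝ} (hθ : ∀ i, (D i).IsShapeRegular θ)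
    {v : ∀ i, (D i).X} (hv : ∀ i, v i ∈ (D i).X0)
    {C : ℝ} (hC : ∀ i, (D i).seminormX (v i) ≤ C)
    {u : HybridFV.Space d → ℝ} (hu : HybridFV.MemL2 Ω u)
    (hlim : Tendsto
      (fun i => HybridFV.normL2 Ω fun x => (D i).reconstruction (v i) x - u x)
      (HybridFV.sizeToZero D) (𝓝 0)) :
    HybridFV.MemH10 Ω u ∧ ∃ G : HybridFV.Space d → HybridFV.Space d,
      HybridFV.HasWeakGradient Ω u G ∧
      HybridFV.WeaklyTendstoL2 Ω (fun i => (D i).discreteGradient (v i))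
        (HybridFV.sizeToZero D) G := by
  have := HybridFV.neBot_sizeToZero hsize
  obtain ⟨G, hG, -, hweak⟩ :=
    HybridFV.exists_weakLimit_discreteGradient hd hΩ.isBounded hθ hv hC hu hlim
  have htest : HybridFV.IsTestLimit Ω u G := hG.isTestLimit_of_clamp hΩ fun _ =>
    HybridFV.exists_hasZeroTraceGradient_clamp hd hΩ.isBounded hθ hv hC hu hlim (Nat.cast_nonneg _)
  exact ⟨htest.memH10 hG.hasWeakGradient, G, hG.hasWeakGradient, hweak⟩

theorem lemma4p2 {d : ℕ} (hd : 0 < d) (Ω : Set (HybridFV.Space d))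
    (hΩ : HybridFV.IsPolyhedralDomain Ω) {ι : Type*} (D : ι → HybridFV.Discretisation Ω)
    (hsize : ∀ δ : ℝ, 0 < δ → ∃ i, (D i).size < δ)
    (hreg : ∃ θ : ℝ, 0 < θ ∧ ∀ i, (D i).regularity ≤ θ)
    (v : ∀ i, (D i).X) (hv : ∀ i, v i ∈ (D i).X0)
    (hbound : ∃ C : ℝ, 0 < C ∧ ∀ i, (D i).seminormX (v i) ≤ C)
    (u : HybridFV.Space d → ℝ) (hu : HybridFV.MemL2 Ω u)
    (hlim : Tendsto
      (fun i => HybridFV.normL2 Ω fun x => (D i).reconstruction (v i) x - u x)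
      (HybridFV.sizeToZero D) (𝓝 0)) :
    HybridFV.MemH10 Ω u ∧ ∃ G : HybridFV.Space d → HybridFV.Space d,
      HybridFV.HasWeakGradient Ω u G ∧
      HybridFV.WeaklyTendstoL2 Ω (fun i => (D i).discreteGradient (v i))
        (HybridFV.sizeToZero D) G := by
  obtain ⟨θ, -, hθ⟩ := hreg
  obtain ⟨C, -, hC⟩ := hbound
  exact lemma4p2_general hd hΩ.isPolyhedral hsize
    (fun i => (D i).isShapeRegular_of_regularity_le (hθ i)) hv hC hu hlim
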